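/- Let $N\ge 0$ and $m\ge 1$ be integers. Let $S_N^C$ be the Weyl group of type $C_N$ with simple reflections $s_1,\dots,s_N$ (the bond between $s_{N-1}$ and $s_N$ being the one of order $4$) and $S_N=\langle s_1,\dots,s_{N-1}\rangle$. Let $\mathcal H$ be the Iwahori--Hecke algebra of $S_N^C$ over $\mathbb C[t^{\pm1}]$ with generators $T_1,\dots,T_N$, the braid relations and $(T_i-t)(T_i+t^{-1})=0$ for $i<N$, $(T_N-t_N)(T_N+t_N^{-1})=0$, where $t_N=t^m$ (Case B). The bar involution of $\mathcal H$ is the ring homomorphism with $t\mapsto t^{-1}$, $T_i\mapsto T_i^{-1}$, fixing $\mathbb C$. Let $\mathcal M^-$ be the free $\mathbb C[t^{\pm1}]$-module with basis $m_\alpha$, $\alpha=\alpha_1\cdots\alpha_N\in\{1,2\}^N$, on which $\mathcal H$ acts as follows. For $i<N$, $T_im_\alpha$ equals $-t^{-1}m_\alpha$ if $\alpha_i=\alpha_{i+1}$, $m_{s_i\alpha}$ if $\alpha_i<\alpha_{i+1}$, and $m_{s_i\alpha}+(t-t^{-1})m_\alpha$ if $\alpha_i>\alpha_{i+1}$; $T_Nm_\alpha$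 equals $m_{s_N\alpha}$ if $\alpha_N=1$ and $m_{s_N\alpha}+(t^m-t^{-m})m_\alpha$ if $\alpha_N=2$. Here $s_i$ ($i<N$) exchanges $\alpha_i$ and $\alpha_{i+1}$, and $s_N$ changes the letter $\alpha_N$. If the letters $2$ of $\alpha$ stand at the places $i_1<\dots<i_r$, then $w(\alpha)=(s_{i_r}\cdots s_N)\cdots(s_{i_1}\cdots s_N)$ is a reduced expression of the minimal representative of the corresponding coset in $S_N^C/S_N$, and $m_\alpha=T_{w(\alpha)}m_{1\cdots1}$. Write $\alpha\le\beta$ if $w(\alpha)\le w(\beta)$ in the Bruhat order. Let $\mathbf t^{l(\alpha)}$ be the product of the parameters ($t$ for $s_1,\dots,s_{N-1}$ and $t^m$ for $s_N$) along this expression, and write $\mathbf t^{l(\alpha)-l(\beta)}=\mathbf t^{l(\alpha)}/\mathbf t^{l(\beta)}$. The bar involution of $\mathcal M^-$ is the semilinear map with $\overline{m_\alpha}=\overline{T_{w(\alpha)}}\,m_{1\cdots1}$. The parabolic Kazhdan--Lusztig basis of $\mathcal M^-$ is the unique basis $(C^-_\beta)$ with $\overline{C^-_\beta}=C^-_\beta$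 and $C^-_\beta=\sum_{\alpha\le\beta}\mathbf t^{l(\alpha)-l(\beta)}P^-_{\alpha,\beta}\,m_\alpha$, where $P^-_{\beta,\beta}=1$ and $\mathbf t^{l(\alpha)-l(\beta)}P^-_{\alpha,\beta}\in t^{-1}\mathbb Z[t^{-1}]$ for $\alpha<\beta$. The link pattern of $\beta\in\{1,2\}^N$ is built thus. Repeatedly join a $2$ and a $1$ (in this order) that are adjacent by an arc, and remove them, until no such pair is left; the remaining letters are called unpaired. For $1\le j\le m$, the $j$-th unpaired $2$ from the right gets the integer $m+1-j$. For $j\ge m+1$ with $j-m+1$ even, the $j$-th and $(j+1)$-st unpaired $2$'s from the right, if both exist, are joined by a dotted line. All unpaired $1$'s, and the unpaired $2$ left over (there is at most one), are circled. Identify $\mathcal M^-$ with $V^{\otimes N}$, where $V$ is free with basis $|1\rangle,|2\rangle$, by $m_\alpha=|\alpha_1\cdots\alpha_N\rangle$. Let $\varpi^B(\beta)$ be the tensor product, over the blocks of the link pattern and in the corresponding tensor places, of the vectors: $|21\rangle+t^{-1}|12\rangle$ for an arc; $|2\rangle+(-1)^{m-p}t^{-p}|1\rangle$ for an unpaired $2$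 with the integer $p$; $|22\rangle+t^{-1}|11\rangle$ for a dotted line; $|x\rangle$ for a circled letter $x$. Theorem. The vectors $\varpi^B(\beta)$, $\beta\in\{1,2\}^N$, are the parabolic Kazhdan--Lusztig basis: they form a basis of $\mathcal M^-$ with the properties above (with $P^-_{\alpha,\beta}\in\mathbb Z[t]$), any basis with these properties equals it, and so $\varpi^B(\beta)=C^-_\beta$ for all $\beta$. -/

import Mathlib

open scoped LaurentPolynomial

noncomputable section

namespace ParabolicKL

/-! ### Ground ring, the group of type `C_N` and the Bruhat order -/

/-- The ring `ℂ[t, t⁻¹]`; the element `t ^ n` is `LaurentPolynomial.T n`. -/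
abbrev Ground : Type := ℂ[T;T⁻¹]

/-- The element `t ^ n` of the ground ring. -/
abbrev tp (n : ℤ) : Ground := LaurentPolynomial.T n

/-- The finite Weyl group of type `C_N`.  Its simple reflections are indexed by `Fin N`
(`s_1, …, s_N` become `0, …, N - 1`), the last one being the special reflection `s_N`. -/
abbrev WeylC (N : ℕ) : Type := (CoxeterMatrix.B N).Group

/-- The Coxeter system `(S_N^C, {s_1, …, s_N})`. -/
abbrev weylSystem (N : ℕ) : CoxeterSystem (CoxeterMatrix.B N) (WeylC N) :=
  (CoxeterMatrix.B N).toCoxeterSystem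

/-- The strong Bruhat order: `u ≤ w` if `u` is the product of a subexpression of a reduced
expression of `w`. -/
def BruhatLE {N : ℕ} (u w : WeylC N) : Prop :=
  ∃ ω : List (Fin N), (weylSystem N).IsReduced ω ∧ (weylSystem N).wordProd ω = w ∧
    ∃ ω' : List (Fin N), ω'.Sublist ω ∧ (weylSystem N).wordProd ω' = u

/-- The exponent of the Hecke parameter of the `i`-th generator: the parameter is `t` for the
generators `T_1, …, T_{N-1}` and `t_N = t ^ m` for `T_N`. -/
def wt (N m : ℕ) (i : Fin N) : ℤ := if (i : ℕ) + 1 < N then 1 else m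

/-! ### The Hecke algebra with parameters `(t, t ^ m)` and its bar involution -/

/-- The defining relations of the Iwahori–Hecke algebra of type `B_N` with `t_N = t ^ m`. -/
inductive HeckeRel (N m : ℕ) :
    FreeAlgebra Ground (Fin N) → FreeAlgebra Ground (Fin N) → Prop
  | quadratic (i : Fin N) : HeckeRel N m
      ((FreeAlgebra.ι Ground i - algebraMap _ _ (tp (wt N m i))) *
        (FreeAlgebra.ι Ground i + algebraMap _ _ (tp (-wt N m i)))) 0
  | braid_three (i j : Fin N) (hij : (i : ℕ) + 1 = j) (hj : (j : ℕ) + 1 < N) : HeckeRel N m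
      (FreeAlgebra.ι Ground i * FreeAlgebra.ι Ground j * FreeAlgebra.ι Ground i)
      (FreeAlgebra.ι Ground j * FreeAlgebra.ι Ground i * FreeAlgebra.ι Ground j)
  | braid_four (i j : Fin N) (hij : (i : ℕ) + 1 = j) (hj : (j : ℕ) + 1 = N) : HeckeRel N m
      (FreeAlgebra.ι Ground i * FreeAlgebra.ι Ground j * FreeAlgebra.ι Ground i *
        FreeAlgebra.ι Ground j)
      (FreeAlgebra.ι Ground j * FreeAlgebra.ι Ground i * FreeAlgebra.ι Ground j *
        FreeAlgebra.ι Ground i)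
  | comm (i j : Fin N) (hij : (i : ℕ) + 1 < j) : HeckeRel N m
      (FreeAlgebra.ι Ground i * FreeAlgebra.ι Ground j)
      (FreeAlgebra.ι Ground j * FreeAlgebra.ι Ground i)

/-- The Iwahori–Hecke algebra of type `B_N` with parameters `(t, t_N) = (t, t ^ m)`. -/
def Hecke (N m : ℕ) : Type := RingQuot (HeckeRel N m)

instance (N m : ℕ) : Ring (Hecke N m) := inferInstanceAs (Ring (RingQuot (HeckeRel N m)))

instance (N m : ℕ) : Algebra Ground (Hecke N m) :=
  inferInstanceAs (Algebra Ground (RingQuot (HeckeRel N m)))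

/-- The quotient map from the free algebra. -/
def heckeMk (N m : ℕ) : FreeAlgebra Ground (Fin N) →ₐ[Ground] Hecke N m :=
  RingQuot.mkAlgHom Ground (HeckeRel N m)

theorem heckeMk_rel (N m : ℕ) {x y : FreeAlgebra Ground (Fin N)} (h : HeckeRel N m x y) :
    heckeMk N m x = heckeMk N m y :=
  RingQuot.mkAlgHom_rel Ground h

/-- The universal property of the Hecke algebra. -/
def heckeLift {N m : ℕ} {B : Type} [Ring B] [Algebra Ground B]
    (f : FreeAlgebra Ground (Fin N) →ₐ[Ground] B)
    (hf : ∀ ⦃x y⦄, HeckeRel N m x y → f x = f y) : Hecke N m →ₐ[Ground] B :=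
  RingQuot.liftAlgHom Ground ⟨f, hf⟩

theorem heckeLift_mk {N m : ℕ} {B : Type} [Ring B] [Algebra Ground B]
    (f : FreeAlgebra Ground (Fin N) →ₐ[Ground] B)
    (hf : ∀ ⦃x y⦄, HeckeRel N m x y → f x = f y) (x : FreeAlgebra Ground (Fin N)) :
    heckeLift f hf (heckeMk N m x) = f x :=
  RingQuot.liftAlgHom_mkAlgHom_apply Ground f hf x

/-- The generator `T_i` of the Hecke algebra. -/
def gen (N m : ℕ) (i : Fin N) : Hecke N m :=
  heckeMk N m (FreeAlgebra.ι Ground i)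

theorem gen_quadratic (N m : ℕ) (i : Fin N) :
    (gen N m i - algebraMap _ _ (tp (wt N m i))) *
      (gen N m i + algebraMap _ _ (tp (-wt N m i))) = 0 := by
  have h := heckeMk_rel N m (HeckeRel.quadratic (m := m) i)
  simpa [gen] using h

theorem gen_braid_three (N m : ℕ) (i j : Fin N) (hij : (i : ℕ) + 1 = j) (hj : (j : ℕ) + 1 < N) :
    gen N m i * gen N m j * gen N m i = gen N m j * gen N m i * gen N m j := by
  have h := heckeMk_rel N m (HeckeRel.braid_three (m := m) i j hij hj)
  simpa [gen] using h

theorem gen_braid_four (N m : ℕ) (i j : Fin N) (hij : (i : ℕ) + 1 = j) (hj : (j : ℕ) + 1 = N) :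
    gen N m i * gen N m j * gen N m i * gen N m j =
      gen N m j * gen N m i * gen N m j * gen N m i := by
  have h := heckeMk_rel N m (HeckeRel.braid_four (m := m) i j hij hj)
  simpa [gen] using h

theorem gen_comm (N m : ℕ) (i j : Fin N) (hij : (i : ℕ) + 1 < j) :
    gen N m i * gen N m j = gen N m j * gen N m i := by
  have h := heckeMk_rel N m (HeckeRel.comm (m := m) i j hij)
  simpa [gen] using h

theorem tp_mul_neg (n : ℤ) : tp n * tp (-n) = 1 := by
  rw [← LaurentPolynomial.T_add]; simp

/-- The inverse `T_i⁻¹ = T_i - (t_i - t_i⁻¹)` of a generator. -/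
def genInv (N m : ℕ) (i : Fin N) : Hecke N m :=
  gen N m i - algebraMap _ _ (tp (wt N m i) - tp (-wt N m i))

theorem gen_mul_genInv (N m : ℕ) (i : Fin N) : gen N m i * genInv N m i = 1 := by
  have h := gen_quadratic N m i
  have h1 : (algebraMap Ground (Hecke N m)) (tp (wt N m i)) *
      (algebraMap Ground (Hecke N m)) (tp (-wt N m i)) = 1 := by
    rw [← map_mul, tp_mul_neg, map_one]
  have hc := Algebra.commutes (tp (wt N m i)) (gen N m i)
  have h2 : (gen N m i - algebraMap _ _ (tp (wt N m i))) *
      (gen N m i + algebraMap _ _ (tp (-wt N m i))) = gen N m i * genInv N m i - 1 := by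
    rw [genInv, map_sub, ← h1, sub_mul, mul_add, mul_add, hc, mul_sub, mul_sub]
    abel
  rw [h2] at h
  exact sub_eq_zero.mp h

theorem genInv_mul_gen (N m : ℕ) (i : Fin N) : genInv N m i * gen N m i = 1 := by
  rw [← gen_mul_genInv N m i, genInv, sub_mul, mul_sub, Algebra.commutes]

/-- A generator as a unit of the Hecke algebra. -/
def genUnit (N m : ℕ) (i : Fin N) : (Hecke N m)ˣ :=
  ⟨gen N m i, genInv N m i, gen_mul_genInv N m i, genInv_mul_gen N m i⟩

/-- A copy of the Hecke algebra, as an algebra over the ground ring through `t ↦ t⁻¹`. -/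
def TwistedHecke (N m : ℕ) : Type := Hecke N m

instance (N m : ℕ) : Ring (TwistedHecke N m) := inferInstanceAs (Ring (Hecke N m))

instance (N m : ℕ) : Algebra Ground (TwistedHecke N m) :=
  Algebra.compHom (Hecke N m) (LaurentPolynomial.invert (R := ℂ)).toRingEquiv.toRingHom

/-- The homomorphism from the free algebra with `T_i ↦ T_i⁻¹` and `t ↦ t⁻¹`. -/
def freeBar (N m : ℕ) : FreeAlgebra Ground (Fin N) →ₐ[Ground] TwistedHecke N m :=
  FreeAlgebra.lift Ground fun i => (genInv N m i : Hecke N m)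

theorem genUnit_inv_quadratic (N m : ℕ) (i : Fin N) :
    (genInv N m i - algebraMap _ _ (tp (-wt N m i))) *
      (genInv N m i + algebraMap _ _ (tp (wt N m i))) = 0 := by
  have h := gen_quadratic N m i
  have e1 : genInv N m i - algebraMap _ _ (tp (-wt N m i)) =
      gen N m i - algebraMap _ _ (tp (wt N m i)) := by
    rw [genInv, map_sub]; abel
  have e2 : genInv N m i + algebraMap _ _ (tp (wt N m i)) =
      gen N m i + algebraMap _ _ (tp (-wt N m i)) := by
    rw [genInv, map_sub]; abel
  rw [e1, e2, h]

theorem freeBar_ι (N m : ℕ) (i : Fin N) :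
    freeBar N m (FreeAlgebra.ι Ground i) = (genInv N m i : Hecke N m) :=
  FreeAlgebra.lift_ι_apply _ _

theorem freeBar_algebraMap (N m : ℕ) (c : Ground) :
    freeBar N m (algebraMap _ _ c) =
      (algebraMap Ground (Hecke N m) (LaurentPolynomial.invert c) : Hecke N m) :=
  (freeBar N m).commutes c

theorem freeBar_rel (N m : ℕ) ⦃x y : FreeAlgebra Ground (Fin N)⦄ (h : HeckeRel N m x y) :
    freeBar N m x = freeBar N m y := by
  have hmap (n : ℤ) : freeBar N m (algebraMap _ _ (tp n)) =
      (algebraMap Ground (Hecke N m) (tp (-n)) : Hecke N m) := by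
    rw [freeBar_algebraMap, LaurentPolynomial.invert_T]
  cases h with
  | quadratic i =>
    rw [map_mul, map_sub, map_add, map_zero, freeBar_ι, hmap, hmap, neg_neg]
    exact genUnit_inv_quadratic N m i
  | braid_three i j hij hj =>
    have h := congrArg (fun u : (Hecke N m)ˣ => ((u⁻¹ : (Hecke N m)ˣ) : Hecke N m))
      (show genUnit N m i * genUnit N m j * genUnit N m i =
        genUnit N m j * genUnit N m i * genUnit N m j from
        Units.ext (gen_braid_three N m i j hij hj))
    simp only [mul_inv_rev, ← mul_assoc, Units.val_mul] at h
    simp only [map_mul, freeBar_ι]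
    exact h
  | braid_four i j hij hj =>
    have h := congrArg (fun u : (Hecke N m)ˣ => ((u⁻¹ : (Hecke N m)ˣ) : Hecke N m))
      (show genUnit N m i * genUnit N m j * genUnit N m i * genUnit N m j =
        genUnit N m j * genUnit N m i * genUnit N m j * genUnit N m i from
        Units.ext (gen_braid_four N m i j hij hj))
    simp only [mul_inv_rev, ← mul_assoc, Units.val_mul] at h
    simp only [map_mul, freeBar_ι]
    exact h.symm
  | comm i j hij =>
    have h := congrArg (fun u : (Hecke N m)ˣ => ((u⁻¹ : (Hecke N m)ˣ) : Hecke N m))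
      (show genUnit N m i * genUnit N m j = genUnit N m j * genUnit N m i from
        Units.ext (gen_comm N m i j hij))
    simp only [mul_inv_rev, Units.val_mul] at h
    simp only [map_mul, freeBar_ι]
    exact h.symm

/-- The bar involution of the Hecke algebra: the ring homomorphism with `T_i ↦ T_i⁻¹` and
`t ↦ t⁻¹`. -/
def heckeBar (N m : ℕ) : Hecke N m →+* Hecke N m :=
  (heckeLift (freeBar N m) (freeBar_rel N m)).toRingHom

theorem heckeBar_gen (N m : ℕ) (i : Fin N) : heckeBar N m (gen N m i) = genInv N m i :=
  (heckeLift_mk (freeBar N m) (freeBar_rel N m) _).trans (freeBar_ι N m i)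

theorem heckeBar_algebraMap (N m : ℕ) (c : Ground) :
    heckeBar N m (algebraMap _ _ c) = algebraMap _ _ (LaurentPolynomial.invert c) :=
  (heckeLift (freeBar N m) (freeBar_rel N m)).commutes c

/-! ### Binary strings and the module `M⁻` -/

/-- The letters `1` and `2`; the order `1 < 2` is `false < true`. -/
abbrev Letter : Type := Bool

/-- The letter `1`. -/
abbrev one : Letter := false

/-- The letter `2`. -/
abbrev two : Letter := true

/-- Binary strings `α_1 … α_N`; the letter `α_i` is the value at `i - 1`. -/
abbrev Str (N : ℕ) : Type := Fin N → Letter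

/-- The string `s_i · α`: for `i < N` exchange `α_i` and `α_{i+1}`, for `i = N` replace `α_N` by
the other letter. -/
def strRefl {N : ℕ} (i : Fin N) (α : Str N) : Str N :=
  if h : (i : ℕ) + 1 < N then α ∘ Equiv.swap i ⟨i + 1, h⟩ else Function.update α i (!α i)

/-- The module `M⁻`, free over the ground ring with basis indexed by binary strings, as the module
of coefficient families; it is `V^{⊗ N}` with `V` free of rank two. -/
abbrev MMinus (N : ℕ) : Type := Str N → Ground

/-- The standard basis element `m_α`. -/
def ket {N : ℕ} (α : Str N) : MMinus N := Pi.single α 1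

/-- The vector `T_i m_α`. -/
def actBasis (N m : ℕ) (i : Fin N) (α : Str N) : MMinus N :=
  if h : (i : ℕ) + 1 < N then
    if α i = α ⟨i + 1, h⟩ then -tp (-1) • ket α
    else if α i < α ⟨i + 1, h⟩ then ket (strRefl i α)
    else ket (strRefl i α) + (tp 1 - tp (-1)) • ket α
  else
    if α i = one then ket (strRefl i α)
    else ket (strRefl i α) + (tp m - tp (-m)) • ket α

/-- The linear operator by which `T_i` acts on `M⁻`. -/
def genOp (N m : ℕ) (i : Fin N) : Module.End Ground (MMinus N) :=
  (Pi.basisFun Ground (Str N)).constr Ground (actBasis N m i)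

theorem genOp_ket (N m : ℕ) (i : Fin N) (α : Str N) :
    genOp N m i (ket α) = actBasis N m i α := by
  have := (Pi.basisFun Ground (Str N)).constr_basis Ground (actBasis N m i) α
  simpa only [genOp, ket, Pi.basisFun_apply] using this

theorem ketExt {N : ℕ} {f g : Module.End Ground (MMinus N)} (h : ∀ α, f (ket α) = g (ket α)) :
    f = g :=
  (Pi.basisFun Ground (Str N)).ext fun α => by simpa [ket] using h α

theorem strRefl_apply_lt {N : ℕ} (i j : Fin N) (hij : (i : ℕ) + 1 = j) (α : Str N) (k : Fin N) :
    strRefl i α k = if k = i then α j else if k = j then α i else α k := by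
  have h : (i : ℕ) + 1 < N := by omega
  obtain rfl : j = ⟨i + 1, h⟩ := Fin.ext hij.symm
  simp only [strRefl, h, dite_true, Function.comp_apply, Equiv.swap_apply_def]
  split_ifs <;> rfl

theorem strRefl_apply_last {N : ℕ} (i : Fin N) (hi : (i : ℕ) + 1 = N) (α : Str N) (k : Fin N) :
    strRefl i α k = if k = i then !α i else α k := by
  simp [strRefl, hi, Function.update_apply]

theorem strRefl_strRefl {N : ℕ} (i : Fin N) (α : Str N) : strRefl i (strRefl i α) = α := by
  unfold strRefl
  split_ifs with h
  · funext k; simp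
  · simp

theorem genOp_lt (N m : ℕ) (i j : Fin N) (hij : (i : ℕ) + 1 = j) (α : Str N) :
    genOp N m i (ket α) =
      if α i = α j then -tp (-1) • ket α
      else if α i < α j then ket (strRefl i α)
      else ket (strRefl i α) + (tp 1 - tp (-1)) • ket α := by
  have h : (i : ℕ) + 1 < N := by omega
  obtain rfl : j = ⟨i + 1, h⟩ := Fin.ext hij.symm
  rw [genOp_ket, actBasis, dif_pos h]

theorem genOp_last (N m : ℕ) (i : Fin N) (hi : (i : ℕ) + 1 = N) (α : Str N) :
    genOp N m i (ket α) =
      if α i = one then ket (strRefl i α)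
      else ket (strRefl i α) + (tp m - tp (-m)) • ket α := by
  rw [genOp_ket, actBasis, dif_neg (by omega)]

theorem genOp_eq (N m : ℕ) (i j : Fin N) (hij : (i : ℕ) + 1 = j) (α : Str N) (h : α i = α j) :
    genOp N m i (ket α) = -tp (-1) • ket α := by
  rw [genOp_lt N m i j hij, if_pos h]

theorem genOp_up (N m : ℕ) (i j : Fin N) (hij : (i : ℕ) + 1 = j) (α : Str N)
    (hi : α i = one) (hj : α j = two) : genOp N m i (ket α) = ket (strRefl i α) := by
  rw [genOp_lt N m i j hij, if_neg (by simp [hi, hj]), if_pos (by simp [hi, hj])]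

theorem genOp_down (N m : ℕ) (i j : Fin N) (hij : (i : ℕ) + 1 = j) (α : Str N)
    (hi : α i = two) (hj : α j = one) :
    genOp N m i (ket α) = ket (strRefl i α) + (tp 1 - tp (-1)) • ket α := by
  rw [genOp_lt N m i j hij, if_neg (by simp [hi, hj]), if_neg (by simp [hi, hj])]

theorem genOp_last_up (N m : ℕ) (i : Fin N) (hi : (i : ℕ) + 1 = N) (α : Str N)
    (h : α i = one) : genOp N m i (ket α) = ket (strRefl i α) := by
  rw [genOp_last N m i hi, if_pos h]

theorem genOp_last_down (N m : ℕ) (i : Fin N) (hi : (i : ℕ) + 1 = N) (α : Str N)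
    (h : α i = two) :
    genOp N m i (ket α) = ket (strRefl i α) + (tp m - tp (-m)) • ket α := by
  rw [genOp_last N m i hi, if_neg (by simp [h])]

theorem act_quadratic (N m : ℕ) (i : Fin N) (α : Str N) :
    genOp N m i (genOp N m i (ket α) + tp (-wt N m i) • ket α) -
      tp (wt N m i) • (genOp N m i (ket α) + tp (-wt N m i) • ket α) = 0 := by
  by_cases h : (i : ℕ) + 1 < N
  · obtain ⟨j, hij⟩ : ∃ j : Fin N, (i : ℕ) + 1 = j := ⟨⟨i + 1, h⟩, rfl⟩
    have hne : j ≠ i := by simp only [ne_eq, Fin.ext_iff]; omega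
    have e : tp 1 * tp (-1) = 1 := tp_mul_neg 1
    have hw : wt N m i = 1 := if_pos h
    have h1 := genOp_eq N m i j hij
    have h2 := genOp_up N m i j hij
    have h3 := genOp_down N m i j hij
    have h4 := strRefl_apply_lt i j hij
    rw [hw]
    generalize tp 1 = q at *
    generalize tp (-1) = r at *
    cases ha : α i <;> cases hb : α j <;>
    simp only [map_add, map_smul, ha, hb, h1, h2, h3, h4, hne, if_true, if_false,
      strRefl_strRefl]
    all_goals first
      | module
      | linear_combination (norm := module) (-e) • ket α
  · have hi : (i : ℕ) + 1 = N := by omega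
    have e : tp m * tp (-m) = 1 := tp_mul_neg m
    have hw : wt N m i = m := if_neg h
    have h2 := genOp_last_up N m i hi
    have h3 := genOp_last_down N m i hi
    have h4 := strRefl_apply_last i hi
    rw [hw]
    generalize tp m = q at *
    generalize tp (-m) = r at *
    cases ha : α i <;>
    simp only [map_add, map_smul, ha, h2, h3, h4, if_true, strRefl_strRefl, Bool.not_false,
      Bool.not_true] <;>
    linear_combination (norm := module) (-e) • ket α

theorem act_braid_three (N m : ℕ) (i j : Fin N) (hij : (i : ℕ) + 1 = j) (hj : (j : ℕ) + 1 < N)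
    (α : Str N) : genOp N m i (genOp N m j (genOp N m i (ket α))) =
      genOp N m j (genOp N m i (genOp N m j (ket α))) := by
  obtain ⟨k, hjk⟩ : ∃ k : Fin N, (j : ℕ) + 1 = k := ⟨⟨j + 1, hj⟩, rfl⟩
  have n1 : j ≠ i := by simp only [ne_eq, Fin.ext_iff]; omega
  have n2 : k ≠ i := by simp only [ne_eq, Fin.ext_iff]; omega
  have n3 : k ≠ j := by simp only [ne_eq, Fin.ext_iff]; omega
  have h4 := strRefl_apply_lt i j hij
  have h5 := strRefl_apply_lt j k hjk
  have e : tp 1 * tp (-1) = 1 := tp_mul_neg 1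
  have h1 := genOp_eq N m i j hij
  have h2 := genOp_up N m i j hij
  have h3 := genOp_down N m i j hij
  have g1 := genOp_eq N m j k hjk
  have g2 := genOp_up N m j k hjk
  have g3 := genOp_down N m j k hjk
  generalize tp 1 = q at *
  generalize tp (-1) = r at *
  cases ha : α i <;> cases hb : α j <;> cases hc : α k <;>
  simp only [map_add, map_smul, ha, hb, hc, h1, h2, h3, h4, h5, g1, g2, g3, n1, n2, n3,
    n1.symm, n2.symm, n3.symm, if_true, if_false, strRefl_strRefl]
  all_goals first
    | module
    | linear_combination (norm := module) (-(q - r) * e) • ket α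
    | linear_combination (norm := module) ((q - r) * e) • ket α

theorem act_braid_four (N m : ℕ) (i j : Fin N) (hij : (i : ℕ) + 1 = j) (hj : (j : ℕ) + 1 = N)
    (α : Str N) : genOp N m i (genOp N m j (genOp N m i (genOp N m j (ket α)))) =
      genOp N m j (genOp N m i (genOp N m j (genOp N m i (ket α)))) := by
  have n1 : j ≠ i := by simp only [ne_eq, Fin.ext_iff]; omega
  have h4 := strRefl_apply_lt i j hij
  have h5 := strRefl_apply_last j hj
  have e : tp 1 * tp (-1) = 1 := tp_mul_neg 1
  have h1 := genOp_eq N m i j hij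
  have h2 := genOp_up N m i j hij
  have h3 := genOp_down N m i j hij
  have g2 := genOp_last_up N m j hj
  have g3 := genOp_last_down N m j hj
  generalize tp 1 = q at *
  generalize tp (-1) = r at *
  generalize tp m = q' at *
  generalize tp (-m) = r' at *
  cases ha : α i <;> cases hb : α j <;>
  simp only [map_add, map_smul, ha, hb, h1, h2, h3, h4, h5, g2, g3, n1,
    n1.symm, if_true, if_false, strRefl_strRefl, Bool.not_false, Bool.not_true]
  all_goals first
    | module
    | linear_combination (norm := module) ((q' - r') * e) • ket (strRefl j α)
    | linear_combination (norm := module) (-(q' - r') * e) • ket (strRefl j α)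

theorem act_comm (N m : ℕ) (i j : Fin N) (hij : (i : ℕ) + 1 < j) (α : Str N) :
    genOp N m i (genOp N m j (ket α)) = genOp N m j (genOp N m i (ket α)) := by
  obtain ⟨i', hi'⟩ : ∃ k : Fin N, (i : ℕ) + 1 = k := ⟨⟨i + 1, by omega⟩, rfl⟩
  have n1 : j ≠ i := by simp only [ne_eq, Fin.ext_iff]; omega
  have n2 : j ≠ i' := by simp only [ne_eq, Fin.ext_iff]; omega
  have n3 : i' ≠ i := by simp only [ne_eq, Fin.ext_iff]; omega
  have h1 := genOp_eq N m i i' hi'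
  have h2 := genOp_up N m i i' hi'
  have h3 := genOp_down N m i i' hi'
  have h4 := strRefl_apply_lt i i' hi'
  by_cases h : (j : ℕ) + 1 < N
  · obtain ⟨j', hj'⟩ : ∃ k : Fin N, (j : ℕ) + 1 = k := ⟨⟨j + 1, h⟩, rfl⟩
    have n4 : j' ≠ i := by simp only [ne_eq, Fin.ext_iff]; omega
    have n5 : j' ≠ i' := by simp only [ne_eq, Fin.ext_iff]; omega
    have n6 : j' ≠ j := by simp only [ne_eq, Fin.ext_iff]; omega
    have g1 := genOp_eq N m j j' hj'
    have g2 := genOp_up N m j j' hj'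
    have g3 := genOp_down N m j j' hj'
    have g4 := strRefl_apply_lt j j' hj'
    have hs : strRefl i (strRefl j α) = strRefl j (strRefl i α) := by
      funext l
      simp only [h4, g4]
      by_cases l1 : l = i <;> by_cases l2 : l = j <;> by_cases l3 : l = i' <;>
        by_cases l4 : l = j' <;> grind
    cases ha : α i <;> cases hb : α j <;> cases hc : α i' <;> cases hd : α j' <;>
    simp only [map_add, map_smul, ha, hb, hc, hd, h1, h2, h3, h4, g1, g2, g3, g4, n1, n2,
      n4, n5, n1.symm, n2.symm, n4.symm, n5.symm, if_false, hs]
    all_goals module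
  · have hj : (j : ℕ) + 1 = N := by omega
    have g2 := genOp_last_up N m j hj
    have g3 := genOp_last_down N m j hj
    have g4 := strRefl_apply_last j hj
    have hs : strRefl i (strRefl j α) = strRefl j (strRefl i α) := by
      funext l
      simp only [h4, g4]
      by_cases l1 : l = i <;> by_cases l2 : l = j <;> by_cases l3 : l = i' <;> grind
    cases ha : α i <;> cases hb : α j <;> cases hc : α i' <;>
    simp only [map_add, map_smul, ha, hb, hc, h1, h2, h3, h4, g2, g3, g4, n1, n2,
      n1.symm, n2.symm, if_false, hs]
    all_goals module

theorem act_rel (N m : ℕ) ⦃x y : FreeAlgebra Ground (Fin N)⦄ (h : HeckeRel N m x y) :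
    FreeAlgebra.lift Ground (genOp N m) x = FreeAlgebra.lift Ground (genOp N m) y := by
  cases h with
  | quadratic i =>
    simp only [map_mul, map_sub, map_add, map_zero, FreeAlgebra.lift_ι_apply, AlgHom.commutes]
    exact ketExt fun α => act_quadratic N m i α
  | braid_three i j hij hj =>
    simp only [map_mul, FreeAlgebra.lift_ι_apply]
    exact ketExt fun α => act_braid_three N m i j hij hj α
  | braid_four i j hij hj =>
    simp only [map_mul, FreeAlgebra.lift_ι_apply]
    exact ketExt fun α => act_braid_four N m i j hij hj α
  | comm i j hij =>
    simp only [map_mul, FreeAlgebra.lift_ι_apply]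
    exact ketExt fun α => act_comm N m i j hij α

/-- The action of the Hecke algebra on `M⁻`. -/
def heckeAct (N m : ℕ) : Hecke N m →ₐ[Ground] Module.End Ground (MMinus N) :=
  heckeLift (FreeAlgebra.lift Ground (genOp N m)) (act_rel N m)

theorem heckeAct_gen (N m : ℕ) (i : Fin N) : heckeAct N m (gen N m i) = genOp N m i := by
  rw [heckeAct, gen, heckeLift_mk, FreeAlgebra.lift_ι_apply]

/-- The reduced word of the minimal coset representative `w⁻(α)`.  If the letters `2` of `α` stand
at the places `i_1 < … < i_r`, it is `(s_{i_r} ⋯ s_N) ⋯ (s_{i_2} ⋯ s_N)(s_{i_1} ⋯ s_N)`. -/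
def minWord {N : ℕ} (α : Str N) : List (Fin N) :=
  (((List.finRange N).filter fun i => α i = two).reverse).flatMap
    fun i => (List.finRange N).filter fun j => i ≤ j

/-- The minimal coset representative `w⁻(α)`. -/
def minRep {N : ℕ} (α : Str N) : WeylC N := (weylSystem N).wordProd (minWord α)

/-- The element `T_{w⁻(α)}` of the Hecke algebra. -/
def heckeMin (N m : ℕ) (α : Str N) : Hecke N m := ((minWord α).map (gen N m)).prod

/-- The order on strings: `α ≤ β` if `w⁻(α) ≤ w⁻(β)` in the Bruhat order. -/
def StrLE {N : ℕ} (α β : Str N) : Prop := BruhatLE (minRep α) (minRep β)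

/-- The exponent of `𝐭^{l(w⁻(α))} = t^{l'(w⁻(α)) + m l_N(w⁻(α))}`. -/
def wlen (N m : ℕ) (α : Str N) : ℤ := ((minWord α).map (wt N m)).sum

/-- The bar involution of `M⁻`.  It is the semilinear map (with respect to `t ↦ t⁻¹`) sending
`m_α = T_{w⁻(α)} m_{1…1}` to `\overline{T_{w⁻(α)}} m_{1…1}`. -/
def moduleBar (N m : ℕ) (v : MMinus N) : MMinus N :=
  ∑ α : Str N, LaurentPolynomial.invert (v α) •
    heckeAct N m (heckeBar N m (heckeMin N m α)) (ket fun _ => one)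

/-! ### The parabolic Kazhdan–Lusztig basis -/

/-- The set `ℤ(Γ_-)` of integral linear combinations of the elements `t ^ k` with `k < 0`. -/
def negPart : AddSubgroup Ground := AddSubgroup.closure {x | ∃ k : ℤ, k < 0 ∧ x = tp k}

open Classical in
/-- `C` is a parabolic Kazhdan–Lusztig basis of `M⁻` with Kazhdan–Lusztig polynomials `P x y`:
every `C y` is bar invariant and
`C y = ∑_{x ≤ y} 𝐭^{l(x) - l(y)} P_{x,y} m_x` with `P_{y,y} = 1` and
`𝐭^{l(x) - l(y)} P_{x,y} ∈ ℤ(Γ_-)` for `x < y`. -/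
structure IsParabolicKLBasis (N m : ℕ) (C : Module.Basis (Str N) Ground (MMinus N))
    (P : Str N → Str N → Ground) : Prop where
  bar_eq : ∀ y, moduleBar N m (C y) = C y
  expansion : ∀ y, C y =
    ∑ x ∈ Finset.univ.filter (fun x => StrLE x y),
      (tp (wlen N m x - wlen N m y) * P x y) • ket x
  diag : ∀ y, P y y = 1
  off_diag : ∀ x y, StrLE x y → x ≠ y → tp (wlen N m x - wlen N m y) * P x y ∈ negPart

/-! ### Link patterns and the map `ϖ` -/

/-- `Arc α i j`: the `2` at `i` and the `1` at `j` form a pair.  Pairs are formed by repeatedly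
joining a `2` and a `1` (in this order) that have become adjacent, and removing them: so all the
letters strictly between `i` and `j` have been paired before, among themselves. -/
inductive Arc {N : ℕ} (α : Str N) : Fin N → Fin N → Prop
  | mk (i j : Fin N) (hij : i < j) (hi : α i = two) (hj : α j = one)
      (partner : Fin N → Fin N)
      (between : ∀ k, i < k → k < j → i < partner k ∧ partner k < j)
      (left : ∀ k, i < k → k < j → α k = two → Arc α k (partner k))
      (right : ∀ k, i < k → k < j → α k = one → Arc α (partner k) k) : Arc α i j

/-- `α_i` is an unpaired `1`. -/
def UnpairedOne {N : ℕ} (α : Str N) (i : Fin N) : Prop := α i = one ∧ ∀ j, ¬ Arc α j i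

/-- `α_i` is an unpaired `2`. -/
def UnpairedTwo {N : ℕ} (α : Str N) (i : Fin N) : Prop := α i = two ∧ ∀ j, ¬ Arc α i j

open Classical in
/-- The unpaired `2` at `i` is the `rank α i`-th one counted from the right. -/
def rank {N : ℕ} (α : Str N) (i : Fin N) : ℕ :=
  (Finset.univ.filter fun k => i ≤ k ∧ UnpairedTwo α k).card

/-- `α_i` carries a vertical line with an integer: it is one of the `m` rightmost unpaired
`2`s.  The integer is `label m α i`. -/
def Labelled {N : ℕ} (m : ℕ) (α : Str N) (i : Fin N) : Prop := UnpairedTwo α i ∧ rank α i ≤ m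

/-- The integer `m + 1 - j` on the `j`-th unpaired `2` from the right, `1 ≤ j ≤ m`. -/
def label {N : ℕ} (m : ℕ) (α : Str N) (i : Fin N) : ℕ := m + 1 - rank α i

/-- The unpaired `2`s at `i < i'` are joined by a dotted line: they are the `(j + 1)`-th and the
`j`-th unpaired `2` from the right, where `j ≥ m + 1` and `j - m + 1` is even. -/
def Dotted {N : ℕ} (m : ℕ) (α : Str N) (i i' : Fin N) : Prop :=
  i < i' ∧ UnpairedTwo α i ∧ UnpairedTwo α i' ∧ rank α i = rank α i' + 1 ∧
    m + 1 ≤ rank α i' ∧ Even ((rank α i' : ℤ) - m + 1)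

/-- `α_i` carries a circled letter: it is an unpaired `1`, or an unpaired `2` which has no integer
and is not on a dotted line. -/
def Circled {N : ℕ} (m : ℕ) (α : Str N) (i : Fin N) : Prop :=
  UnpairedOne α i ∨
    (UnpairedTwo α i ∧ ¬ Labelled m α i ∧ ∀ k, ¬ Dotted m α i k ∧ ¬ Dotted m α k i)

/-- The vector `|x⟩` of `V`. -/
def ketOne (x : Letter) : Letter → Ground := Pi.single x 1

/-- The vector `|x y⟩` of `V ⊗ V`. -/
def ketTwo (x y : Letter) : Letter × Letter → Ground := Pi.single (x, y) 1

/-- The vector `|21⟩ + t⁻¹ |12⟩` of an arc. -/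
def arcVec : Letter × Letter → Ground := ketTwo two one + tp (-1) • ketTwo one two

/-- The vector `|2⟩ + (-1)^(m-p) t^(-p) |1⟩` of a vertical line with the integer `p`. -/
def labelVec (m p : ℕ) : Letter → Ground :=
  ketOne two + ((-1) ^ (m - p) * tp (-(p : ℤ))) • ketOne one

/-- The vector `|22⟩ + t⁻¹ |11⟩` of a dotted line. -/
def dottedVec : Letter × Letter → Ground := ketTwo two two + tp (-1) • ketTwo one one

open Classical in
/-- The vector `ϖ(β)` of the link pattern of `β`: the tensor product of the vectors of its building
blocks.  Its coefficient at `m_α` is the product, over all blocks, of the coefficients of the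
vector of the block at the letters of `α` in the places of the block. -/
def varpi (N m : ℕ) (β : Str N) : MMinus N := fun α =>
  (∏ p ∈ Finset.univ.filter (fun p : Fin N × Fin N => Arc β p.1 p.2), arcVec (α p.1, α p.2)) *
  (∏ i ∈ Finset.univ.filter (fun i : Fin N => Labelled m β i), labelVec m (label m β i) (α i)) *
  (∏ p ∈ Finset.univ.filter (fun p : Fin N × Fin N => Dotted m β p.1 p.2),
    dottedVec (α p.1, α p.2)) *
  (∏ i ∈ Finset.univ.filter (fun i : Fin N => Circled m β i), ketOne (β i) (α i))

end ParabolicKL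

end

open scoped LaurentPolynomial

noncomputable section

namespace ParabolicKL

/-- `s_i α` is obtained from `α` by replacing `12` by `21` at the places `i, i + 1`, or by
replacing the last letter `1` by `2`. -/
def IsUp {N : ℕ} (i : Fin N) (α : Str N) : Prop :=
  α i = one ∧ ∀ j : Fin N, (i : ℕ) + 1 = j → α j = two

theorem isUp_trichotomy {N : ℕ} (i : Fin N) (α : Str N) :
    IsUp i α ∨ IsUp i (strRefl i α) ∨ ∃ j : Fin N, (i : ℕ) + 1 = j ∧ α i = α j := by
  by_cases h : (i : ℕ) + 1 < N
  · obtain ⟨j, hij⟩ : ∃ j : Fin N, (i : ℕ) + 1 = j := ⟨⟨i + 1, h⟩, rfl⟩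
    have hne : j ≠ i := by simp only [ne_eq, Fin.ext_iff]; omega
    have hj : ∀ k : Fin N, (i : ℕ) + 1 = k → k = j := fun k hk => Fin.ext (by omega)
    have hs := strRefl_apply_lt i j hij α
    cases hi : α i <;> cases hj' : α j
    · exact Or.inr (Or.inr ⟨j, hij, hj'.symm⟩)
    · exact Or.inl ⟨hi, fun k hk => by rw [hj k hk, hj']⟩
    · refine Or.inr (Or.inl ⟨by simp [hs, hj'], fun k hk => ?_⟩)
      rw [hj k hk]; simp [hs, hi, hne]
    · exact Or.inr (Or.inr ⟨j, hij, hj'.symm⟩)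
  · have hN : (i : ℕ) + 1 = N := by omega
    have hs := strRefl_apply_last i hN α
    have hj : ∀ k : Fin N, (i : ℕ) + 1 ≠ k := fun k hk => by omega
    cases hi : α i
    · exact Or.inl ⟨hi, fun k hk => (hj k hk).elim⟩
    · exact Or.inr (Or.inl ⟨by simp [hs, hi], fun k hk => (hj k hk).elim⟩)

theorem finRange_split {N : ℕ} (i : Fin N) : ∃ A B : List (Fin N),
    List.finRange N = A ++ i :: B ∧ (∀ a ∈ A, a < i) ∧ (∀ b ∈ B, i < b) ∧
      B.Pairwise (· < ·) := by
  obtain ⟨A, B, h⟩ := List.append_of_mem (List.mem_finRange i)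
  have hs : (List.finRange N).Pairwise (· < ·) := List.pairwise_lt_finRange N
  rw [h, List.pairwise_append, List.pairwise_cons] at hs
  exact ⟨A, B, h, fun a ha => hs.2.2 a ha i (by simp), hs.2.1.1, hs.2.1.2⟩

theorem finRange_split_succ {N : ℕ} (i j : Fin N) (hij : (i : ℕ) + 1 = j) :
    ∃ A B : List (Fin N), List.finRange N = A ++ i :: j :: B ∧ (∀ a ∈ A, a < i) ∧
      ∀ b ∈ B, j < b := by
  obtain ⟨A, B, h, hA, hB, hs⟩ := finRange_split i
  have hj : j ∈ A ++ i :: B := h ▸ List.mem_finRange j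
  have hjB : j ∈ B := by
    rcases List.mem_append.mp hj with hj | hj
    · have := hA j hj; rw [Fin.lt_def] at this; omega
    · rcases List.mem_cons.mp hj with hj | hj
      · rw [Fin.ext_iff] at hj; omega
      · exact hj
  cases B with
  | nil => simp at hjB
  | cons b B =>
    rw [List.pairwise_cons] at hs
    obtain rfl : j = b := by
      rcases List.mem_cons.mp hjB with rfl | hj'
      · rfl
      · have h1 := hs.1 j hj'
        have h2 := hB b (by simp)
        rw [Fin.lt_def] at h1 h2; omega
    exact ⟨A, B, h, hA, hs.1⟩

/-- The list `s_i ⋯ s_N`. -/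
def tailWord {N : ℕ} (i : Fin N) : List (Fin N) := (List.finRange N).filter fun j => i ≤ j

theorem minWord_eq {N : ℕ} (α : Str N) :
    minWord α = ((List.finRange N).filter fun i => α i = two).reverse.flatMap tailWord := rfl

theorem filter_eq_self_of {A : Type*} {l : List A} {p : A → Bool} (h : ∀ a ∈ l, p a = true) :
    l.filter p = l := List.filter_eq_self.mpr h

theorem filter_eq_nil_of {A : Type*} {l : List A} {p : A → Bool} (h : ∀ a ∈ l, p a = false) :
    l.filter p = [] := List.filter_eq_nil_iff.mpr (by simpa using h)

theorem tailWord_succ {N : ℕ} (i j : Fin N) (hij : (i : ℕ) + 1 = j) :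
    tailWord i = i :: tailWord j := by
  obtain ⟨A, B, h, hA, hB⟩ := finRange_split_succ i j hij
  have h1 : i < j := by rw [Fin.lt_def]; omega
  simp only [tailWord, h, List.filter_append, List.filter_cons]
  rw [filter_eq_nil_of (l := A) (by simpa using hA),
    filter_eq_nil_of (l := A) (by simpa using fun a ha => (hA a ha).trans h1),
    filter_eq_self_of (l := B) (by simpa using fun b hb => (h1.trans (hB b hb)).le),
    filter_eq_self_of (l := B) (by simpa using fun b hb => (hB b hb).le)]
  simp [h1.le, h1]

theorem tailWord_last {N : ℕ} (i : Fin N) (hi : (i : ℕ) + 1 = N) : tailWord i = [i] := by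
  obtain ⟨A, B, h, hA, hB, -⟩ := finRange_split i
  have hBn : B = [] := List.eq_nil_iff_forall_not_mem.mpr fun b hb => by
    have := hB b hb; rw [Fin.lt_def] at this; omega
  subst hBn
  rw [tailWord, h, List.filter_append, filter_eq_nil_of (l := A) (by simpa using hA)]
  simp

theorem le_of_mem_tailWord {N : ℕ} {i k : Fin N} (h : k ∈ tailWord i) : i ≤ k := by
  simpa [tailWord] using h

/-- `w⁻(s_i α) = s_i w⁻(α)` up to commutations. -/
theorem prod_map_minWord_up {N : ℕ} {X : Type*} [Monoid X] (g : Fin N → X)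
    (hg : ∀ i k : Fin N, (i : ℕ) + 1 < k → g i * g k = g k * g i) {i : Fin N} {α : Str N}
    (h : IsUp i α) :
    ((minWord (strRefl i α)).map g).prod = g i * ((minWord α).map g).prod := by
  by_cases hi : (i : ℕ) + 1 < N
  · obtain ⟨j, hij⟩ : ∃ j : Fin N, (i : ℕ) + 1 = j := ⟨⟨i + 1, hi⟩, rfl⟩
    obtain ⟨A, B, hAB, hA, hB⟩ := finRange_split_succ i j hij
    have hne : j ≠ i := by simp only [ne_eq, Fin.ext_iff]; omega
    have h1 := h.1
    have h2 := h.2 j hij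
    have hs := strRefl_apply_lt i j hij α
    have hlt : i < j := by rw [Fin.lt_def]; omega
    have eA : A.filter (fun k => strRefl i α k = two) = A.filter fun k => α k = two := by
      refine List.filter_congr fun k hk => ?_
      rw [hs, if_neg (hA k hk).ne, if_neg ((hA k hk).trans hlt).ne]
    have eB : B.filter (fun k => strRefl i α k = two) = B.filter fun k => α k = two := by
      refine List.filter_congr fun k hk => ?_
      rw [hs, if_neg (hlt.trans (hB k hk)).ne', if_neg (hB k hk).ne']
    have hc : g i * (List.map g ((B.filter fun k => α k = two).reverse.flatMap tailWord)).prod =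
        (List.map g ((B.filter fun k => α k = two).reverse.flatMap tailWord)).prod * g i := by
      refine Commute.list_prod_right _ _ fun x hx => ?_
      obtain ⟨k, hk, rfl⟩ := List.mem_map.mp hx
      obtain ⟨b, hb, hk⟩ := List.mem_flatMap.mp hk
      have hb' := hB b (List.mem_of_mem_filter (List.mem_reverse.mp hb))
      have hk' := le_of_mem_tailWord hk
      rw [Fin.lt_def] at hb'
      rw [Fin.le_def] at hk'
      exact hg i k (by omega)
    simp only [minWord_eq, hAB, List.filter_append, List.filter_cons, eA, eB, hs i, hs j, h1, h2,
      hne, if_true, if_false, List.reverse_append, List.flatMap_append, List.reverse_cons,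
      List.map_append, List.prod_append, decide_true, decide_false, Bool.false_eq_true]
    simp only [List.flatMap_cons, List.flatMap_nil, List.append_nil, tailWord_succ i j hij,
      List.map_cons, List.prod_cons, mul_assoc]
    simp only [← mul_assoc, hc]
  · have hN : (i : ℕ) + 1 = N := by omega
    obtain ⟨A, B, hAB, hA, hB, -⟩ := finRange_split i
    have hBn : B = [] := List.eq_nil_iff_forall_not_mem.mpr fun b hb => by
      have := hB b hb; rw [Fin.lt_def] at this; omega
    subst hBn
    have h1 := h.1
    have hs := strRefl_apply_last i hN α
    have eA : A.filter (fun k => strRefl i α k = two) = A.filter fun k => α k = two := by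
      refine List.filter_congr fun k hk => ?_
      rw [hs, if_neg (hA k hk).ne]
    simp only [minWord_eq, hAB, List.filter_append, eA]
    simp [hs i, h1, tailWord_last i hN]

theorem minWord_one {N : ℕ} : minWord (fun _ : Fin N => one) = [] := by
  simp [minWord_eq]

/-- The length of `w⁻(α)`. -/
def height {N : ℕ} (α : Str N) : ℕ := (minWord α).length

theorem height_up {N : ℕ} {i : Fin N} {α : Str N} (h : IsUp i α) :
    height (strRefl i α) = height α + 1 := by
  have := prod_map_minWord_up (fun _ => Multiplicative.ofAdd 1) (fun _ _ _ => rfl) h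
  simp only [List.map_const', List.prod_replicate, ← ofAdd_nsmul, ← ofAdd_add] at this
  have := Multiplicative.ofAdd.injective this
  simp only [smul_eq_mul, mul_one] at this
  rw [height, height]; omega

/-- Every string arises from `1 ⋯ 1` by raising moves. -/
theorem exists_isUp {N : ℕ} (α : Str N) (h : α ≠ fun _ => one) :
    ∃ i β, IsUp i β ∧ α = strRefl i β := by
  classical
  have hne : (Finset.univ.filter fun i => α i = two).Nonempty := by
    by_contra hn
    rw [Finset.not_nonempty_iff_eq_empty, Finset.filter_eq_empty_iff] at hn
    exact h (funext fun i => by simpa using hn (Finset.mem_univ i))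
  obtain ⟨i, hi, hmax⟩ := Finset.exists_max_image _ (fun i : Fin N => i) hne
  rw [Finset.mem_filter] at hi
  rcases isUp_trichotomy i α with hu | hu | ⟨j, hij, hj⟩
  · rw [hu.1] at hi; simp at hi
  · exact ⟨i, _, hu, (strRefl_strRefl i α).symm⟩
  · have := hmax j (by simp [← hj, hi.2])
    rw [Fin.le_def] at this; omega

theorem strInduct {N : ℕ} {p : Str N → Prop} (h0 : p fun _ => one)
    (hup : ∀ i α, IsUp i α → p α → p (strRefl i α)) (α : Str N) : p α := by
  induction hn : height α using Nat.strong_induction_on generalizing α with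
  | _ n ih =>
    by_cases h : α = fun _ => one
    · rwa [h]
    · obtain ⟨i, β, hu, rfl⟩ := exists_isUp α h
      have := height_up hu
      exact hup i β hu (ih (height β) (by omega) β rfl)

/-! ### The words `minWord α` are reduced -/

theorem strRefl_comm {N : ℕ} (i k : Fin N) (h : (i : ℕ) + 1 < k) (α : Str N) :
    strRefl i (strRefl k α) = strRefl k (strRefl i α) := by
  obtain ⟨j, hij⟩ : ∃ j : Fin N, (i : ℕ) + 1 = j := ⟨⟨i + 1, by omega⟩, rfl⟩
  have h1 := strRefl_apply_lt i j hij
  by_cases hk : (k : ℕ) + 1 < N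
  · obtain ⟨l, hkl⟩ : ∃ j : Fin N, (k : ℕ) + 1 = j := ⟨⟨k + 1, hk⟩, rfl⟩
    have h2 := strRefl_apply_lt k l hkl
    funext x
    simp only [h1, h2, Fin.ext_iff]
    grind
  · have h2 := strRefl_apply_last k (by omega)
    funext x
    simp only [h1, h2, Fin.ext_iff]
    grind

/-- The permutation of the strings given by `s_i`. -/
def strPerm {N : ℕ} (i : Fin N) : Equiv.Perm (Str N) :=
  ⟨strRefl i, strRefl i, strRefl_strRefl i, strRefl_strRefl i⟩

theorem strPerm_apply {N : ℕ} (i : Fin N) (α : Str N) : strPerm i α = strRefl i α := rfl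

theorem strPerm_mul_self {N : ℕ} (i : Fin N) : strPerm i * strPerm i = 1 :=
  Equiv.ext fun α => strRefl_strRefl i α

theorem strPerm_order {N : ℕ} (i j : Fin N) (hij : i < j) :
    (strPerm i * strPerm j) ^ (CoxeterMatrix.B N).M i j = 1 := by
  have hij' := hij
  rw [Fin.lt_def] at hij
  by_cases h1 : (i : ℕ) + 1 = j
  · have hne : j ≠ i := hij'.ne'
    have a1 := strRefl_apply_lt i j h1
    by_cases h2 : (j : ℕ) + 1 = N
    · have hM : (CoxeterMatrix.B N).M i j = 4 := by
        simp [CoxeterMatrix.B, hij'.ne]; grind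
      have a2 := strRefl_apply_last j h2
      rw [hM]
      ext1 α
      simp only [pow_succ, pow_zero, one_mul, Equiv.Perm.mul_apply, strPerm_apply,
        Equiv.Perm.one_apply]
      funext k
      by_cases k1 : k = i <;> by_cases k2 : k = j <;>
        simp_all [Ne.symm hne]
    · obtain ⟨l, hl⟩ : ∃ l : Fin N, (j : ℕ) + 1 = l := ⟨⟨j + 1, by omega⟩, rfl⟩
      have hM : (CoxeterMatrix.B N).M i j = 3 := by
        simp [CoxeterMatrix.B, hij'.ne]; grind
      have n1 : l ≠ i := by simp only [ne_eq, Fin.ext_iff]; omega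
      have n2 : l ≠ j := by simp only [ne_eq, Fin.ext_iff]; omega
      have a2 := strRefl_apply_lt j l hl
      rw [hM]
      ext1 α
      simp only [pow_succ, pow_zero, one_mul, Equiv.Perm.mul_apply, strPerm_apply,
        Equiv.Perm.one_apply]
      funext k
      by_cases k1 : k = i <;> by_cases k2 : k = j <;> by_cases k3 : k = l <;>
        simp_all [n1.symm, n2.symm, Ne.symm hne]
  · have hM : (CoxeterMatrix.B N).M i j = 2 := by
      simp [CoxeterMatrix.B, hij'.ne]; grind
    rw [hM]
    ext1 α
    simp only [pow_succ, pow_zero, one_mul, Equiv.Perm.mul_apply, strPerm_apply,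
      Equiv.Perm.one_apply]
    rw [← strRefl_comm i j (by omega), strRefl_strRefl, strRefl_strRefl]

theorem strPerm_isLiftable (N : ℕ) : (CoxeterMatrix.B N).IsLiftable (strPerm (N := N)) := by
  intro i j
  rcases lt_trichotomy i j with h | rfl | h
  · exact strPerm_order i j h
  · rw [(CoxeterMatrix.B N).diagonal, pow_one, strPerm_mul_self]
  · have := congrArg (·⁻¹) (strPerm_order j i h)
    have hi : ∀ k : Fin N, (strPerm k)⁻¹ = strPerm k := fun k => rfl
    simp only [← inv_pow, mul_inv_rev, hi, inv_one] at this
    rw [(CoxeterMatrix.B N).symmetric i j]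
    exact this

/-- The action of the Weyl group on strings. -/
def weylAct (N : ℕ) : WeylC N →* Equiv.Perm (Str N) :=
  (weylSystem N).lift ⟨strPerm, strPerm_isLiftable N⟩

theorem weylAct_wordProd {N : ℕ} (ω : List (Fin N)) :
    weylAct N ((weylSystem N).wordProd ω) = (ω.map strPerm).prod := by
  rw [CoxeterSystem.wordProd, map_list_prod, List.map_map]
  refine congrArg List.prod (List.map_congr_left fun i _ => ?_)
  exact (weylSystem N).lift_apply_simple (strPerm_isLiftable N) i

theorem prod_strPerm_minWord {N : ℕ} (α : Str N) :
    ((minWord α).map strPerm).prod (fun _ => one) = α := by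
  induction α using strInduct with
  | h0 => simp [minWord_one]
  | hup i α hu ih =>
    rw [prod_map_minWord_up strPerm
      (fun i k h => Equiv.ext fun α => strRefl_comm i k h α) hu, Equiv.Perm.mul_apply, ih,
      strPerm_apply]

theorem height_strRefl_le {N : ℕ} (i : Fin N) (α : Str N) :
    height (strRefl i α) ≤ height α + 1 := by
  rcases isUp_trichotomy i α with h | h | ⟨j, hij, h⟩
  · exact (height_up h).le
  · have := height_up h
    rw [strRefl_strRefl] at this
    omega
  · have hs := strRefl_apply_lt i j hij α
    have : strRefl i α = α := by
      funext k; rw [hs]; split_ifs <;> simp_all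
    rw [this]; omega

theorem height_word_le {N : ℕ} (ω : List (Fin N)) :
    height ((ω.map strPerm).prod fun _ => one) ≤ ω.length := by
  induction ω with
  | nil => simp [height, minWord_one]
  | cons i ω ih =>
    rw [List.map_cons, List.prod_cons, Equiv.Perm.mul_apply, strPerm_apply, List.length_cons]
    exact (height_strRefl_le i _).trans (by omega)

theorem minWord_isReduced {N : ℕ} (α : Str N) : (weylSystem N).IsReduced (minWord α) := by
  refine le_antisymm ((weylSystem N).length_wordProd_le _) ?_
  obtain ⟨ω, hω, he⟩ := (weylSystem N).exists_isReduced ((weylSystem N).wordProd (minWord α))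
  have h1 := height_word_le ω
  rw [← weylAct_wordProd, ← he, weylAct_wordProd, prod_strPerm_minWord] at h1
  rw [he, hω]
  exact h1

theorem strLE_of_sublist {N : ℕ} {α β : Str N} (h : (minWord α).Sublist (minWord β)) :
    StrLE α β :=
  ⟨minWord β, minWord_isReduced β, rfl, minWord α, h, rfl⟩

/-! ### A criterion for the Bruhat order -/

/-- The number of letters `2` among the places up to `k`. -/
def prefixTwos {N : ℕ} (α : Str N) (k : Fin N) : ℕ :=
  (Finset.univ.filter fun i => i ≤ k ∧ α i = two).card

theorem tailWord_sublist {N : ℕ} {i j : Fin N} (h : i ≤ j) :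
    (tailWord j).Sublist (tailWord i) :=
  List.monotone_filter_right _ fun k => by simpa using h.trans

theorem flatMap_tailWord_sublist {N : ℕ} {l l' : List (Fin N)}
    (h : List.SublistForall₂ (fun j i => i ≤ j) l l') :
    (l.reverse.flatMap tailWord).Sublist (l'.reverse.flatMap tailWord) := by
  induction h with
  | nil => simp
  | cons h _ ih =>
    simp only [List.reverse_cons, List.flatMap_append, List.flatMap_cons, List.flatMap_nil,
      List.append_nil]
    exact ih.append (tailWord_sublist h)
  | cons_right _ ih =>
    simp only [List.reverse_cons, List.flatMap_append]
    exact ih.trans (List.sublist_append_left _ _)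

theorem sublistForall₂_of_countP {A : Type*} [LinearOrder A] :
    ∀ (l l' : List A), l.Pairwise (· < ·) → l'.Pairwise (· < ·) →
      (∀ a, l.countP (· ≤ a) ≤ l'.countP (· ≤ a)) →
      List.SublistForall₂ (fun j i => i ≤ j) l l'
  | [], _, _, _, _ => .nil
  | a :: l, [], _, _, h => by simpa using h a
  | a :: l, b :: l', hl, hl', h => by
    rw [List.pairwise_cons] at hl hl'
    have hb : b ≤ a := by
      by_contra hb
      have h1 := h a
      have h2 : l'.countP (· ≤ a) = 0 := by
        rw [List.countP_eq_zero]
        intro c hc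
        simpa using (not_le.mp hb).trans (hl'.1 c hc)
      rw [List.countP_cons, List.countP_cons, h2] at h1
      simp [hb] at h1
    refine .cons hb (sublistForall₂_of_countP l l' hl.2 hl'.2 fun c => ?_)
    by_cases hc : a ≤ c
    · have := h c
      simpa [List.countP_cons, hc, hb.trans hc] using this
    · have h2 : l.countP (· ≤ c) = 0 := by
        rw [List.countP_eq_zero]
        intro d hd
        simpa using (not_le.mp hc).trans (hl.1 d hd)
      rw [h2]; exact Nat.zero_le _

theorem countP_filter_finRange {N : ℕ} (α : Str N) (k : Fin N) :
    ((List.finRange N).filter fun i => α i = two).countP (· ≤ k) = prefixTwos α k := by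
  rw [List.countP_filter, List.countP_eq_length_filter, prefixTwos,
    ← List.toFinset_card_of_nodup ((List.nodup_finRange N).filter _)]
  congr 1
  ext i
  simp

theorem minWord_sublist_of_prefixTwos_le {N : ℕ} {α β : Str N}
    (h : ∀ k, prefixTwos α k ≤ prefixTwos β k) : (minWord α).Sublist (minWord β) :=
  flatMap_tailWord_sublist <| sublistForall₂_of_countP _ _
    ((List.pairwise_lt_finRange N).filter _) ((List.pairwise_lt_finRange N).filter _)
    fun k => by rw [countP_filter_finRange, countP_filter_finRange]; exact h k

/-! ### The bar involution commutes with the operators `T_i + t_i⁻¹` -/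

/-- The operator by which `T_i⁻¹` acts on `M⁻`. -/
def genInvOp (N m : ℕ) (i : Fin N) : Module.End Ground (MMinus N) :=
  heckeAct N m (genInv N m i)

theorem genInvOp_apply (N m : ℕ) (i : Fin N) (v : MMinus N) :
    genInvOp N m i v = genOp N m i v - (tp (wt N m i) - tp (-wt N m i)) • v := by
  rw [genInvOp, genInv, map_sub, heckeAct_gen, AlgHom.commutes, LinearMap.sub_apply,
    Module.algebraMap_end_apply]

theorem genOp_genInvOp (N m : ℕ) (i : Fin N) (v : MMinus N) :
    genOp N m i (genInvOp N m i v) = v := by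
  rw [genInvOp, ← heckeAct_gen, ← Module.End.mul_apply, ← map_mul, gen_mul_genInv, map_one,
    Module.End.one_apply]

theorem genInvOp_comm (N m : ℕ) (i j : Fin N) (hij : (i : ℕ) + 1 < j) :
    genInvOp N m i * genInvOp N m j = genInvOp N m j * genInvOp N m i := by
  have := congrArg (fun x => heckeAct N m (heckeBar N m x)) (gen_comm N m i j hij)
  simp only [map_mul, heckeBar_gen] at this
  exact this

theorem genInvOp_braid_three (N m : ℕ) (i j : Fin N) (hij : (i : ℕ) + 1 = j)
    (hj : (j : ℕ) + 1 < N) (v : MMinus N) :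
    genInvOp N m i (genInvOp N m j (genInvOp N m i v)) =
      genInvOp N m j (genInvOp N m i (genInvOp N m j v)) := by
  have := congrArg (fun x => heckeAct N m (heckeBar N m x) v) (gen_braid_three N m i j hij hj)
  simp only [map_mul, heckeBar_gen] at this
  exact this

theorem genInvOp_braid_four (N m : ℕ) (i j : Fin N) (hij : (i : ℕ) + 1 = j)
    (hj : (j : ℕ) + 1 = N) (v : MMinus N) :
    genInvOp N m i (genInvOp N m j (genInvOp N m i (genInvOp N m j v))) =
      genInvOp N m j (genInvOp N m i (genInvOp N m j (genInvOp N m i v))) := by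
  have := congrArg (fun x => heckeAct N m (heckeBar N m x) v) (gen_braid_four N m i j hij hj)
  simp only [map_mul, heckeBar_gen] at this
  exact this

/-- The image of `m_α` under the bar involution. -/
def barKet (N m : ℕ) (α : Str N) : MMinus N :=
  ((minWord α).map (genInvOp N m)).prod (ket fun _ => one)

theorem moduleBar_eq (N m : ℕ) (v : MMinus N) :
    moduleBar N m v = ∑ α : Str N, LaurentPolynomial.invert (v α) • barKet N m α := by
  refine Finset.sum_congr rfl fun α _ => ?_
  rw [barKet, heckeMin, map_list_prod, map_list_prod, List.map_map, List.map_map]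
  have : ((heckeAct N m ∘ heckeBar N m) ∘ gen N m) = genInvOp N m :=
    funext fun i => congrArg (heckeAct N m) (heckeBar_gen N m i)
  rw [this]

theorem moduleBar_ket (N m : ℕ) (α : Str N) : moduleBar N m (ket α) = barKet N m α := by
  classical
  rw [moduleBar_eq, Finset.sum_eq_single α]
  · simp [ket]
  · intro β _ h
    simp [ket, h]
  · simp

theorem moduleBar_add (N m : ℕ) (v w : MMinus N) :
    moduleBar N m (v + w) = moduleBar N m v + moduleBar N m w := by
  simp only [moduleBar_eq, Pi.add_apply, map_add, add_smul, Finset.sum_add_distrib]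

theorem moduleBar_smul (N m : ℕ) (c : Ground) (v : MMinus N) :
    moduleBar N m (c • v) = LaurentPolynomial.invert c • moduleBar N m v := by
  simp only [moduleBar_eq, Pi.smul_apply, smul_eq_mul, map_mul, mul_smul, Finset.smul_sum]

theorem moduleBar_tp_smul (N m : ℕ) (k : ℤ) (v : MMinus N) :
    moduleBar N m (tp k • v) = tp (-k) • moduleBar N m v := by
  rw [moduleBar_smul, LaurentPolynomial.invert_T]

theorem moduleBar_neg (N m : ℕ) (v : MMinus N) : moduleBar N m (-v) = -moduleBar N m v := by
  simp only [moduleBar_eq, Pi.neg_apply, map_neg, neg_smul, Finset.sum_neg_distrib]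

theorem moduleBar_sub (N m : ℕ) (v w : MMinus N) :
    moduleBar N m (v - w) = moduleBar N m v - moduleBar N m w := by
  rw [sub_eq_add_neg, moduleBar_add, moduleBar_neg, sub_eq_add_neg]

theorem moduleBar_zero (N m : ℕ) : moduleBar N m 0 = 0 := by
  simp [moduleBar_eq]

theorem moduleBar_sum (N m : ℕ) {ι : Type*} (s : Finset ι) (v : ι → MMinus N) :
    moduleBar N m (∑ i ∈ s, v i) = ∑ i ∈ s, moduleBar N m (v i) :=
  map_sum (AddMonoidHom.mk' (moduleBar N m) (moduleBar_add N m)) v s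

theorem eq_sum_ket {N : ℕ} (v : MMinus N) : v = ∑ α : Str N, v α • ket α := by
  classical
  funext β
  simp [ket, Finset.sum_apply, Pi.single_apply]

theorem barKet_one (N m : ℕ) : barKet N m (fun _ => one) = ket fun _ => one := by
  simp [barKet, minWord_one]

theorem barKet_up {N m : ℕ} {i : Fin N} {α : Str N} (h : IsUp i α) :
    barKet N m (strRefl i α) = genInvOp N m i (barKet N m α) := by
  rw [barKet, prod_map_minWord_up (genInvOp N m) (genInvOp_comm N m) h, Module.End.mul_apply]
  rfl

theorem wt_lt {N m : ℕ} {i : Fin N} (h : (i : ℕ) + 1 < N) : wt N m i = 1 := if_pos h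

theorem wt_last {N m : ℕ} {i : Fin N} (h : (i : ℕ) + 1 = N) : wt N m i = m :=
  if_neg (by omega)

theorem genInvOp_barKet_eq (N m : ℕ) (α : Str N) : ∀ i j : Fin N, (i : ℕ) + 1 = j → α i = α j →
    genInvOp N m i (barKet N m α) = -tp 1 • barKet N m α := by
  induction hn : height α using Nat.strong_induction_on generalizing α with
  | _ n ih =>
  intro i j hij hα
  by_cases h1 : α = fun _ => one
  · subst h1
    rw [barKet_one, genInvOp_apply, genOp_eq N m i j hij _ rfl, wt_lt (by omega)]
    module
  obtain ⟨k, γ, hu, rfl⟩ := exists_isUp α h1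
  have hγ := height_up hu
  have hne : j ≠ i := by simp only [ne_eq, Fin.ext_iff]; omega
  have si := strRefl_apply_lt i j hij
  rw [barKet_up hu]
  rcases lt_trichotomy ((k : ℕ) + 1) i with hki | hki | hki
  · have sk := strRefl_apply_lt k ⟨k + 1, by omega⟩ rfl γ
    have hγ' : γ i = γ j := by
      rw [sk, sk] at hα
      simpa only [Fin.ext_iff, show (i : ℕ) ≠ k by omega, show (j : ℕ) ≠ k by omega,
        show (i : ℕ) ≠ k + 1 by omega, show (j : ℕ) ≠ k + 1 by omega, if_false] using hα
    rw [← Module.End.mul_apply, ← genInvOp_comm N m k i hki, Module.End.mul_apply,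
      ih _ (by omega) γ rfl i j hij hγ', map_smul]
  · have sk := strRefl_apply_lt k i hki
    have nk : k ≠ i := by simp only [ne_eq, Fin.ext_iff]; omega
    have nk' : k ≠ j := by simp only [ne_eq, Fin.ext_iff]; omega
    have hk1 := hu.1
    have hk2 := hu.2 i hki
    have hγj : γ j = one := by simpa [sk, nk.symm, nk'.symm, hne, hk1] using hα.symm
    have hδ : IsUp i (strRefl i γ) := by
      refine ⟨by simp [si, hγj], fun l hl => ?_⟩
      obtain rfl : l = j := Fin.ext (by omega)
      simp [si, hne, hk2]
    have e := barKet_up (m := m) hδ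
    have hh := height_up hδ
    rw [strRefl_strRefl] at e hh
    rw [e, ← genInvOp_braid_three N m k i hki (by omega),
      ih _ (by omega) _ rfl k i hki (by simp [si, nk, nk', hk1, hγj]), map_smul, map_smul]
  · rcases lt_trichotomy (k : ℕ) j with hkj | hkj | hkj
    · obtain rfl : k = i := Fin.ext (by omega)
      have hk1 := hu.1
      have hk2 := hu.2 j hij
      simp [si, hne, hk1, hk2] at hα
    · obtain rfl : k = j := Fin.ext hkj
      have hk1 := hu.1
      by_cases hk : (k : ℕ) + 1 < N
      · obtain ⟨l, hkl⟩ : ∃ l : Fin N, (k : ℕ) + 1 = l := ⟨⟨k + 1, hk⟩, rfl⟩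
        have sk := strRefl_apply_lt k l hkl
        have hk2 := hu.2 l hkl
        have nl : l ≠ i := by simp only [ne_eq, Fin.ext_iff]; omega
        have nl' : l ≠ k := by simp only [ne_eq, Fin.ext_iff]; omega
        have hγi : γ i = two := by simpa [sk, hne.symm, nl.symm, nl'.symm, hk2] using hα
        have hδ : IsUp i (strRefl i γ) := by
          refine ⟨by simp [si, hk1], fun x hx => ?_⟩
          obtain rfl : x = k := Fin.ext (by omega)
          simp [si, hne, hγi]
        have e := barKet_up (m := m) hδ
        have hh := height_up hδ
        rw [strRefl_strRefl] at e hh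
        rw [e, genInvOp_braid_three N m i k hij (by omega),
          ih _ (by omega) _ rfl k l hkl (by simp [si, nl, nl', hne, hγi, hk2]), map_smul,
          map_smul]
      · have hN : (k : ℕ) + 1 = N := by omega
        have sk := strRefl_apply_last k hN
        have hγi : γ i = two := by simpa [sk, hne.symm, hk1] using hα
        have hδ : IsUp i (strRefl i γ) := by
          refine ⟨by simp [si, hk1], fun x hx => ?_⟩
          obtain rfl : x = k := Fin.ext (by omega)
          simp [si, hne, hγi]
        have hε : IsUp k (strRefl k (strRefl i γ)) :=
          ⟨by simp [si, sk, hne, hγi], fun x hx => by omega⟩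
        have e := barKet_up (m := m) hδ
        have hh := height_up hδ
        have e' := barKet_up (m := m) hε
        have hh' := height_up hε
        rw [strRefl_strRefl] at e hh e' hh'
        rw [e, e', genInvOp_braid_four N m i k hij hN,
          ih _ (by omega) _ rfl i k hij (by simp [si, sk, hne, hne.symm, hγi, hk1]), map_smul,
          map_smul, map_smul]
    · have hγ' : γ i = γ j := by
        by_cases hk : (k : ℕ) + 1 < N
        · have sk := strRefl_apply_lt k ⟨k + 1, by omega⟩ rfl γ
          rw [sk, sk] at hα
          simpa only [Fin.ext_iff, show (i : ℕ) ≠ k by omega, show (j : ℕ) ≠ k by omega,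
            show (i : ℕ) ≠ k + 1 by omega, show (j : ℕ) ≠ k + 1 by omega, if_false] using hα
        · have sk := strRefl_apply_last k (by omega) γ
          rw [sk, sk] at hα
          simpa only [Fin.ext_iff, show (i : ℕ) ≠ k by omega, show (j : ℕ) ≠ k by omega,
            if_false] using hα
      rw [← Module.End.mul_apply, genInvOp_comm N m i k (by omega), Module.End.mul_apply,
        ih _ (by omega) γ rfl i j hij hγ', map_smul]

/-- The operator by which `T_i + t_i⁻¹` acts on `M⁻`. -/
def cup (N m : ℕ) (i : Fin N) : Module.End Ground (MMinus N) :=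
  genOp N m i + tp (-wt N m i) • 1

theorem cup_apply (N m : ℕ) (i : Fin N) (v : MMinus N) :
    cup N m i v = genOp N m i v + tp (-wt N m i) • v := rfl

theorem cup_up {N m : ℕ} {i : Fin N} {α : Str N} (h : IsUp i α) :
    cup N m i (ket α) = ket (strRefl i α) + tp (-wt N m i) • ket α := by
  rw [cup_apply]
  congr 1
  by_cases hi : (i : ℕ) + 1 < N
  · exact genOp_up N m i ⟨i + 1, hi⟩ rfl α h.1 (h.2 _ rfl)
  · exact genOp_last_up N m i (by omega) α h.1

theorem cup_down {N m : ℕ} {i : Fin N} {α : Str N} (h : IsUp i (strRefl i α)) :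
    cup N m i (ket α) = ket (strRefl i α) + tp (wt N m i) • ket α := by
  rw [cup_apply]
  by_cases hi : (i : ℕ) + 1 < N
  · have s := strRefl_apply_lt i ⟨i + 1, hi⟩ rfl α
    have h1 := h.1
    have h2 := h.2 ⟨i + 1, hi⟩ rfl
    rw [s] at h1 h2
    rw [genOp_down N m i ⟨i + 1, hi⟩ rfl α (by simpa [Fin.ext_iff] using h2)
      (by simpa [Fin.ext_iff] using h1), wt_lt hi]
    module
  · have hN : (i : ℕ) + 1 = N := by omega
    have h1 := h.1
    rw [strRefl_apply_last i hN α] at h1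
    rw [genOp_last_down N m i hN α (by simpa using h1), wt_last hN]
    module

theorem cup_eq {N m : ℕ} {i j : Fin N} (hij : (i : ℕ) + 1 = j) {α : Str N} (h : α i = α j) :
    cup N m i (ket α) = 0 := by
  rw [cup_apply, genOp_eq N m i j hij α h, wt_lt (by omega)]
  module

theorem moduleBar_cup_ket (N m : ℕ) (i : Fin N) (α : Str N) :
    moduleBar N m (cup N m i (ket α)) = cup N m i (moduleBar N m (ket α)) := by
  have hinv := genInvOp_apply N m i
  rcases isUp_trichotomy i α with h | h | ⟨j, hij, h⟩
  · rw [cup_up h, moduleBar_add, moduleBar_tp_smul, moduleBar_ket, moduleBar_ket, barKet_up h,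
      hinv, cup_apply, neg_neg]
    module
  · have e := barKet_up (m := m) h
    have g := genOp_genInvOp N m i (barKet N m (strRefl i α))
    rw [← e, strRefl_strRefl] at g
    rw [cup_down h, moduleBar_add, moduleBar_tp_smul, moduleBar_ket, moduleBar_ket, cup_apply, g]
  · have g := genInvOp_barKet_eq N m α i j hij h
    rw [hinv, wt_lt (by omega), sub_eq_iff_eq_add] at g
    rw [cup_eq hij h, moduleBar_ket, moduleBar_zero, cup_apply, g, wt_lt (by omega)]
    module

/-- The operator `K` commutes with the bar involution. -/
def BarComm (N m : ℕ) (K : Module.End Ground (MMinus N)) : Prop :=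
  ∀ v, moduleBar N m (K v) = K (moduleBar N m v)

theorem barComm_cup (N m : ℕ) (i : Fin N) : BarComm N m (cup N m i) := by
  intro v
  conv_lhs => rw [eq_sum_ket v]
  rw [map_sum, moduleBar_sum, moduleBar_eq, map_sum]
  refine Finset.sum_congr rfl fun α _ => ?_
  rw [map_smul, map_smul, moduleBar_smul, moduleBar_cup_ket, moduleBar_ket]

theorem barComm_one (N m : ℕ) : BarComm N m 1 := fun _ => rfl

theorem BarComm.mul {N m : ℕ} {K L : Module.End Ground (MMinus N)} (hK : BarComm N m K)
    (hL : BarComm N m L) : BarComm N m (K * L) := fun v => by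
  rw [Module.End.mul_apply, hK, hL, Module.End.mul_apply]

theorem BarComm.add {N m : ℕ} {K L : Module.End Ground (MMinus N)} (hK : BarComm N m K)
    (hL : BarComm N m L) : BarComm N m (K + L) := fun v => by
  rw [LinearMap.add_apply, moduleBar_add, hK, hL, LinearMap.add_apply]

theorem BarComm.sub {N m : ℕ} {K L : Module.End Ground (MMinus N)} (hK : BarComm N m K)
    (hL : BarComm N m L) : BarComm N m (K - L) := fun v => by
  rw [LinearMap.sub_apply, moduleBar_sub, hK, hL, LinearMap.sub_apply]

theorem BarComm.smul {N m : ℕ} {K : Module.End Ground (MMinus N)} (hK : BarComm N m K)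
    {c : Ground} (hc : LaurentPolynomial.invert c = c) : BarComm N m (c • K) := fun v => by
  rw [LinearMap.smul_apply, moduleBar_smul, hK, LinearMap.smul_apply, hc]

theorem BarComm.apply {N m : ℕ} {K : Module.End Ground (MMinus N)} (hK : BarComm N m K)
    {v : MMinus N} (hv : moduleBar N m v = v) : moduleBar N m (K v) = K v := by
  rw [hK, hv]

theorem moduleBar_ket_one (N m : ℕ) :
    moduleBar N m (ket fun _ => one) = ket fun _ => one := by
  rw [moduleBar_ket, barKet_one]

/-- A linear map which intertwines the operators `T_i + t_i⁻¹` with operators that commute with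
the bar involution, and which maps `m_{1…1}` to a bar invariant vector, commutes with the bar
involutions. -/
theorem moduleBar_comm_of_intertwine {N N' m m' : ℕ} (F : MMinus N →ₗ[Ground] MMinus N')
    (h1 : moduleBar N' m' (F (ket fun _ => one)) = F (ket fun _ => one))
    (hF : ∀ i : Fin N, ∃ K, BarComm N' m' K ∧ ∀ α, F (cup N m i (ket α)) = K (F (ket α)))
    (v : MMinus N) : moduleBar N' m' (F v) = F (moduleBar N m v) := by
  have hF' : ∀ i : Fin N, ∃ K, BarComm N' m' K ∧ ∀ v, F (cup N m i v) = K (F v) := by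
    intro i
    obtain ⟨K, hK, h⟩ := hF i
    exact ⟨K, hK, fun v => LinearMap.congr_fun
      (f := F ∘ₗ cup N m i) (g := K ∘ₗ F) ((Pi.basisFun Ground (Str N)).ext fun α => by
        simpa [ket] using h α) v⟩
  have key : ∀ α, moduleBar N' m' (F (ket α)) = F (moduleBar N m (ket α)) := by
    intro α
    induction α using strInduct with
    | h0 => rw [h1, moduleBar_ket_one]
    | hup i α hu ih =>
      obtain ⟨K, hK, h⟩ := hF' i
      have e : ket (strRefl i α) = cup N m i (ket α) - tp (-wt N m i) • ket α := by
        rw [cup_up hu]; module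
      rw [e, map_sub, map_smul, h, moduleBar_sub, moduleBar_sub, hK, ih, ← h,
        moduleBar_tp_smul, moduleBar_tp_smul, ih, ← barComm_cup, map_sub, map_smul]
  conv_lhs => rw [eq_sum_ket v]
  rw [map_sum, moduleBar_sum, moduleBar_eq, map_sum]
  refine Finset.sum_congr rfl fun α _ => ?_
  rw [map_smul, map_smul, moduleBar_smul, key, moduleBar_ket]

/-! ### Local computations -/

section Local

variable {X : Type*} [AddCommGroup X] [Module Ground X]

/-- The action of `T_i + t_i⁻¹`, `i < N`, on the two letters which it concerns. -/
structure CupRule (u : Module.End Ground X) (g : Letter → Letter → X) : Prop where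
  one_one : u (g one one) = 0
  two_two : u (g two two) = 0
  one_two : u (g one two) = g two one + tp (-1) • g one two
  two_one : u (g two one) = g one two + tp 1 • g two one

/-- The action of `T_N + t_N⁻¹` on the letter which it concerns, where `t_N = t ^ m`. -/
structure FlipRule (m : ℤ) (u : Module.End Ground X) (g : Letter → X) : Prop where
  apply_one : u (g one) = g two + tp (-m) • g one
  apply_two : u (g two) = g one + tp m • g two

theorem tp_smul_tp_smul (a b : ℤ) (x : X) : tp a • tp b • x = tp (a + b) • x := by
  rw [smul_smul, ← LaurentPolynomial.T_add]

theorem tp_zero_smul (x : X) : tp 0 • x = x := by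
  rw [tp, LaurentPolynomial.T_zero, one_smul]

theorem tp_zero_eq : tp 0 = 1 := LaurentPolynomial.T_zero

theorem arc_cup_cup_cup {u₀ u₁ u₂ : Module.End Ground X}
    {f : Letter → Letter → Letter → Letter → X}
    (h0 : ∀ c d, CupRule u₀ fun a b => f a b c d) (h1 : ∀ a d, CupRule u₁ fun b c => f a b c d)
    (h2 : ∀ a b, CupRule u₂ fun c d => f a b c d) :
    CupRule (u₁ * u₀ * u₂) fun a d => f a two one d + tp (-1) • f a one two d := by
  constructor <;>
  simp only [Module.End.mul_apply, map_add, map_smul, map_zero,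
    fun c d => (h0 c d).one_one, fun c d => (h0 c d).one_two, fun c d => (h0 c d).two_one,
    fun c d => (h0 c d).two_two, fun c d => (h1 c d).one_one, fun c d => (h1 c d).one_two,
    fun c d => (h1 c d).two_one, fun c d => (h1 c d).two_two, fun c d => (h2 c d).one_one,
    fun c d => (h2 c d).one_two, fun c d => (h2 c d).two_one, fun c d => (h2 c d).two_two,
    smul_zero, smul_add, tp_smul_tp_smul, neg_add_cancel, add_neg_cancel, tp_zero_smul] <;>
  norm_num <;> module

theorem arc_cup_cup_flip {m : ℤ} {u₀ u₁ u₂ : Module.End Ground X}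
    {f : Letter → Letter → Letter → X}
    (h0 : ∀ c, CupRule u₀ fun a b => f a b c) (h1 : ∀ a, CupRule u₁ fun b c => f a b c)
    (h2 : ∀ a b, FlipRule m u₂ fun c => f a b c) :
    FlipRule m (u₁ * u₀ * u₂) fun a => f a two one + tp (-1) • f a one two := by
  constructor <;>
  simp only [Module.End.mul_apply, map_add, map_smul, map_zero,
    fun c => (h0 c).one_one, fun c => (h0 c).one_two, fun c => (h0 c).two_one,
    fun c => (h0 c).two_two, fun c => (h1 c).one_one, fun c => (h1 c).one_two,
    fun c => (h1 c).two_one, fun c => (h1 c).two_two, fun c d => (h2 c d).apply_one,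
    fun c d => (h2 c d).apply_two,
    smul_zero, smul_add, tp_smul_tp_smul, neg_add_cancel, add_neg_cancel, tp_zero_smul] <;>
  ring_nf <;> module

theorem label_flip {m : ℤ} {u₀ u₁ : Module.End Ground X} {f : Letter → Letter → X}
    (h0 : CupRule u₀ f) (h1 : ∀ a, FlipRule (m + 1) u₁ fun b => f a b) :
    FlipRule m ((tp m + tp (-m)) • 1 - u₁ * u₀) fun a =>
      (if a = two then 1 else -1 : Ground) • (f a two + tp (-(m + 1)) • f a one) := by
  constructor <;>
  simp only [Module.End.mul_apply, map_add, map_smul, map_zero, LinearMap.sub_apply,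
    LinearMap.smul_apply, Module.End.one_apply, if_true, if_false, Bool.false_eq_true,
    h0.one_one, h0.one_two, h0.two_one, h0.two_two, fun c => (h1 c).apply_one, fun c => (h1 c).apply_two,
    smul_add, one_smul, neg_smul, tp_smul_tp_smul, smul_neg, map_neg] <;>
  simp only [smul_sub, smul_add, tp_smul_tp_smul, add_smul, sub_zero] <;>
  ring_nf <;> (try simp only [tp_zero_smul]) <;> module

theorem dotted_flip {u₀ u₁ u₂ : Module.End Ground X} {f : Letter → Letter → Letter → X}
    (h0 : ∀ c, CupRule u₀ fun a b => f a b c) (h1 : ∀ a, CupRule u₁ fun b c => f a b c)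
    (h2 : ∀ a b, FlipRule 0 u₂ fun c => f a b c) :
    FlipRule 0 (1 + (u₂ - 1) * u₁ * (u₂ - 1) * u₀ * (u₂ - 1)) fun a =>
      f a two two + tp (-1) • f a one one := by
  constructor <;>
  simp only [Module.End.mul_apply, map_add, map_smul, map_zero, LinearMap.sub_apply,
    LinearMap.add_apply, Module.End.one_apply,
    fun c => (h0 c).one_one, fun c => (h0 c).one_two, fun c => (h0 c).two_one,
    fun c => (h0 c).two_two, fun c => (h1 c).one_one, fun c => (h1 c).one_two,
    fun c => (h1 c).two_one, fun c => (h1 c).two_two, fun c d => (h2 c d).apply_one,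
    fun c d => (h2 c d).apply_two, neg_zero, add_sub_cancel_right,
    smul_zero, smul_add, tp_smul_tp_smul, neg_add_cancel, tp_zero_smul,
    add_zero, zero_add] <;>
  abel

end Local

theorem cupRule_of {N m : ℕ} {p q : Fin N} (hpq : (p : ℕ) + 1 = q) (F : Letter → Letter → Str N)
    (h1 : ∀ a b, F a b p = a) (h2 : ∀ a b, F a b q = b)
    (h3 : ∀ a b k, k ≠ p → k ≠ q → F a b k = F b a k) :
    CupRule (cup N m p) fun a b => ket (F a b) := by
  have hne : q ≠ p := by simp only [ne_eq, Fin.ext_iff]; omega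
  have hs : ∀ a b, strRefl p (F a b) = F b a := by
    intro a b
    funext k
    rw [strRefl_apply_lt p q hpq]
    split_ifs with e1 e2
    · rw [e1, h1, h2]
    · rw [e2, h1, h2]
    · exact h3 a b k e1 e2
  have hup : IsUp p (F one two) := ⟨h1 _ _, fun j hj => by
    obtain rfl : j = q := Fin.ext (by omega)
    exact h2 _ _⟩
  have hw : wt N m p = 1 := wt_lt (by omega)
  refine ⟨cup_eq hpq (by rw [h1, h2]), cup_eq hpq (by rw [h1, h2]), ?_, ?_⟩
  · rw [cup_up hup, hs, hw]
  · rw [cup_down (by rwa [hs]), hs, hw]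

theorem flipRule_of {N m : ℕ} {p : Fin N} (hp : (p : ℕ) + 1 = N) (F : Letter → Str N)
    (h1 : ∀ a, F a p = a) (h3 : ∀ a b k, k ≠ p → F a k = F b k) :
    FlipRule m (cup N m p) fun a => ket (F a) := by
  have hs : ∀ a, strRefl p (F a) = F !a := by
    intro a
    funext k
    rw [strRefl_apply_last p hp]
    split_ifs with e1
    · rw [e1, h1, h1]
    · exact h3 a _ k e1
  have hup : IsUp p (F one) := ⟨h1 _, fun j hj => by omega⟩
  have hw : wt N m p = m := wt_last hp
  constructor
  · rw [cup_up hup, hs, hw]; rfl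
  · rw [cup_down (by rwa [hs]), hs, hw]; rfl

theorem FlipRule.congr_smul {X : Type*} [AddCommGroup X] [Module Ground X] {m : ℤ}
    {u : Module.End Ground X} {g : Letter → X} (h : FlipRule m u g) (c : Ground) :
    FlipRule m u fun a => c • g a := by
  constructor
  · rw [map_smul, h.apply_one]; module
  · rw [map_smul, h.apply_two]; module

theorem update_self_update {N : ℕ} (β : Str N) (p q : Fin N) :
    Function.update (Function.update β q (β q)) p (β p) = β := by
  simp

/-- Operators with the same local rules on `F m_α` as `T_p + t⁻¹` on `m_α` intertwine. -/
theorem cup_intertwine {N m : ℕ} {X : Type*} [AddCommGroup X] [Module Ground X]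
    {p q : Fin N} (hpq : (p : ℕ) + 1 = q) (F : MMinus N →ₗ[Ground] X) (K : Module.End Ground X)
    (β : Str N)
    (h : CupRule K fun a b => F (ket (Function.update (Function.update β q b) p a))) :
    F (cup N m p (ket β)) = K (F (ket β)) := by
  have hne : q ≠ p := by simp only [ne_eq, Fin.ext_iff]; omega
  have r := cupRule_of (m := m) hpq
    (fun a b => Function.update (Function.update β q b) p a) (by simp)
    (by simp [hne]) (by intros; simp [*])
  have e := update_self_update β p q
  rw [← e]
  cases β p <;> cases β q
  · rw [r.one_one, h.one_one, map_zero]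
  · rw [r.one_two, h.one_two, map_add, map_smul]
  · rw [r.two_one, h.two_one, map_add, map_smul]
  · rw [r.two_two, h.two_two, map_zero]

theorem flip_intertwine {N m : ℕ} {X : Type*} [AddCommGroup X] [Module Ground X]
    {p : Fin N} (hp : (p : ℕ) + 1 = N) (F : MMinus N →ₗ[Ground] X) (K : Module.End Ground X)
    (β : Str N) (h : FlipRule m K fun a => F (ket (Function.update β p a))) :
    F (cup N m p (ket β)) = K (F (ket β)) := by
  have r := flipRule_of (m := m) hp (fun a => Function.update β p a) (by simp)
    (by intros; simp [*])
  have e := Function.update_eq_self p β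
  rw [← e]
  cases β p
  · rw [r.apply_one, h.apply_one, map_add, map_smul]
  · rw [r.apply_two, h.apply_two, map_add, map_smul]

/-! ### Inserting letters -/

/-- `m_β ↦ m_γ`, where `γ` is `β` on the image of `e` and `o` elsewhere. -/
def insertMap {N N' : ℕ} (e : Fin N → Fin N') (o : Str N') : MMinus N →ₗ[Ground] MMinus N' :=
  (Pi.basisFun Ground (Str N)).constr Ground fun β => ket (Function.extend e β o)

theorem insertMap_ket {N N' : ℕ} (e : Fin N → Fin N') (o : Str N') (β : Str N) :
    insertMap e o (ket β) = ket (Function.extend e β o) := by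
  have := (Pi.basisFun Ground (Str N)).constr_basis Ground
    (fun β => ket (Function.extend e β o)) β
  simpa only [insertMap, ket, Pi.basisFun_apply] using this

open Classical in
theorem insertMap_apply {N N' : ℕ} {e : Fin N → Fin N'} (he : Function.Injective e) (o : Str N')
    (v : MMinus N) (γ : Str N') :
    insertMap e o v γ = if ∀ k, k ∉ Set.range e → γ k = o k then v (γ ∘ e) else 0 := by
  conv_lhs => rw [eq_sum_ket v]
  have hiff : ∀ β : Str N, Function.extend e β o = γ ↔
      (∀ k, k ∉ Set.range e → γ k = o k) ∧ β = γ ∘ e := by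
    intro β
    constructor
    · rintro rfl
      refine ⟨fun k hk => Function.extend_apply' _ _ _ hk, ?_⟩
      funext k
      exact (he.extend_apply _ _ _).symm
    · rintro ⟨h1, rfl⟩
      funext k
      by_cases hk : k ∈ Set.range e
      · obtain ⟨j, rfl⟩ := hk
        rw [he.extend_apply]; rfl
      · rw [Function.extend_apply' _ _ _ hk, h1 k hk]
  rw [map_sum, Finset.sum_apply]
  simp only [map_smul, insertMap_ket, Pi.smul_apply, smul_eq_mul]
  split_ifs with h
  · rw [Finset.sum_eq_single (γ ∘ e)]
    · rw [(hiff _).mpr ⟨h, rfl⟩]; simp [ket]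
    · intro β _ hβ
      have : Function.extend e β o ≠ γ := fun hh => hβ ((hiff β).mp hh).2
      simp [ket, this.symm]
    · simp
  · refine Finset.sum_eq_zero fun β _ => ?_
    have : Function.extend e β o ≠ γ := fun hh => h ((hiff β).mp hh).1
    simp [ket, this.symm]

theorem extend_update {N N' : ℕ} {e : Fin N → Fin N'} (he : Function.Injective e) (β : Str N)
    (o : Str N') (p : Fin N) (a : Letter) :
    Function.extend e (Function.update β p a) o =
      Function.update (Function.extend e β o) (e p) a := by
  funext k
  by_cases hk : k ∈ Set.range e
  · obtain ⟨j, rfl⟩ := hk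
    rw [he.extend_apply, Function.update_apply, Function.update_apply, he.extend_apply]
    simp only [he.eq_iff]
  · have : k ≠ e p := fun h => hk ⟨p, h.symm⟩
    rw [Function.extend_apply' _ _ _ hk, Function.update_of_ne this,
      Function.extend_apply' _ _ _ hk]

theorem insertMap_cup {N N' m m' : ℕ} {e : Fin N → Fin N'} (he : Function.Injective e)
    (o : Str N') (p : Fin N)
    (hp : (∃ q : Fin N, (p : ℕ) + 1 = q ∧ (e p : ℕ) + 1 = e q) ∨
      ((p : ℕ) + 1 = N ∧ (e p : ℕ) + 1 = N' ∧ m = m')) (β : Str N) :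
    insertMap e o (cup N m p (ket β)) = cup N' m' (e p) (insertMap e o (ket β)) := by
  rcases hp with ⟨q, hpq, hpq'⟩ | ⟨hN, hN', rfl⟩
  · have hne : e q ≠ e p := by simp only [ne_eq, Fin.ext_iff]; omega
    refine cup_intertwine hpq _ _ β ?_
    simp only [insertMap_ket, extend_update he]
    exact cupRule_of hpq' _ (by simp) (by simp [hne]) (by intros; simp [*])
  · refine flip_intertwine hN _ _ β ?_
    simp only [insertMap_ket, extend_update he]
    exact flipRule_of hN' _ (by simp) (by intros; simp [*])

/-- The order embedding `Fin N → Fin (N + 2)` which omits the places `i` and `i + 1`. -/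
def skip {N : ℕ} (i : Fin (N + 1)) (k : Fin N) : Fin (N + 2) :=
  ⟨if (k : ℕ) < i then k else k + 2, by split_ifs <;> omega⟩

theorem skip_val {N : ℕ} (i : Fin (N + 1)) (k : Fin N) :
    (skip i k : ℕ) = if (k : ℕ) < i then (k : ℕ) else k + 2 := rfl

theorem skip_strictMono {N : ℕ} (i : Fin (N + 1)) : StrictMono (skip i) := by
  intro a b hab
  rw [Fin.lt_def] at hab ⊢
  rw [skip_val, skip_val]
  split_ifs <;> omega

theorem skip_injective {N : ℕ} (i : Fin (N + 1)) : Function.Injective (skip i) :=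
  (skip_strictMono i).injective

theorem not_mem_range_skip {N : ℕ} (i : Fin (N + 1)) (k : Fin (N + 2)) :
    k ∉ Set.range (skip i) ↔ k = i.castSucc ∨ k = i.succ := by
  constructor
  · intro h
    by_contra hk
    rw [not_or, Fin.ext_iff, Fin.ext_iff, Fin.val_castSucc, Fin.val_succ] at hk
    by_cases hki : (k : ℕ) < i
    · exact h ⟨⟨k, by omega⟩, Fin.ext (by rw [skip_val]; simp [hki])⟩
    · refine h ⟨⟨k - 2, by omega⟩, Fin.ext ?_⟩
      rw [skip_val]
      simp only
      split_ifs <;> omega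
  · rintro h ⟨j, rfl⟩
    rw [Fin.ext_iff, Fin.ext_iff, Fin.val_castSucc, Fin.val_succ, skip_val] at h
    split_ifs at h <;> omega

/-- The string with letter `x` at the place `i` and letter `y` elsewhere. -/
def pairStr {N : ℕ} (i : Fin (N + 1)) (x y : Letter) : Str (N + 2) :=
  fun k => if k = i.castSucc then x else y

theorem castSucc_ne_succ' {N : ℕ} (i : Fin (N + 1)) : i.succ ≠ i.castSucc := by
  rw [ne_eq, Fin.ext_iff, Fin.val_castSucc, Fin.val_succ]; omega

theorem extend_skip_left {N : ℕ} (i : Fin (N + 1)) (β : Str N) (x y : Letter) :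
    Function.extend (skip i) β (pairStr i x y) i.castSucc = x := by
  rw [Function.extend_apply' _ _ _ ((not_mem_range_skip i _).mpr (Or.inl rfl)), pairStr,
    if_pos rfl]

theorem extend_skip_right {N : ℕ} (i : Fin (N + 1)) (β : Str N) (x y : Letter) :
    Function.extend (skip i) β (pairStr i x y) i.succ = y := by
  rw [Function.extend_apply' _ _ _ ((not_mem_range_skip i _).mpr (Or.inr rfl)), pairStr,
    if_neg (castSucc_ne_succ' i)]

theorem extend_skip {N : ℕ} (i : Fin (N + 1)) (β : Str N) (x y : Letter) (k : Fin N) :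
    Function.extend (skip i) β (pairStr i x y) (skip i k) = β k :=
  (skip_injective i).extend_apply _ _ _

theorem extend_skip_congr {N : ℕ} (i : Fin (N + 1)) (β : Str N) (x y x' y' : Letter)
    (k : Fin (N + 2)) (h1 : k ≠ i.castSucc) (h2 : k ≠ i.succ) :
    Function.extend (skip i) β (pairStr i x y) k =
      Function.extend (skip i) β (pairStr i x' y') k := by
  have : k ∈ Set.range (skip i) := by
    by_contra h
    rcases (not_mem_range_skip i k).mp h with h | h
    · exact h1 h
    · exact h2 h
  obtain ⟨j, rfl⟩ := this
  rw [extend_skip, extend_skip]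

theorem insertMap_pairStr_apply {N : ℕ} (i : Fin (N + 1)) (x y : Letter) (v : MMinus N)
    (γ : Str (N + 2)) : insertMap (skip i) (pairStr i x y) v γ =
      if γ i.castSucc = x ∧ γ i.succ = y then v (γ ∘ skip i) else 0 := by
  rw [insertMap_apply (skip_injective i)]
  refine if_congr ?_ rfl rfl
  simp only [not_mem_range_skip]
  constructor
  · intro h
    have h1 := h _ (Or.inl rfl)
    have h2 := h _ (Or.inr rfl)
    rw [pairStr, if_pos rfl] at h1
    rw [pairStr, if_neg (castSucc_ne_succ' i)] at h2
    exact ⟨h1, h2⟩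
  · rintro ⟨h1, h2⟩ k (rfl | rfl)
    · rw [pairStr, if_pos rfl, h1]
    · rw [pairStr, if_neg (castSucc_ne_succ' i), h2]

/-- Insertion of the vector `|21⟩ + t⁻¹|12⟩` at the places `i, i + 1`. -/
def arcMap {N : ℕ} (i : Fin (N + 1)) : MMinus N →ₗ[Ground] MMinus (N + 2) :=
  insertMap (skip i) (pairStr i two one) + tp (-1) • insertMap (skip i) (pairStr i one two)

/-- Insertion of the vector `|22⟩ + t⁻¹|11⟩` at the last two places. -/
def dottedMap (N : ℕ) : MMinus N →ₗ[Ground] MMinus (N + 2) :=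
  insertMap (skip (Fin.last N)) (pairStr (Fin.last N) two two) +
    tp (-1) • insertMap (skip (Fin.last N)) (pairStr (Fin.last N) one one)

theorem arcMap_apply {N : ℕ} (i : Fin (N + 1)) (v : MMinus N) (γ : Str (N + 2)) :
    arcMap i v γ = v (γ ∘ skip i) * arcVec (γ i.castSucc, γ i.succ) := by
  simp only [arcMap, LinearMap.add_apply, LinearMap.smul_apply, Pi.add_apply, Pi.smul_apply,
    insertMap_pairStr_apply, arcVec, ketTwo, Pi.single_apply, smul_eq_mul]
  cases γ i.castSucc <;> cases γ i.succ <;> simp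

theorem dottedMap_apply {N : ℕ} (v : MMinus N) (γ : Str (N + 2)) :
    dottedMap N v γ = v (γ ∘ skip (Fin.last N)) *
      dottedVec (γ (Fin.last N).castSucc, γ (Fin.last N).succ) := by
  simp only [dottedMap, LinearMap.add_apply, LinearMap.smul_apply, Pi.add_apply, Pi.smul_apply,
    insertMap_pairStr_apply, dottedVec, ketTwo, Pi.single_apply, smul_eq_mul]
  cases γ (Fin.last N).castSucc <;> cases γ (Fin.last N).succ <;> simp

theorem arcMap_ket {N : ℕ} (i : Fin (N + 1)) (β : Str N) : arcMap i (ket β) =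
    ket (Function.extend (skip i) β (pairStr i two one)) +
      tp (-1) • ket (Function.extend (skip i) β (pairStr i one two)) := by
  simp only [arcMap, LinearMap.add_apply, LinearMap.smul_apply, insertMap_ket]

theorem dottedMap_ket {N : ℕ} (β : Str N) : dottedMap N (ket β) =
    ket (Function.extend (skip (Fin.last N)) β (pairStr (Fin.last N) two two)) +
      tp (-1) • ket (Function.extend (skip (Fin.last N)) β (pairStr (Fin.last N) one one)) := by
  simp only [dottedMap, LinearMap.add_apply, LinearMap.smul_apply, insertMap_ket]

theorem cupRule_pair {N m : ℕ} (i : Fin (N + 1)) (β : Str N) : CupRule (cup (N + 2) m i.castSucc)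
    fun x y => ket (Function.extend (skip i) β (pairStr i x y)) :=
  cupRule_of (q := i.succ) (by simp) _ (extend_skip_left i β) (extend_skip_right i β)
    fun x y k h1 h2 => extend_skip_congr i β x y y x k h1 h2

theorem arcMap_cup {N m : ℕ} (i : Fin (N + 1)) (p : Fin N) : ∃ K, BarComm (N + 2) m K ∧
    ∀ β, arcMap i (cup N m p (ket β)) = K (arcMap i (ket β)) := by
  have hinj := skip_injective i
  by_cases hp : (p : ℕ) + 1 = i
  · by_cases hN : (p : ℕ) + 1 < N
    · obtain ⟨q, hpq⟩ : ∃ q : Fin N, (p : ℕ) + 1 = q := ⟨⟨p + 1, hN⟩, rfl⟩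
      refine ⟨cup _ m i.castSucc * cup _ m (skip i p) * cup _ m i.succ,
        ((barComm_cup _ _ _).mul (barComm_cup _ _ _)).mul (barComm_cup _ _ _), fun β => ?_⟩
      have v1 : (skip i p : ℕ) + 1 = i.castSucc := by
        rw [skip_val, if_pos (by omega), Fin.val_castSucc, hp]
      have v2 : (i.succ : ℕ) + 1 = skip i q := by
        rw [skip_val, if_neg (by omega), Fin.val_succ]; omega
      have n1 : i.castSucc ≠ skip i p := by simp only [ne_eq, Fin.ext_iff]; omega
      have n2 : i.succ ≠ skip i q := by simp only [ne_eq, Fin.ext_iff]; omega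
      have n5 : p ≠ q := by simp only [ne_eq, Fin.ext_iff]; omega
      refine cup_intertwine hpq _ _ β ?_
      simp only [arcMap_ket]
      refine arc_cup_cup_cup (f := fun a b c d => ket (Function.extend (skip i)
        (Function.update (Function.update β q d) p a) (pairStr i b c)))
        (fun c d => ?_) (fun a d => cupRule_pair i _) fun a b => ?_
      · refine cupRule_of v1 _ (fun a b => ?_) (fun a b => extend_skip_left i _ _ _)
          fun a b k h1 h2 => ?_
        · rw [extend_skip, Function.update_self]
        · rw [extend_update hinj _ _ p, extend_update hinj _ _ p, Function.update_of_ne h1,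
            Function.update_of_ne h1]
          by_cases h3 : k = i.succ
          · rw [h3, extend_skip_right, extend_skip_right]
          · exact extend_skip_congr i _ _ _ _ _ k h2 h3
      · refine cupRule_of v2 _ (fun a b => extend_skip_right i _ _ _) (fun a b => ?_)
          fun c d k h1 h2 => ?_
        · rw [extend_skip, Function.update_of_ne n5.symm, Function.update_self]
        · rw [Function.update_comm n5.symm, Function.update_comm n5.symm,
            extend_update hinj _ _ q, extend_update hinj _ _ q, Function.update_of_ne h2,
            Function.update_of_ne h2]
          by_cases h3 : k = i.castSucc
          · rw [h3, extend_skip_left, extend_skip_left]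
          · exact extend_skip_congr i _ _ _ _ _ k h3 h1
    · refine ⟨cup _ m i.castSucc * cup _ m (skip i p) * cup _ m i.succ,
        ((barComm_cup _ _ _).mul (barComm_cup _ _ _)).mul (barComm_cup _ _ _), fun β => ?_⟩
      have v1 : (skip i p : ℕ) + 1 = i.castSucc := by
        rw [skip_val, if_pos (by omega), Fin.val_castSucc, hp]
      have v2 : (i.succ : ℕ) + 1 = N + 2 := by rw [Fin.val_succ]; omega
      refine flip_intertwine (by omega) _ _ β ?_
      simp only [arcMap_ket]
      refine arc_cup_cup_flip (f := fun a b c => ket (Function.extend (skip i)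
        (Function.update β p a) (pairStr i b c)))
        (fun c => ?_) (fun a => cupRule_pair i _) fun a b => ?_
      · refine cupRule_of v1 _ (fun a b => ?_) (fun a b => extend_skip_left i _ _ _)
          fun a b k h1 h2 => ?_
        · rw [extend_skip, Function.update_self]
        · rw [extend_update hinj _ _ p, extend_update hinj _ _ p, Function.update_of_ne h1,
            Function.update_of_ne h1]
          by_cases h3 : k = i.succ
          · rw [h3, extend_skip_right, extend_skip_right]
          · exact extend_skip_congr i _ _ _ _ _ k h2 h3
      · refine flipRule_of v2 _ (fun a => extend_skip_right i _ _ _) fun c d k h1 => ?_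
        by_cases h3 : k = i.castSucc
        · rw [h3, extend_skip_left, extend_skip_left]
        · exact extend_skip_congr i _ _ _ _ _ k h3 h1
  · refine ⟨cup _ m (skip i p), barComm_cup _ _ _, fun β => ?_⟩
    have hh : (∃ q : Fin N, (p : ℕ) + 1 = q ∧ (skip i p : ℕ) + 1 = skip i q) ∨
        ((p : ℕ) + 1 = N ∧ (skip i p : ℕ) + 1 = N + 2 ∧ m = m) := by
      by_cases hN : (p : ℕ) + 1 < N
      · refine Or.inl ⟨⟨p + 1, hN⟩, rfl, ?_⟩
        rw [skip_val, skip_val]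
        simp only
        split_ifs <;> omega
      · refine Or.inr ⟨by omega, ?_, rfl⟩
        rw [skip_val]
        split_ifs <;> omega
    simp only [arcMap, LinearMap.add_apply, LinearMap.smul_apply, map_add, map_smul,
      insertMap_cup hinj _ p hh]

theorem extend_const {N N' : ℕ} (e : Fin N → Fin N') :
    Function.extend e (fun _ => one) (fun _ => one) = fun _ => one := by
  funext k
  by_cases hk : ∃ j, e j = k
  · simp [Function.extend_def, hk]
  · simp [hk]

theorem pairStr_one_one {N : ℕ} (i : Fin (N + 1)) : pairStr i one one = fun _ => one := by
  funext k; simp [pairStr]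

theorem moduleBar_arcMap_one {N m : ℕ} (i : Fin (N + 1)) :
    moduleBar (N + 2) m (arcMap i (ket fun _ => one)) = arcMap i (ket fun _ => one) := by
  induction i using Fin.reverseInduction with
  | last =>
    have h1 := cupRule_pair (m := m) (Fin.last N) (fun _ => one)
    have h2 : FlipRule m (cup (N + 2) m (Fin.last N).succ) fun x =>
        ket (Function.extend (skip (Fin.last N)) (fun _ => one) (pairStr (Fin.last N) one x)) :=
      flipRule_of (by simp) _ (fun a => extend_skip_right _ _ _ _) fun c d k h => by
        by_cases h3 : k = (Fin.last N).castSucc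
        · rw [h3, extend_skip_left, extend_skip_left]
        · exact extend_skip_congr _ _ _ _ _ _ k h3 h
    have e : arcMap (Fin.last N) (ket fun _ => one) =
        (cup (N + 2) m (Fin.last N).castSucc * cup (N + 2) m (Fin.last N).succ)
          (ket fun _ => one) := by
      have h3 := h2.apply_one
      rw [pairStr_one_one, extend_const] at h3
      have h4 := h1.one_one
      rw [pairStr_one_one, extend_const] at h4
      rw [Module.End.mul_apply, h3, map_add, map_smul, h4, h1.one_two, arcMap_ket, smul_zero,
        add_zero]
    rw [e]
    exact ((barComm_cup _ _ _).mul (barComm_cup _ _ _)).apply (moduleBar_ket_one _ _)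
  | cast i ih =>
    have key : arcMap i.castSucc (ket fun _ => one) =
        cup (N + 2) m i.castSucc.castSucc (arcMap i.succ (ket fun _ => one)) := by
      have h1 := cupRule_pair (m := m) i.castSucc (fun _ => one)
      have h2 : Function.extend (skip i.succ) (fun _ => one) (pairStr i.succ two one) =
          Function.extend (skip i.castSucc) (fun _ => one) (pairStr i.castSucc one two) := by
        funext k
        by_cases hk : k = i.succ.castSucc
        · rw [hk, extend_skip_left]
          exact (extend_skip_right i.castSucc _ one two).symm
        · have : ∀ (j : Fin (N + 1)) (o : Str (N + 2)), o k = one →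
              Function.extend (skip j) (fun _ => one) o k = one := by
            intro j o ho
            by_cases hj : ∃ x, skip j x = k
            · simp [Function.extend_def, hj]
            · simp [hj, ho]
          rw [this _ _ (by rw [pairStr, if_neg hk])]
          by_cases hk' : k = i.castSucc.castSucc
          · rw [hk', extend_skip_left]
          · have hr : k ∈ Set.range (skip i.castSucc) := by
              by_contra h
              rcases (not_mem_range_skip _ k).mp h with h | h
              · exact hk' h
              · exact hk h
            obtain ⟨j, rfl⟩ := hr
            rw [extend_skip]
      have h3 : cup (N + 2) m i.castSucc.castSucc (ket
          (Function.extend (skip i.succ) (fun _ => one) (pairStr i.succ one two))) = 0 := by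
        refine cup_eq (j := i.succ.castSucc) (by simp) ?_
        have : i.castSucc.castSucc = skip i.succ i := Fin.ext (by simp [skip_val])
        rw [extend_skip_left, this, extend_skip]
      rw [arcMap_ket i.succ, h2, map_add, map_smul, h3, h1.one_two, arcMap_ket, smul_zero,
        add_zero]
    rw [key]
    exact (barComm_cup _ _ _).apply ih

theorem moduleBar_arcMap {N m : ℕ} (i : Fin (N + 1)) (v : MMinus N) :
    moduleBar (N + 2) m (arcMap i v) = arcMap i (moduleBar N m v) :=
  moduleBar_comm_of_intertwine _ (moduleBar_arcMap_one i) (arcMap_cup i) v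

/-! ### Adding a dotted line at the end, for `t_N = 1` -/

theorem dotted_vec_eq {X : Type*} [AddCommGroup X] [Module Ground X]
    {u₁ u₂ : Module.End Ground X} {f : Letter → Letter → X} (h1 : CupRule u₁ f)
    (h2 : ∀ a, FlipRule (0 : ℕ) u₂ (f a)) :
    ((u₂ - 1) * u₁ * (u₂ - 1)) (f one one) = f two two + tp (-1) • f one one := by
  have t1 : ∀ a, (u₂ - 1) (f a one) = f a two := fun a => by
    rw [LinearMap.sub_apply, Module.End.one_apply, (h2 a).apply_one, Nat.cast_zero, neg_zero,
      tp_zero_smul, add_sub_cancel_right]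
  have t2 : ∀ a, (u₂ - 1) (f a two) = f a one := fun a => by
    rw [LinearMap.sub_apply, Module.End.one_apply, (h2 a).apply_two, Nat.cast_zero,
      tp_zero_smul, add_sub_cancel_right]
  rw [Module.End.mul_apply, Module.End.mul_apply, t1, h1.one_two, map_add, map_smul, t1, t2]

theorem flipRule_pair_last {N m : ℕ} (β : Str N) (x : Letter) :
    FlipRule m (cup (N + 2) m (Fin.last N).succ) fun y =>
      ket (Function.extend (skip (Fin.last N)) β (pairStr (Fin.last N) x y)) :=
  flipRule_of (by simp) _ (fun a => extend_skip_right _ _ _ _) fun c d k h => by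
    by_cases h3 : k = (Fin.last N).castSucc
    · rw [h3, extend_skip_left, extend_skip_left]
    · exact extend_skip_congr _ _ _ _ _ _ k h3 h

theorem dottedMap_cup {N : ℕ} (p : Fin N) : ∃ K, BarComm (N + 2) 0 K ∧
    ∀ β, dottedMap N (cup N 0 p (ket β)) = K (dottedMap N (ket β)) := by
  have hinj := skip_injective (Fin.last N)
  by_cases hN : (p : ℕ) + 1 < N
  · refine ⟨cup _ 0 (skip (Fin.last N) p), barComm_cup _ _ _, fun β => ?_⟩
    have hh : (∃ q : Fin N, (p : ℕ) + 1 = q ∧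
        (skip (Fin.last N) p : ℕ) + 1 = skip (Fin.last N) q) ∨
        ((p : ℕ) + 1 = N ∧ (skip (Fin.last N) p : ℕ) + 1 = N + 2 ∧ 0 = 0) :=
      Or.inl ⟨⟨p + 1, hN⟩, rfl, by simp [skip_val, hN]⟩
    simp only [dottedMap, LinearMap.add_apply, LinearMap.smul_apply, map_add, map_smul,
      insertMap_cup hinj _ p hh]
  · have hτ : BarComm (N + 2) 0 (cup _ 0 (Fin.last N).succ - 1) :=
      (barComm_cup _ _ _).sub (barComm_one _ _)
    refine ⟨1 + (cup _ 0 (Fin.last N).succ - 1) * cup _ 0 (Fin.last N).castSucc *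
      (cup _ 0 (Fin.last N).succ - 1) * cup _ 0 (skip (Fin.last N) p) *
      (cup _ 0 (Fin.last N).succ - 1),
      (barComm_one _ _).add ((((hτ.mul (barComm_cup _ _ _)).mul hτ).mul
        (barComm_cup _ _ _)).mul hτ), fun β => ?_⟩
    have v1 : (skip (Fin.last N) p : ℕ) + 1 = (Fin.last N).castSucc := by
      simp [skip_val]; omega
    refine flip_intertwine (by omega) _ _ β ?_
    simp only [dottedMap_ket]
    refine dotted_flip (f := fun a b c => ket (Function.extend (skip (Fin.last N))
      (Function.update β p a) (pairStr (Fin.last N) b c)))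
      (fun c => ?_) (fun a => cupRule_pair (Fin.last N) _) fun a b => flipRule_pair_last _ _
    refine cupRule_of v1 _ (fun a b => ?_) (fun a b => extend_skip_left _ _ _ _)
      fun a b k h1 h2 => ?_
    · rw [extend_skip, Function.update_self]
    · rw [extend_update hinj, extend_update hinj, Function.update_of_ne h1,
        Function.update_of_ne h1]
      by_cases h3 : k = (Fin.last N).succ
      · rw [h3, extend_skip_right, extend_skip_right]
      · exact extend_skip_congr _ _ _ _ _ _ k h2 h3

theorem moduleBar_dottedMap {N : ℕ} (v : MMinus N) :
    moduleBar (N + 2) 0 (dottedMap N v) = dottedMap N (moduleBar N 0 v) := by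
  refine moduleBar_comm_of_intertwine _ ?_ dottedMap_cup v
  have h1 := cupRule_pair (m := 0) (Fin.last N) (fun _ => one)
  have h2 := flipRule_pair_last (m := 0) (N := N) (fun _ => one)
  have hτ : BarComm (N + 2) 0 (cup _ 0 (Fin.last N).succ - 1) :=
    (barComm_cup _ _ _).sub (barComm_one _ _)
  have e : dottedMap N (ket fun _ => one) = ((cup _ 0 (Fin.last N).succ - 1) *
      cup _ 0 (Fin.last N).castSucc * (cup _ 0 (Fin.last N).succ - 1)) (ket fun _ => one) := by
    have h3 : (fun _ : Fin (N + 2) => one) = Function.extend (skip (Fin.last N)) (fun _ => one)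
        (pairStr (Fin.last N) one one) := by rw [pairStr_one_one, extend_const]
    rw [h3, dottedMap_ket]
    exact (dotted_vec_eq h1 h2).symm
  rw [e]
  exact ((hτ.mul (barComm_cup _ _ _)).mul hτ).apply (moduleBar_ket_one _ _)

/-! ### Adding a label at the end -/

/-- The sign of a letter: `-1` for `1` and `1` for `2`. -/
def letterSign (x : Letter) : Ground := if x = two then 1 else -1

/-- The sign `(-1)^r`, where `r` is the number of letters `1`. -/
def strSign {N : ℕ} (α : Str N) : Ground := ∏ k, letterSign (α k)

/-- `m_β ↦ (-1)^r m_β ⊗ (|2⟩ + t^(-m)|1⟩)`, where `r` is the number of letters `1` in `β`. -/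
def labelMap (N m : ℕ) : MMinus N →ₗ[Ground] MMinus (N + 1) :=
  (insertMap Fin.castSucc (fun _ => two) +
    tp (-(m : ℤ)) • insertMap Fin.castSucc (fun _ => one)) ∘ₗ
    (LinearMap.pi fun α => strSign α • LinearMap.proj α)

theorem not_mem_range_castSucc {N : ℕ} (k : Fin (N + 1)) :
    k ∉ Set.range (Fin.castSucc (n := N)) ↔ k = Fin.last N := by
  induction k using Fin.lastCases with
  | last => simp
  | cast k => simp [Fin.ext_iff]; omega

theorem labelMap_apply {N m : ℕ} (v : MMinus N) (γ : Str (N + 1)) :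
    labelMap N m v γ = strSign (γ ∘ Fin.castSucc) * v (γ ∘ Fin.castSucc) *
      (if γ (Fin.last N) = two then 1 else tp (-(m : ℤ))) := by
  simp only [labelMap, LinearMap.comp_apply, LinearMap.add_apply, LinearMap.smul_apply,
    Pi.add_apply, Pi.smul_apply, insertMap_apply (Fin.castSucc_injective N),
    not_mem_range_castSucc, forall_eq, LinearMap.pi_apply, LinearMap.proj_apply, smul_eq_mul]
  cases γ (Fin.last N) <;> simp

theorem labelMap_ket {N m : ℕ} (β : Str N) : labelMap N m (ket β) = strSign β •
    (ket (Function.extend Fin.castSucc β fun _ => two) +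
      tp (-(m : ℤ)) • ket (Function.extend Fin.castSucc β fun _ => one)) := by
  have : (LinearMap.pi fun α => strSign α • LinearMap.proj α : Module.End Ground (MMinus N))
      (ket β) = strSign β • ket β := by
    funext α
    by_cases h : α = β
    · subst h; simp
    · simp [ket, h]
  rw [labelMap, LinearMap.comp_apply, this, map_smul]
  simp only [LinearMap.add_apply, LinearMap.smul_apply, insertMap_ket]

theorem strSign_update {N : ℕ} (β : Str N) (p : Fin N) (a : Letter) :
    strSign (Function.update β p a) =
      letterSign a * ∏ k ∈ Finset.univ.erase p, letterSign (β k) := by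
  rw [strSign, ← Finset.mul_prod_erase _ _ (Finset.mem_univ p), Function.update_self]
  congr 1
  refine Finset.prod_congr rfl fun k hk => ?_
  rw [Function.update_of_ne (Finset.ne_of_mem_erase hk)]

theorem strSign_update_update {N : ℕ} (β : Str N) {p q : Fin N} (h : q ≠ p) (a b : Letter) :
    strSign (Function.update (Function.update β q b) p a) = letterSign a * letterSign b *
      ∏ k ∈ (Finset.univ.erase p).erase q, letterSign (β k) := by
  rw [strSign_update, ← Finset.mul_prod_erase (Finset.univ.erase p) _
    (Finset.mem_erase.mpr ⟨h, Finset.mem_univ q⟩), Function.update_self, mul_assoc]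
  congr 2
  refine Finset.prod_congr rfl fun k hk => ?_
  rw [Function.update_of_ne (Finset.ne_of_mem_erase hk)]

theorem extend_castSucc_last {N : ℕ} (β : Str N) (o : Str (N + 1)) :
    Function.extend Fin.castSucc β o (Fin.last N) = o (Fin.last N) :=
  Function.extend_apply' _ _ _ ((not_mem_range_castSucc _).mpr rfl)

theorem extend_castSucc_congr {N : ℕ} (β : Str N) (o o' : Str (N + 1)) (k : Fin (N + 1))
    (h : k ≠ Fin.last N) :
    Function.extend Fin.castSucc β o k = Function.extend Fin.castSucc β o' k := by
  obtain ⟨j, rfl⟩ : k ∈ Set.range (Fin.castSucc (n := N)) := by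
    by_contra hk; exact h ((not_mem_range_castSucc k).mp hk)
  rw [(Fin.castSucc_injective N).extend_apply, (Fin.castSucc_injective N).extend_apply]

theorem flipRule_last {N m : ℕ} (β : Str N) : FlipRule m (cup (N + 1) m (Fin.last N))
    fun x => ket (Function.extend Fin.castSucc β fun _ => x) :=
  flipRule_of (by simp) _ (fun a => extend_castSucc_last _ _)
    fun a b k h => extend_castSucc_congr _ _ _ k h

theorem labelMap_cup {N m : ℕ} (p : Fin N) : ∃ K, BarComm (N + 1) (m + 1) K ∧
    ∀ β, labelMap N (m + 1) (cup N m p (ket β)) = K (labelMap N (m + 1) (ket β)) := by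
  have hinj := Fin.castSucc_injective N
  by_cases hN : (p : ℕ) + 1 < N
  · obtain ⟨q, hpq⟩ : ∃ q : Fin N, (p : ℕ) + 1 = q := ⟨⟨p + 1, hN⟩, rfl⟩
    have hne : q ≠ p := by simp only [ne_eq, Fin.ext_iff]; omega
    have hne' : q.castSucc ≠ p.castSucc := fun h => hne (hinj h)
    refine ⟨cup _ (m + 1) p.castSucc, barComm_cup _ _ _, fun β => ?_⟩
    refine cup_intertwine hpq _ _ β ?_
    simp only [labelMap_ket, strSign_update_update β hne, extend_update hinj]
    have r : ∀ o : Str (N + 1), CupRule (cup (N + 1) (m + 1) p.castSucc) fun a b => ket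
        (Function.update (Function.update (Function.extend Fin.castSucc β o) q.castSucc b)
          p.castSucc a) := fun o =>
      cupRule_of (q := q.castSucc) (by simpa using hpq) _ (by simp) (by simp [hne'])
        (by intros; simp [*])
    have r2 := r fun _ => two
    have r1 := r fun _ => one
    constructor
    · simp only [map_smul, map_add, r1.one_one, r2.one_one, smul_zero, add_zero]
    · simp only [map_smul, map_add, r1.two_two, r2.two_two, smul_zero, add_zero]
    · simp only [map_smul, map_add, r1.one_two, r2.one_two, mul_comm (letterSign one)]
      module
    · simp only [map_smul, map_add, r1.two_one, r2.two_one, mul_comm (letterSign one)]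
      module
  · refine ⟨(tp m + tp (-m)) • 1 - cup _ (m + 1) (Fin.last N) * cup _ (m + 1) p.castSucc,
      ((barComm_one _ _).smul ?_).sub ((barComm_cup _ _ _).mul (barComm_cup _ _ _)),
      fun β => ?_⟩
    · rw [map_add, LaurentPolynomial.invert_T, LaurentPolynomial.invert_T, neg_neg, add_comm]
    · refine flip_intertwine (by omega) _ _ β ?_
      simp only [labelMap_ket, strSign_update]
      have h := (label_flip (m := m) (u₀ := cup _ (m + 1) p.castSucc)
        (u₁ := cup _ (m + 1) (Fin.last N))
        (f := fun a b => ket (Function.extend Fin.castSucc (Function.update β p a) fun _ => b))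
        (cupRule_of (q := Fin.last N) (by simp; omega) _
          (fun a b => by rw [hinj.extend_apply, Function.update_self])
          (fun a b => extend_castSucc_last _ _) fun a b k h1 h2 => by
            rw [extend_update hinj, extend_update hinj, Function.update_of_ne h1,
              Function.update_of_ne h1, extend_castSucc_congr _ _ _ k h2])
        (fun a => by exact_mod_cast flipRule_last (m := m + 1) _)).congr_smul
        (∏ k ∈ Finset.univ.erase p, letterSign (β k))
      convert h using 1
      funext a
      rw [smul_smul, mul_comm (letterSign a), letterSign, Nat.cast_add, Nat.cast_one]

theorem moduleBar_labelMap {N m : ℕ} (v : MMinus N) :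
    moduleBar (N + 1) (m + 1) (labelMap N (m + 1) v) = labelMap N (m + 1) (moduleBar N m v) := by
  refine moduleBar_comm_of_intertwine _ ?_ labelMap_cup v
  have h := (flipRule_last (m := m + 1) (N := N) fun _ => one).apply_one
  have hs : strSign (fun _ : Fin N => one) = (((-1) ^ N : ℤ) : Ground) := by
    simp [strSign, letterSign]
  rw [extend_const] at h
  rw [labelMap_ket, extend_const, ← h, hs, moduleBar_smul, map_intCast]
  rw [(barComm_cup _ _ _).apply (moduleBar_ket_one _ _)]

/-! ### Arcs and the partition of the places into blocks -/

theorem arc_iff {N : ℕ} (α : Str N) (x y : Fin N) : Arc α x y ↔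
    x < y ∧ α x = two ∧ α y = one ∧
      ∀ k, x < k → k < y → ∃ l, x < l ∧ l < y ∧ (Arc α k l ∨ Arc α l k) := by
  constructor
  · rintro ⟨_, _, hij, hi, hj, p, hb, hl, hr⟩
    refine ⟨hij, hi, hj, fun k h1 h2 => ⟨p k, (hb k h1 h2).1, (hb k h1 h2).2, ?_⟩⟩
    cases hk : α k
    · exact Or.inr (hr k h1 h2 hk)
    · exact Or.inl (hl k h1 h2 hk)
  · rintro ⟨hij, hi, hj, h⟩
    have h' : ∀ k, ∃ l, x < k → k < y → x < l ∧ l < y ∧ (Arc α k l ∨ Arc α l k) := by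
      intro k
      by_cases hk : x < k ∧ k < y
      · obtain ⟨l, hl⟩ := h k hk.1 hk.2
        exact ⟨l, fun _ _ => hl⟩
      · exact ⟨x, fun h1 h2 => (hk ⟨h1, h2⟩).elim⟩
    choose p hp using h'
    have two_of : ∀ a b, Arc α a b → α a = two ∧ α b = one := fun a b hab => by
      cases hab; exact ⟨‹_›, ‹_›⟩
    refine Arc.mk x y hij hi hj p (fun k h1 h2 => ⟨(hp k h1 h2).1, (hp k h1 h2).2.1⟩) ?_ ?_
    · intro k h1 h2 hk
      rcases (hp k h1 h2).2.2 with h3 | h3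
      · exact h3
      · rw [(two_of _ _ h3).2] at hk; cases hk
    · intro k h1 h2 hk
      rcases (hp k h1 h2).2.2 with h3 | h3
      · rw [(two_of _ _ h3).1] at hk; cases hk
      · exact h3

theorem Arc.lt {N : ℕ} {α : Str N} {x y : Fin N} (h : Arc α x y) : x < y :=
  ((arc_iff α x y).mp h).1

theorem Arc.left_two {N : ℕ} {α : Str N} {x y : Fin N} (h : Arc α x y) : α x = two :=
  ((arc_iff α x y).mp h).2.1

theorem Arc.right_one {N : ℕ} {α : Str N} {x y : Fin N} (h : Arc α x y) : α y = one :=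
  ((arc_iff α x y).mp h).2.2.1

theorem Arc.not_both {N : ℕ} {α : Str N} {x y z : Fin N} (h : Arc α x y) (h' : Arc α z x) :
    False := by
  have := h.left_two; rw [h'.right_one] at this; cases this

theorem Arc.exists_right {N : ℕ} {α : Str N} {x y k : Fin N} (h : Arc α x y) (h1 : x < k)
    (h2 : k < y) (hk : α k = two) : ∃ l, x < l ∧ l < y ∧ Arc α k l := by
  obtain ⟨l, h3, h4, h5⟩ := ((arc_iff α x y).mp h).2.2.2 k h1 h2
  rcases h5 with h5 | h5
  · exact ⟨l, h3, h4, h5⟩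
  · rw [h5.right_one] at hk; cases hk

theorem Arc.exists_left {N : ℕ} {α : Str N} {x y k : Fin N} (h : Arc α x y) (h1 : x < k)
    (h2 : k < y) (hk : α k = one) : ∃ l, x < l ∧ l < y ∧ Arc α l k := by
  obtain ⟨l, h3, h4, h5⟩ := ((arc_iff α x y).mp h).2.2.2 k h1 h2
  rcases h5 with h5 | h5
  · rw [h5.left_two] at hk; cases hk
  · exact ⟨l, h3, h4, h5⟩

theorem Arc.not_right_lt {N : ℕ} {α : Str N} : ∀ {n : ℕ} {x y y' : Fin N}, (y' : ℕ) - x ≤ n →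
    Arc α x y → Arc α x y' → ¬ y < y' := by
  intro n
  induction n with
  | zero =>
    intro x y y' hn _ h' _
    have := h'.lt; rw [Fin.lt_def] at this; omega
  | succ n ih =>
    intro x y y' hn h h' hlt
    obtain ⟨l, h1, h2, h3⟩ := h'.exists_left h.lt hlt h.right_one
    obtain ⟨z, h4, h5, h6⟩ := h.exists_right h1 h3.lt h3.left_two
    refine ih ?_ h6 h3 h5
    rw [Fin.lt_def] at h1 hlt; omega

theorem Arc.right_unique {N : ℕ} {α : Str N} {x y y' : Fin N} (h : Arc α x y)
    (h' : Arc α x y') : y = y' :=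
  le_antisymm (_root_.not_lt.mp (Arc.not_right_lt le_rfl h' h)) (_root_.not_lt.mp (Arc.not_right_lt le_rfl h h'))

theorem Arc.left_unique {N : ℕ} {α : Str N} {x x' y : Fin N} (h : Arc α x y)
    (h' : Arc α x' y) : x = x' := by
  have key : ∀ {x x' : Fin N}, Arc α x y → Arc α x' y → ¬ x < x' := by
    intro x x' h h' hlt
    obtain ⟨z, -, h2, h3⟩ := h.exists_right hlt h'.lt h'.left_two
    exact h2.ne (h3.right_unique h')
  exact le_antisymm (_root_.not_lt.mp (key h' h)) (_root_.not_lt.mp (key h h'))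

theorem rank_lt {N : ℕ} {α : Str N} {i j : Fin N} (h : i < j) (hi : UnpairedTwo α i) :
    rank α j < rank α i := by
  classical
  refine Finset.card_lt_card ((Finset.ssubset_iff_of_subset fun k hk => ?_).mpr ⟨i, ?_, ?_⟩)
  · simp only [Finset.mem_filter, Finset.mem_univ, true_and] at hk ⊢
    exact ⟨h.le.trans hk.1, hk.2⟩
  · simp [hi]
  · simp [h]

theorem one_le_rank {N : ℕ} {α : Str N} {i : Fin N} (hi : UnpairedTwo α i) : 1 ≤ rank α i := by
  classical
  exact Finset.card_pos.mpr ⟨i, by simp [hi]⟩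

theorem eq_of_rank_eq {N : ℕ} {α : Str N} {i j : Fin N} (hi : UnpairedTwo α i)
    (hj : UnpairedTwo α j) (h : rank α i = rank α j) : i = j := by
  rcases lt_trichotomy i j with hij | hij | hij
  · exact absurd h (rank_lt hij hi).ne'
  · exact hij
  · exact absurd h (rank_lt hij hj).ne

open Classical in
@[to_additive]
theorem prod_rel_fst {ι M : Type*} [Fintype ι] [CommMonoid M] (R : ι → ι → Prop)
    (h : ∀ x y y', R x y → R x y' → y = y') (δ : ι → M) :
    ∏ p ∈ Finset.univ.filter (fun p : ι × ι => R p.1 p.2), δ p.1 =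
      ∏ x, if ∃ y, R x y then δ x else 1 := by
  rw [← Finset.prod_filter]
  refine Finset.prod_bij (fun p _ => p.1) ?_ ?_ ?_ (fun _ _ => rfl)
  · rintro ⟨x, y⟩ hp
    simp only [Finset.mem_filter, Finset.mem_univ, true_and] at hp ⊢
    exact ⟨y, hp⟩
  · rintro ⟨x, y⟩ hp ⟨x', y'⟩ hp' hx
    simp only [Finset.mem_filter, Finset.mem_univ, true_and] at hp hp' hx
    subst hx
    rw [h x y y' hp hp']
  · intro x hx
    simp only [Finset.mem_filter, Finset.mem_univ, true_and] at hx
    obtain ⟨y, hy⟩ := hx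
    exact ⟨(x, y), by simpa using hy, rfl⟩

open Classical in
@[to_additive]
theorem prod_rel_snd {ι M : Type*} [Fintype ι] [CommMonoid M] (R : ι → ι → Prop)
    (h : ∀ x x' y, R x y → R x' y → x = x') (δ : ι → M) :
    ∏ p ∈ Finset.univ.filter (fun p : ι × ι => R p.1 p.2), δ p.2 =
      ∏ y, if ∃ x, R x y then δ y else 1 := by
  rw [← Finset.prod_filter]
  refine Finset.prod_bij (fun p _ => p.2) ?_ ?_ ?_ (fun _ _ => rfl)
  · rintro ⟨x, y⟩ hp
    simp only [Finset.mem_filter, Finset.mem_univ, true_and] at hp ⊢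
    exact ⟨x, hp⟩
  · rintro ⟨x, y⟩ hp ⟨x', y'⟩ hp' hx
    simp only [Finset.mem_filter, Finset.mem_univ, true_and] at hp hp' hx
    subst hx
    rw [h x x' y hp hp']
  · intro y hy
    simp only [Finset.mem_filter, Finset.mem_univ, true_and] at hy
    obtain ⟨x, hx⟩ := hy
    exact ⟨(x, y), by simpa using hx, rfl⟩

theorem Dotted.not_both {N m : ℕ} {α : Str N} {i j k : Fin N} (h : Dotted m α i j)
    (h' : Dotted m α k i) : False := by
  obtain ⟨-, -, -, h1, h2, ⟨a, ha⟩⟩ := h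
  obtain ⟨-, -, -, h3, h4, ⟨b, hb⟩⟩ := h'
  rw [h1] at hb
  push_cast at hb
  omega

open Classical in
/-- Every place belongs to exactly one block of the link pattern. -/
@[to_additive]
theorem prod_blocks {N : ℕ} {M : Type*} [CommMonoid M] (m : ℕ) (β : Str N) (δ : Fin N → M) :
    ∏ s, δ s =
      (∏ p ∈ Finset.univ.filter (fun p : Fin N × Fin N => Arc β p.1 p.2), δ p.1 * δ p.2) *
      (∏ i ∈ Finset.univ.filter (fun i : Fin N => Labelled m β i), δ i) *
      (∏ p ∈ Finset.univ.filter (fun p : Fin N × Fin N => Dotted m β p.1 p.2),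
        δ p.1 * δ p.2) *
      (∏ i ∈ Finset.univ.filter (fun i : Fin N => Circled m β i), δ i) := by
  rw [Finset.prod_mul_distrib, Finset.prod_mul_distrib,
    prod_rel_fst (Arc β) (fun x y y' h h' => h.right_unique h'),
    prod_rel_snd (Arc β) (fun x x' y h h' => h.left_unique h'),
    prod_rel_fst (Dotted m β) (fun x y y' h h' => eq_of_rank_eq h.2.2.1 h'.2.2.1 (by
      have := h.2.2.2.1; have := h'.2.2.2.1; omega)),
    prod_rel_snd (Dotted m β) (fun x x' y h h' => eq_of_rank_eq h.2.1 h'.2.1 (by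
      have := h.2.2.2.1; have := h'.2.2.2.1; omega)),
    Finset.prod_filter, Finset.prod_filter]
  simp only [← Finset.prod_mul_distrib]
  refine Finset.prod_congr rfl fun s _ => ?_
  cases hs : β s
  · have a1 : ¬ ∃ y, Arc β s y := fun ⟨y, h⟩ => by rw [h.left_two] at hs; cases hs
    have hu : ¬ UnpairedTwo β s := fun h => by rw [h.1] at hs; cases hs
    have a2 : ¬ Labelled m β s := fun h => hu h.1
    have a3 : ¬ ∃ y, Dotted m β s y := fun ⟨y, h⟩ => hu h.2.1
    have a4 : ¬ ∃ y, Dotted m β y s := fun ⟨y, h⟩ => hu h.2.2.1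
    by_cases a5 : ∃ x, Arc β x s
    · have a6 : ¬ Circled m β s := by
        rintro (h | h)
        · exact a5.elim h.2
        · exact hu h.1
      simp only [if_neg a1, if_neg a2, if_neg a3, if_neg a4, if_pos a5, if_neg a6, one_mul,
        mul_one]
    · have a6 : Circled m β s := Or.inl ⟨hs, fun x hx => a5 ⟨x, hx⟩⟩
      simp only [if_neg a1, if_neg a2, if_neg a3, if_neg a4, if_neg a5, if_pos a6, one_mul]
  · have a1 : ¬ ∃ x, Arc β x s := fun ⟨y, h⟩ => by rw [h.right_one] at hs; cases hs
    have hu1 : ¬ UnpairedOne β s := fun h => by rw [h.1] at hs; cases hs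
    by_cases a2 : ∃ y, Arc β s y
    · have hu : ¬ UnpairedTwo β s := fun h => a2.elim h.2
      have a3 : ¬ Labelled m β s := fun h => hu h.1
      have a4 : ¬ ∃ y, Dotted m β s y := fun ⟨y, h⟩ => hu h.2.1
      have a5 : ¬ ∃ y, Dotted m β y s := fun ⟨y, h⟩ => hu h.2.2.1
      have a6 : ¬ Circled m β s := by
        rintro (h | h)
        · exact hu1 h
        · exact hu h.1
      simp only [if_neg a1, if_pos a2, if_neg a3, if_neg a4, if_neg a5, if_neg a6, mul_one]
    · have hu : UnpairedTwo β s := ⟨hs, fun y hy => a2 ⟨y, hy⟩⟩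
      by_cases a3 : Labelled m β s
      · have a4 : ¬ ∃ y, Dotted m β s y := fun ⟨y, h⟩ => by
          have h1 := a3.2; have h2 := h.2.2.2.1; have h3 := h.2.2.2.2.1; omega
        have a5 : ¬ ∃ y, Dotted m β y s := fun ⟨y, h⟩ => by
          have h1 := a3.2; have h3 := h.2.2.2.2.1; omega
        have a6 : ¬ Circled m β s := by
          rintro (h | h)
          · exact hu1 h
          · exact h.2.1 a3
        simp only [if_neg a1, if_neg a2, if_pos a3, if_neg a4, if_neg a5, if_neg a6, mul_one,
          one_mul]
      · by_cases a4 : ∃ y, Dotted m β s y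
        · have a5 : ¬ ∃ y, Dotted m β y s := fun ⟨y, h⟩ => a4.elim fun z hz => hz.not_both h
          have a6 : ¬ Circled m β s := by
            rintro (h | h)
            · exact hu1 h
            · exact a4.elim fun z hz => (h.2.2 z).1 hz
          simp only [if_neg a1, if_neg a2, if_neg a3, if_pos a4, if_neg a5, if_neg a6, mul_one,
            one_mul]
        · by_cases a5 : ∃ y, Dotted m β y s
          · have a6 : ¬ Circled m β s := by
              rintro (h | h)
              · exact hu1 h
              · exact a5.elim fun z hz => (h.2.2 z).2 hz
            simp only [if_neg a1, if_neg a2, if_neg a3, if_neg a4, if_pos a5, if_neg a6,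
              mul_one, one_mul]
          · have a6 : Circled m β s :=
              Or.inr ⟨hu, a3, fun k => ⟨fun h => a4 ⟨k, h⟩, fun h => a5 ⟨k, h⟩⟩⟩
            simp only [if_neg a1, if_neg a2, if_neg a3, if_neg a4, if_neg a5, if_pos a6,
              one_mul]

/-! ### The coefficients of `ϖ(β)` -/

theorem arcVec_apply (x y : Letter) : arcVec (x, y) =
    if x = two then (if y = one then 1 else 0) else (if y = two then tp (-1) else 0) := by
  cases x <;> cases y <;> simp [arcVec, ketTwo]

theorem dottedVec_apply (x y : Letter) : dottedVec (x, y) =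
    if x = two then (if y = two then 1 else 0) else (if y = one then tp (-1) else 0) := by
  cases x <;> cases y <;> simp [dottedVec, ketTwo]

theorem labelVec_apply (m p : ℕ) (x : Letter) : labelVec m p x =
    if x = two then 1 else (-1) ^ (m - p) * tp (-(p : ℤ)) := by
  cases x <;> simp [labelVec, ketOne]

theorem ketOne_apply (x y : Letter) : ketOne x y = if x = y then 1 else 0 := by
  simp [ketOne, Pi.single_apply, eq_comm]

theorem label_bounds {N m : ℕ} {β : Str N} {i : Fin N} (h : Labelled m β i) :
    1 ≤ label m β i ∧ label m β i ≤ m := by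
  have h1 := one_le_rank h.1
  have h2 := h.2
  rw [label]; omega

theorem varpi_diag {N m : ℕ} (β : Str N) : varpi N m β β = 1 := by
  classical
  unfold varpi
  rw [Finset.prod_eq_one, Finset.prod_eq_one, Finset.prod_eq_one, Finset.prod_eq_one]
  · simp
  · intro i _; simp [ketOne_apply]
  · intro p hp
    have h := (Finset.mem_filter.mp hp).2
    simp [dottedVec_apply, h.2.1.1, h.2.2.1.1]
  · intro i hi
    have h := (Finset.mem_filter.mp hi).2
    simp [labelVec_apply, h.1.1]
  · intro p hp
    have h := (Finset.mem_filter.mp hp).2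
    simp [arcVec_apply, h.left_two, h.right_one]

/-- `α` arises from `β` by flipping some blocks of the link pattern of `β`. -/
structure IsFlip {N : ℕ} (m : ℕ) (β α : Str N) : Prop where
  arc : ∀ x y, Arc β x y → α y = !α x
  dotted : ∀ x y, Dotted m β x y → α y = α x
  circled : ∀ x, Circled m β x → α x = β x

theorem isFlip_of_varpi_ne_zero {N m : ℕ} {β α : Str N} (h : varpi N m β α ≠ 0) :
    IsFlip m β α := by
  classical
  unfold varpi at h
  simp only [mul_ne_zero_iff, Finset.prod_ne_zero_iff, Finset.mem_filter, Finset.mem_univ,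
    true_and] at h
  obtain ⟨⟨⟨h1, -⟩, h3⟩, h4⟩ := h
  refine ⟨fun x y hxy => ?_, fun x y hxy => ?_, fun x hx => ?_⟩
  · have := h1 (x, y) hxy
    rw [arcVec_apply] at this
    revert this
    cases α x <;> cases α y <;> simp
  · have := h3 (x, y) hxy
    rw [dottedVec_apply] at this
    revert this
    cases α x <;> cases α y <;> simp
  · have := h4 x hx
    rw [ketOne_apply] at this
    by_contra hne
    exact this (if_neg (Ne.symm hne))

open Classical in
/-- The exponent of `t⁻¹` in the coefficient of `ϖ(β)` at `m_α`. -/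
def flipExp {N : ℕ} (m : ℕ) (β α : Str N) : ℕ :=
  (∑ p ∈ Finset.univ.filter (fun p : Fin N × Fin N => Arc β p.1 p.2),
    if α p.1 = two then 0 else 1) +
  (∑ i ∈ Finset.univ.filter (fun i : Fin N => Labelled m β i),
    if α i = two then 0 else label m β i) +
  (∑ p ∈ Finset.univ.filter (fun p : Fin N × Fin N => Dotted m β p.1 p.2),
    if α p.1 = two then 0 else 1)

theorem tp_add (a b : ℤ) : tp (a + b) = tp a * tp b := LaurentPolynomial.T_add a b

theorem prod_tp_neg {ι : Type*} (s : Finset ι) (k : ι → ℕ) :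
    ∏ i ∈ s, tp (-(k i : ℤ)) = tp (-((∑ i ∈ s, k i : ℕ) : ℤ)) := by
  classical
  induction s using Finset.induction_on with
  | empty => simp
  | insert a s ha ih =>
    rw [Finset.prod_insert ha, Finset.sum_insert ha, ih, ← LaurentPolynomial.T_add]
    congr 1
    push_cast
    ring

theorem IsFlip.varpi_eq {N m : ℕ} {β α : Str N} (h : IsFlip m β α) :
    ∃ ε : ℤ, varpi N m β α = ε • tp (-(flipExp m β α : ℤ)) := by
  classical
  refine ⟨∏ i ∈ Finset.univ.filter (fun i : Fin N => Labelled m β i),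
    if α i = two then 1 else (-1) ^ (m - label m β i), ?_⟩
  have e1 : ∏ p ∈ Finset.univ.filter (fun p : Fin N × Fin N => Arc β p.1 p.2),
      arcVec (α p.1, α p.2) = tp (-((∑ p ∈ Finset.univ.filter
        (fun p : Fin N × Fin N => Arc β p.1 p.2), if α p.1 = two then 0 else 1 : ℕ) : ℤ)) := by
    rw [← prod_tp_neg]
    refine Finset.prod_congr rfl fun p hp => ?_
    have := h.arc _ _ (Finset.mem_filter.mp hp).2
    rw [arcVec_apply, this]
    cases α p.1 <;> simp
  have e3 : ∏ p ∈ Finset.univ.filter (fun p : Fin N × Fin N => Dotted m β p.1 p.2),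
      dottedVec (α p.1, α p.2) = tp (-((∑ p ∈ Finset.univ.filter
        (fun p : Fin N × Fin N => Dotted m β p.1 p.2),
          if α p.1 = two then 0 else 1 : ℕ) : ℤ)) := by
    rw [← prod_tp_neg]
    refine Finset.prod_congr rfl fun p hp => ?_
    have := h.dotted _ _ (Finset.mem_filter.mp hp).2
    rw [dottedVec_apply, this]
    cases α p.1 <;> simp
  have e4 : ∏ i ∈ Finset.univ.filter (fun i : Fin N => Circled m β i),
      ketOne (β i) (α i) = 1 := by
    refine Finset.prod_eq_one fun i hi => ?_
    rw [ketOne_apply, h.circled i (Finset.mem_filter.mp hi).2, if_pos rfl]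
  have e2 : ∏ i ∈ Finset.univ.filter (fun i : Fin N => Labelled m β i),
      labelVec m (label m β i) (α i) =
      ((∏ i ∈ Finset.univ.filter (fun i : Fin N => Labelled m β i),
        if α i = two then 1 else (-1) ^ (m - label m β i) : ℤ) : Ground) *
      tp (-((∑ i ∈ Finset.univ.filter (fun i : Fin N => Labelled m β i),
        if α i = two then 0 else label m β i : ℕ) : ℤ)) := by
    rw [← prod_tp_neg, Int.cast_prod, ← Finset.prod_mul_distrib]
    refine Finset.prod_congr rfl fun i _ => ?_
    rw [labelVec_apply]
    cases α i <;> simp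
  unfold varpi
  rw [e1, e2, e3, e4, flipExp, zsmul_eq_mul, mul_one]
  push_cast
  rw [neg_add, neg_add, tp_add, tp_add]
  ring

/-- The sum of a weight over the places of the letters `2`. -/
def weightSum {N : ℕ} (f : Fin N → ℤ) (α : Str N) : ℤ := ∑ s, if α s = two then f s else 0

theorem IsFlip.weightSum_le {N m : ℕ} {β α : Str N} (h : IsFlip m β α) (f : Fin N → ℤ) (c : ℤ)
    (hc : 0 ≤ c) (h1 : ∀ x y, x < y → c ≤ f x - f y) (h2 : ∀ x, c * m ≤ f x)
    (h3 : ∀ x y, x < y → c ≤ f x + f y) :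
    c * flipExp m β α ≤ weightSum f β - weightSum f α := by
  classical
  rw [weightSum, weightSum, ← Finset.sum_sub_distrib, sum_blocks m β, flipExp]
  push_cast
  rw [mul_add, mul_add, Finset.mul_sum, Finset.mul_sum, Finset.mul_sum]
  refine le_add_of_le_of_nonneg (add_le_add (add_le_add ?_ ?_) ?_) ?_
  · refine Finset.sum_le_sum fun p hp => ?_
    have ha := (Finset.mem_filter.mp hp).2
    have := h1 _ _ ha.lt
    rw [h.arc _ _ ha, ha.left_two, ha.right_one]
    cases α p.1 <;> simp
    linarith
  · refine Finset.sum_le_sum fun i hi => ?_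
    have ha := (Finset.mem_filter.mp hi).2
    have hb : c * (label m β i : ℤ) ≤ c * m :=
      mul_le_mul_of_nonneg_left (by exact_mod_cast (label_bounds ha).2) hc
    have := h2 i
    rw [ha.1.1]
    cases α i <;> simp
    linarith
  · refine Finset.sum_le_sum fun p hp => ?_
    have ha := (Finset.mem_filter.mp hp).2
    have := h3 _ _ ha.1
    rw [h.dotted _ _ ha, ha.2.1.1, ha.2.2.1.1]
    cases α p.1 <;> simp
    linarith
  · refine Finset.sum_nonneg fun i hi => ?_
    rw [h.circled i (Finset.mem_filter.mp hi).2, sub_self]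

theorem IsFlip.eq_of_flipExp_eq_zero {N m : ℕ} {β α : Str N} (h : IsFlip m β α)
    (h0 : flipExp m β α = 0) : α = β := by
  classical
  rw [flipExp] at h0
  simp only [Nat.add_eq_zero_iff, Finset.sum_eq_zero_iff, Finset.mem_filter, Finset.mem_univ,
    true_and] at h0
  obtain ⟨⟨h1, h2⟩, h3⟩ := h0
  have hs : ∑ s, (if α s = β s then 0 else 1 : ℕ) = 0 := by
    rw [sum_blocks m β, Finset.sum_eq_zero, Finset.sum_eq_zero, Finset.sum_eq_zero,
      Finset.sum_eq_zero]
    · rfl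
    · intro i hi
      rw [if_pos (h.circled i (Finset.mem_filter.mp hi).2)]
    · intro p hp
      have ha := (Finset.mem_filter.mp hp).2
      have := h3 p ha
      rw [h.dotted _ _ ha, ha.2.1.1, ha.2.2.1.1]
      by_cases hp : α p.1 = two <;> simp_all
    · intro i hi
      have ha := (Finset.mem_filter.mp hi).2
      have := h2 i ha
      have hl := label_bounds ha
      rw [ha.1.1]
      by_cases hp : α i = two
      · simp [hp]
      · rw [if_neg hp] at this; omega
    · intro p hp
      have ha := (Finset.mem_filter.mp hp).2
      have := h1 p ha
      rw [h.arc _ _ ha, ha.left_two, ha.right_one]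
      by_cases hp : α p.1 = two <;> simp_all
  funext s
  have := Finset.sum_eq_zero_iff.mp hs s (Finset.mem_univ s)
  by_contra hne
  rw [if_neg hne] at this
  cases this

theorem prefixTwos_eq {N : ℕ} (α : Str N) (k : Fin N) :
    (prefixTwos α k : ℤ) = weightSum (fun s => if s ≤ k then 1 else 0) α := by
  rw [prefixTwos, weightSum, Finset.card_filter]
  push_cast
  refine Finset.sum_congr rfl fun s _ => ?_
  by_cases h1 : s ≤ k <;> by_cases h2 : α s = two <;> simp [h1, h2]

theorem IsFlip.sublist {N m : ℕ} {β α : Str N} (h : IsFlip m β α) :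
    (minWord α).Sublist (minWord β) := by
  refine minWord_sublist_of_prefixTwos_le fun k => ?_
  have := h.weightSum_le (fun s => if s ≤ k then 1 else 0) 0 le_rfl
    (fun x y hxy => by
      by_cases h1 : y ≤ k
      · simp [h1, hxy.le.trans h1]
      · simp only [h1, if_false]; split_ifs <;> norm_num)
    (fun x => by simp only [zero_mul]; split_ifs <;> norm_num)
    (fun x y _ => by split_ifs <;> norm_num)
  rw [← prefixTwos_eq, ← prefixTwos_eq] at this
  omega

theorem sum_wt_tailWord {N m : ℕ} (i : Fin N) :
    ((tailWord i).map (wt N m)).sum = m + N - 1 - i := by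
  induction hn : N - 1 - (i : ℕ) generalizing i with
  | zero =>
    have hN : (i : ℕ) + 1 = N := by omega
    rw [tailWord_last i hN, List.map_singleton, List.sum_singleton, wt_last hN]
    omega
  | succ n ih =>
    obtain ⟨j, hij⟩ : ∃ j : Fin N, (i : ℕ) + 1 = j := ⟨⟨i + 1, by omega⟩, rfl⟩
    rw [tailWord_succ i j hij, List.map_cons, List.sum_cons, ih j (by omega),
      wt_lt (by omega)]
    omega

theorem wlen_eq {N m : ℕ} (α : Str N) :
    wlen N m α = weightSum (fun i => (m : ℤ) + N - 1 - i) α := by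
  rw [wlen, minWord_eq, List.flatMap, List.map_flatten, List.sum_flatten, List.map_map,
    List.map_map]
  have : (List.sum ∘ List.map (wt N m)) ∘ tailWord = fun i : Fin N => (m : ℤ) + N - 1 - i :=
    funext fun i => sum_wt_tailWord i
  rw [this]
  rw [List.map_reverse, List.sum_reverse, ← List.sum_toFinset _
    ((List.nodup_finRange N).filter _), weightSum, ← Finset.sum_filter]
  congr 1
  ext i
  simp

theorem IsFlip.flipExp_le {N m : ℕ} {β α : Str N} (h : IsFlip m β α) :
    (flipExp m β α : ℤ) ≤ wlen N m β - wlen N m α := by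
  have := h.weightSum_le (fun i => (m : ℤ) + N - 1 - i) 1 zero_le_one
    (fun x y hxy => by rw [Fin.lt_def] at hxy; omega)
    (fun x => by have := x.isLt; omega)
    (fun x y hxy => by rw [Fin.lt_def] at hxy; omega)
  rw [← wlen_eq, ← wlen_eq, one_mul] at this
  exact this

theorem IsFlip.height_lt {N m : ℕ} {β α : Str N} (h : IsFlip m β α) (hne : α ≠ β) :
    height α < height β := by
  refine lt_of_le_of_ne h.sublist.length_le fun he => hne ?_
  have := h.sublist.eq_of_length he
  rw [← prod_strPerm_minWord α, this, prod_strPerm_minWord]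

/-! ### Link patterns under the removal of letters -/

/-- The places outside the image of `e` may be removed from the link pattern of `α`. -/
structure Removable {N N' : ℕ} (e : Fin N → Fin N') (α : Str N') : Prop where
  strictMono : StrictMono e
  arc_left : ∀ x L, Arc α (e x) L → L ∈ Set.range e
  arc_right : ∀ x L, Arc α L (e x) → L ∈ Set.range e
  between : ∀ x y K, K ∉ Set.range e → e x < K → K < e y →
    ∃ L, e x < L ∧ L < e y ∧ (Arc α K L ∨ Arc α L K)

theorem Removable.arc_iff_comp {N N' : ℕ} {e : Fin N → Fin N'} {α : Str N'}
    (h : Removable e α) (x y : Fin N) : Arc α (e x) (e y) ↔ Arc (α ∘ e) x y := by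
  induction hn : (y : ℕ) - x using Nat.strong_induction_on generalizing x y with
  | _ n ih =>
  have hlt : ∀ {a b}, e a < e b ↔ a < b := h.strictMono.lt_iff_lt
  have ih' : ∀ a b, x < a → a < y → x < b → b < y →
      (Arc α (e a) (e b) ↔ Arc (α ∘ e) a b) := fun a b h1 h2 h3 h4 =>
    ih (b - a) (by rw [Fin.lt_def] at *; omega) a b rfl
  rw [arc_iff, arc_iff, hlt]
  refine and_congr_right fun _ => and_congr_right fun _ => and_congr_right fun _ => ?_
  constructor
  · intro H k h1 h2
    obtain ⟨L, h3, h4, h5⟩ := H (e k) (hlt.mpr h1) (hlt.mpr h2)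
    obtain ⟨l, rfl⟩ : L ∈ Set.range e := h5.elim (h.arc_left k L) (h.arc_right k L)
    rw [hlt] at h3 h4
    rw [ih' k l h1 h2 h3 h4, ih' l k h3 h4 h1 h2] at h5
    exact ⟨l, h3, h4, h5⟩
  · intro H K h1 h2
    by_cases hK : K ∈ Set.range e
    · obtain ⟨k, rfl⟩ := hK
      rw [hlt] at h1 h2
      obtain ⟨l, h3, h4, h5⟩ := H k h1 h2
      rw [← ih' k l h1 h2 h3 h4, ← ih' l k h3 h4 h1 h2] at h5
      exact ⟨e l, hlt.mpr h3, hlt.mpr h4, h5⟩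
    · exact h.between x y K hK h1 h2

theorem Removable.unpairedOne_iff {N N' : ℕ} {e : Fin N → Fin N'} {α : Str N'}
    (h : Removable e α) (k : Fin N) : UnpairedOne α (e k) ↔ UnpairedOne (α ∘ e) k := by
  refine and_congr_right fun _ => ⟨fun H j hj => H (e j) ((h.arc_iff_comp j k).mpr hj),
    fun H J hJ => ?_⟩
  obtain ⟨j, rfl⟩ := h.arc_right k J hJ
  exact H j ((h.arc_iff_comp j k).mp hJ)

theorem Removable.unpairedTwo_iff {N N' : ℕ} {e : Fin N → Fin N'} {α : Str N'}
    (h : Removable e α) (k : Fin N) : UnpairedTwo α (e k) ↔ UnpairedTwo (α ∘ e) k := by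
  refine and_congr_right fun _ => ⟨fun H j hj => H (e j) ((h.arc_iff_comp k j).mpr hj),
    fun H J hJ => ?_⟩
  obtain ⟨j, rfl⟩ := h.arc_left k J hJ
  exact H j ((h.arc_iff_comp k j).mp hJ)

open Classical in
theorem Removable.rank_eq {N N' : ℕ} {e : Fin N → Fin N'} {α : Str N'}
    (h : Removable e α) (S : Finset (Fin N'))
    (hS : ∀ K, K ∈ S ↔ K ∉ Set.range e ∧ UnpairedTwo α K) (k : Fin N)
    (hk : ∀ K ∈ S, e k ≤ K) : rank α (e k) = rank (α ∘ e) k + S.card := by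
  have hd : Disjoint ((Finset.univ.filter fun j => k ≤ j ∧ UnpairedTwo (α ∘ e) j).map
      ⟨e, h.strictMono.injective⟩) S := by
    rw [Finset.disjoint_left]
    intro K hK hK'
    obtain ⟨j, -, rfl⟩ := Finset.mem_map.mp hK
    exact ((hS _).mp hK').1 ⟨j, rfl⟩
  rw [rank, rank, ← Finset.card_map ⟨e, h.strictMono.injective⟩, ← Finset.card_union_of_disjoint hd]
  congr 1
  ext K
  simp only [Finset.mem_filter, Finset.mem_univ, true_and, Finset.mem_union, Finset.mem_map,
    Function.Embedding.coeFn_mk]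
  constructor
  · rintro ⟨h1, h2⟩
    by_cases hK : K ∈ Set.range e
    · obtain ⟨j, rfl⟩ := hK
      exact Or.inl ⟨j, ⟨h.strictMono.le_iff_le.mp h1, (h.unpairedTwo_iff j).mp h2⟩, rfl⟩
    · exact Or.inr ((hS K).mpr ⟨hK, h2⟩)
  · rintro (⟨j, ⟨h1, h2⟩, rfl⟩ | hK)
    · exact ⟨h.strictMono.monotone h1, (h.unpairedTwo_iff j).mpr h2⟩
    · exact ⟨hk K hK, ((hS K).mp hK).2⟩

/-- The removal of the places outside the image of `e` shifts the ranks by `c` in such a way that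
the link pattern with parameter `m'` becomes the one with parameter `m`. -/
structure RemovableShift {N N' : ℕ} (e : Fin N → Fin N') (α : Str N') (m m' c : ℕ) : Prop
    extends Removable e α where
  rank_eq' : ∀ k, rank α (e k) = rank (α ∘ e) k + c
  labelled_shift : ∀ r, 1 ≤ r → (r + c ≤ m' ↔ r ≤ m)
  dotted_shift : ∀ r : ℕ, 1 ≤ r → ((m' + 1 ≤ r + c ∧ Even (((r + c : ℕ) : ℤ) - m' + 1)) ↔
    (m + 1 ≤ r ∧ Even ((r : ℤ) - m + 1)))
  not_dotted_left : ∀ k K, K ∉ Set.range e → ¬ Dotted m' α (e k) K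
  not_dotted_right : ∀ k K, K ∉ Set.range e → ¬ Dotted m' α K (e k)

section Shift

variable {N N' : ℕ} {e : Fin N → Fin N'} {α : Str N'} {m m' c : ℕ}

theorem RemovableShift.labelled_iff (h : RemovableShift e α m m' c) (k : Fin N) :
    Labelled m' α (e k) ↔ Labelled m (α ∘ e) k := by
  rw [Labelled, Labelled, h.unpairedTwo_iff, h.rank_eq']
  exact and_congr_right fun hk => h.labelled_shift _ (one_le_rank hk)

theorem RemovableShift.dotted_iff (h : RemovableShift e α m m' c) (k l : Fin N) :
    Dotted m' α (e k) (e l) ↔ Dotted m (α ∘ e) k l := by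
  rw [Dotted, Dotted, h.unpairedTwo_iff, h.unpairedTwo_iff, h.rank_eq', h.rank_eq',
    h.strictMono.lt_iff_lt]
  refine and_congr_right fun _ => and_congr_right fun _ => and_congr_right fun hl => ?_
  rw [h.dotted_shift _ (one_le_rank hl)]
  exact and_congr_left fun _ => by omega

theorem RemovableShift.circled_iff (h : RemovableShift e α m m' c) (k : Fin N) :
    Circled m' α (e k) ↔ Circled m (α ∘ e) k := by
  rw [Circled, Circled, h.unpairedOne_iff, h.unpairedTwo_iff, h.labelled_iff]
  refine or_congr_right (and_congr_right fun _ => and_congr_right fun _ => ?_)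
  constructor
  · intro H l
    rw [← h.dotted_iff, ← h.dotted_iff]
    exact H (e l)
  · intro H L
    by_cases hL : L ∈ Set.range e
    · obtain ⟨l, rfl⟩ := hL
      rw [h.dotted_iff, h.dotted_iff]
      exact H l
    · exact ⟨h.not_dotted_left k L hL, h.not_dotted_right k L hL⟩

open Classical in
theorem prod_filter_comp {ι ι' M : Type*} [Fintype ι] [Fintype ι'] [CommMonoid M] {E : ι → ι'}
    (hE : Function.Injective E) (P : ι → Prop) (P' : ι' → Prop) (hP : ∀ x, P' (E x) ↔ P x)
    (S : Finset ι') (hS : ∀ y, y ∈ S ↔ P' y ∧ y ∉ Set.range E) (A : ι' → M) :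
    ∏ y ∈ Finset.univ.filter P', A y =
      (∏ x ∈ Finset.univ.filter P, A (E x)) * ∏ y ∈ S, A y := by
  have hd : Disjoint ((Finset.univ.filter P).map ⟨E, hE⟩) S := by
    rw [Finset.disjoint_left]
    intro K hK hK'
    obtain ⟨j, -, rfl⟩ := Finset.mem_map.mp hK
    exact ((hS _).mp hK').2 ⟨j, rfl⟩
  have : Finset.univ.filter P' = (Finset.univ.filter P).map ⟨E, hE⟩ ∪ S := by
    ext y
    simp only [Finset.mem_filter, Finset.mem_univ, true_and, Finset.mem_union, Finset.mem_map,
      Function.Embedding.coeFn_mk, hS]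
    constructor
    · intro hy
      by_cases h : y ∈ Set.range E
      · obtain ⟨x, rfl⟩ := h
        exact Or.inl ⟨x, (hP x).mp hy, rfl⟩
      · exact Or.inr ⟨hy, h⟩
    · rintro (⟨x, hx, rfl⟩ | h)
      · exact (hP x).mpr hx
      · exact h.1
  rw [this, Finset.prod_union hd, Finset.prod_map]
  rfl

theorem RemovableShift.not_mem_range_arc (h : RemovableShift e α m m' c) {p : Fin N' × Fin N'}
    (hp : Arc α p.1 p.2) : p ∉ Set.range (Prod.map e e) ↔ p.1 ∉ Set.range e := by
  refine not_congr ⟨?_, ?_⟩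
  · rintro ⟨q, rfl⟩; exact ⟨q.1, rfl⟩
  · rintro ⟨x, hx⟩
    obtain ⟨y, hy⟩ := h.arc_left x p.2 (hx ▸ hp)
    exact ⟨(x, y), Prod.ext hx hy⟩

theorem RemovableShift.not_mem_range_dotted (h : RemovableShift e α m m' c)
    {p : Fin N' × Fin N'} (hp : Dotted m' α p.1 p.2) :
    p ∉ Set.range (Prod.map e e) ↔ p.1 ∉ Set.range e := by
  refine not_congr ⟨?_, ?_⟩
  · rintro ⟨q, rfl⟩; exact ⟨q.1, rfl⟩
  · rintro ⟨x, hx⟩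
    by_cases hy : p.2 ∈ Set.range e
    · obtain ⟨y, hy⟩ := hy
      exact ⟨(x, y), Prod.ext hx hy⟩
    · exact (h.not_dotted_left x p.2 hy (hx ▸ hp)).elim

open Classical in
/-- The factors of `ϖ(α)` which belong to the blocks outside the image of `e`. -/
theorem RemovableShift.varpi_eq (h : RemovableShift e α m m' c)
    (SA : Finset (Fin N' × Fin N')) (hSA : ∀ p, p ∈ SA ↔ Arc α p.1 p.2 ∧ p.1 ∉ Set.range e)
    (SL : Finset (Fin N')) (hSL : ∀ k, k ∈ SL ↔ Labelled m' α k ∧ k ∉ Set.range e)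
    (SD : Finset (Fin N' × Fin N'))
    (hSD : ∀ p, p ∈ SD ↔ Dotted m' α p.1 p.2 ∧ p.1 ∉ Set.range e)
    (hC : ∀ k, Circled m' α k → k ∈ Set.range e) (γ : Str N') :
    varpi N' m' α γ =
      (∏ p ∈ Finset.univ.filter (fun p : Fin N × Fin N => Arc (α ∘ e) p.1 p.2),
        arcVec ((γ ∘ e) p.1, (γ ∘ e) p.2)) *
      (∏ i ∈ Finset.univ.filter (fun i : Fin N => Labelled m (α ∘ e) i),
        labelVec m' (label m' α (e i)) ((γ ∘ e) i)) *
      (∏ p ∈ Finset.univ.filter (fun p : Fin N × Fin N => Dotted m (α ∘ e) p.1 p.2),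
        dottedVec ((γ ∘ e) p.1, (γ ∘ e) p.2)) *
      (∏ i ∈ Finset.univ.filter (fun i : Fin N => Circled m (α ∘ e) i),
        ketOne ((α ∘ e) i) ((γ ∘ e) i)) *
      ((∏ p ∈ SA, arcVec (γ p.1, γ p.2)) * (∏ i ∈ SL, labelVec m' (label m' α i) (γ i)) *
        ∏ p ∈ SD, dottedVec (γ p.1, γ p.2)) := by
  have hinj := h.strictMono.injective
  have hinj2 : Function.Injective (Prod.map e e) := hinj.prodMap hinj
  unfold varpi
  rw [prod_filter_comp hinj2 (fun p : Fin N × Fin N => Arc (α ∘ e) p.1 p.2) _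
      (fun p => h.arc_iff_comp p.1 p.2) SA
      (fun p => (hSA p).trans (and_congr_right fun hp => (h.not_mem_range_arc hp).symm)),
    prod_filter_comp hinj (fun i : Fin N => Labelled m (α ∘ e) i) _ h.labelled_iff SL hSL,
    prod_filter_comp hinj2 (fun p : Fin N × Fin N => Dotted m (α ∘ e) p.1 p.2) _
      (fun p => h.dotted_iff p.1 p.2) SD
      (fun p => (hSD p).trans (and_congr_right fun hp => (h.not_mem_range_dotted hp).symm)),
    prod_filter_comp hinj (fun i : Fin N => Circled m (α ∘ e) i) _ h.circled_iff ∅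
      (fun k => by simpa using hC k)]
  simp only [Finset.prod_empty, mul_one, Prod.map, Function.comp_apply]
  ring

open Classical in
theorem RemovableShift.varpi_eq_mul (h : RemovableShift e α m m' c)
    (SA : Finset (Fin N' × Fin N')) (hSA : ∀ p, p ∈ SA ↔ Arc α p.1 p.2 ∧ p.1 ∉ Set.range e)
    (hL : ∀ k, Labelled m' α k → k ∈ Set.range e)
    (SD : Finset (Fin N' × Fin N'))
    (hSD : ∀ p, p ∈ SD ↔ Dotted m' α p.1 p.2 ∧ p.1 ∉ Set.range e)
    (hC : ∀ k, Circled m' α k → k ∈ Set.range e)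
    (hlab : ∀ k x, Labelled m (α ∘ e) k →
      labelVec m' (label m' α (e k)) x = labelVec m (label m (α ∘ e) k) x) (γ : Str N') :
    varpi N' m' α γ = varpi N m (α ∘ e) (γ ∘ e) *
      ((∏ p ∈ SA, arcVec (γ p.1, γ p.2)) * ∏ p ∈ SD, dottedVec (γ p.1, γ p.2)) := by
  rw [h.varpi_eq SA hSA ∅ (fun k => by simpa using hL k) SD hSD hC,
    Finset.prod_congr rfl fun k hk => hlab k _ (Finset.mem_filter.mp hk).2, Finset.prod_empty,
    mul_one]
  rfl

end Shift

/-! ### The recursion for `ϖ` -/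

theorem removableShift_arc {N m : ℕ} (i : Fin (N + 1)) {β : Str (N + 2)}
    (h1 : β i.castSucc = two) (h2 : β i.succ = one) : RemovableShift (skip i) β m m 0 ∧
      Arc β i.castSucc i.succ := by
  have ha : Arc β i.castSucc i.succ := by
    rw [arc_iff]
    refine ⟨by rw [Fin.lt_def, Fin.val_castSucc, Fin.val_succ]; omega, h1, h2,
      fun k hk hk' => ?_⟩
    rw [Fin.lt_def, Fin.val_castSucc] at hk
    rw [Fin.lt_def, Fin.val_succ] at hk'
    omega
  have n1 : i.castSucc ∉ Set.range (skip i) := (not_mem_range_skip i _).mpr (Or.inl rfl)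
  have n2 : i.succ ∉ Set.range (skip i) := (not_mem_range_skip i _).mpr (Or.inr rfl)
  have hu : ∀ K, K ∉ Set.range (skip i) → ¬ UnpairedTwo β K := by
    intro K hK hu
    rcases (not_mem_range_skip i K).mp hK with rfl | rfl
    · exact hu.2 _ ha
    · have := hu.1; rw [h2] at this; cases this
  have hr : Removable (skip i) β := by
    refine ⟨skip_strictMono i, fun x L hL => ?_, fun x L hL => ?_, fun x y K hK hx hy => ?_⟩
    · by_contra hn
      rcases (not_mem_range_skip i L).mp hn with rfl | rfl
      · exact ha.not_both hL
      · exact n1 ⟨x, hL.left_unique ha⟩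
    · by_contra hn
      rcases (not_mem_range_skip i L).mp hn with rfl | rfl
      · exact n2 ⟨x, hL.right_unique ha⟩
      · exact hL.not_both ha
    · rcases (not_mem_range_skip i K).mp hK with rfl | rfl
      · refine ⟨i.succ, hx.trans ha.lt, lt_of_le_of_ne ?_ fun he => n2 ⟨y, he.symm⟩, Or.inl ha⟩
        rw [Fin.lt_def, Fin.val_castSucc] at hy
        rw [Fin.le_def, Fin.val_succ]
        omega
      · refine ⟨i.castSucc, lt_of_le_of_ne ?_ fun he => n1 ⟨x, he⟩, ha.lt.trans hy, Or.inr ha⟩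
        rw [Fin.lt_def, Fin.val_succ] at hx
        rw [Fin.le_def, Fin.val_castSucc]
        omega
  refine ⟨⟨hr, fun k => ?_, fun r _ => Iff.rfl, fun r _ => Iff.rfl, fun k K hK hd => ?_,
    fun k K hK hd => ?_⟩, ha⟩
  · exact hr.rank_eq ∅ (fun K => by
      simp only [Finset.notMem_empty, false_iff]
      exact fun h => hu K h.1 h.2) k (by simp)
  · exact hu K hK hd.2.2.1
  · exact hu K hK hd.2.1

theorem varpi_arc {N m : ℕ} (i : Fin (N + 1)) {β : Str (N + 2)}
    (h1 : β i.castSucc = two) (h2 : β i.succ = one) :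
    varpi (N + 2) m β = arcMap i (varpi N m (β ∘ skip i)) := by
  classical
  obtain ⟨hs, ha⟩ := removableShift_arc (m := m) i h1 h2
  have n1 : i.castSucc ∉ Set.range (skip i) := (not_mem_range_skip i _).mpr (Or.inl rfl)
  have hu1 : ¬ UnpairedTwo β i.castSucc := fun h => h.2 _ ha
  have hu2 : ¬ UnpairedTwo β i.succ := fun h => by have := h.1; rw [h2] at this; cases this
  have hu : ∀ K, K ∉ Set.range (skip i) → ¬ UnpairedTwo β K := by
    intro K hK
    rcases (not_mem_range_skip i K).mp hK with rfl | rfl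
    · exact hu1
    · exact hu2
  funext γ
  rw [hs.varpi_eq_mul {(i.castSucc, i.succ)} ?_ ?_ ∅ ?_ ?_ ?_, arcMap_apply,
    Finset.prod_singleton, Finset.prod_empty, mul_one]
  · rintro ⟨x, y⟩
    simp only [Finset.mem_singleton, Prod.mk.injEq]
    constructor
    · rintro ⟨rfl, rfl⟩; exact ⟨ha, n1⟩
    · rintro ⟨h3, h4⟩
      rcases (not_mem_range_skip i x).mp h4 with rfl | rfl
      · exact ⟨rfl, h3.right_unique ha⟩
      · exact (h3.not_both ha).elim
  · intro k hk
    by_contra hn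
    exact hu k hn hk.1
  · intro p
    simp only [Finset.notMem_empty, false_iff]
    exact fun h => hu p.1 h.2 h.1.2.1
  · intro k hk
    by_contra hn
    rcases hk with hk | hk
    · rcases (not_mem_range_skip i k).mp hn with rfl | rfl
      · have := hk.1; rw [h1] at this; cases this
      · exact hk.2 _ ha
    · exact hu k hn hk.1
  · intro k x _
    rw [label, label, hs.rank_eq' k, add_zero]

theorem removable_of_twos {N N' : ℕ} {e : Fin N → Fin N'} (he : StrictMono e) {β : Str N'}
    (h : ∀ K, K ∉ Set.range e → β K = two ∧ ∀ k, e k < K) :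
    Removable e β ∧ ∀ K, K ∉ Set.range e → UnpairedTwo β K := by
  refine ⟨⟨he, fun x L hL => ?_, fun x L hL => ?_, fun x y K hK _ hy => ?_⟩,
    fun K hK => ⟨(h K hK).1, fun L hL => ?_⟩⟩
  · by_contra hn
    have := (h L hn).1; rw [hL.right_one] at this; cases this
  · by_contra hn
    exact lt_asymm hL.lt ((h L hn).2 x)
  · exact (lt_asymm hy ((h K hK).2 y)).elim
  · by_cases hL' : L ∈ Set.range e
    · obtain ⟨l, rfl⟩ := hL'
      exact lt_asymm hL.lt ((h K hK).2 l)
    · have := (h L hL').1; rw [hL.right_one] at this; cases this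

open Classical in
/-- Up to the sign by which it acts on letters, `ϖ` for the parameter `m` has the labels of
the parameter `m + 1`. -/
theorem varpi_sign {N m : ℕ} (β γ : Str N) : strSign β * strSign γ * varpi N m β γ =
    (∏ p ∈ Finset.univ.filter (fun p : Fin N × Fin N => Arc β p.1 p.2), arcVec (γ p.1, γ p.2)) *
    (∏ i ∈ Finset.univ.filter (fun i : Fin N => Labelled m β i),
      labelVec (m + 1) (label m β i) (γ i)) *
    (∏ p ∈ Finset.univ.filter (fun p : Fin N × Fin N => Dotted m β p.1 p.2),
      dottedVec (γ p.1, γ p.2)) *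
    (∏ i ∈ Finset.univ.filter (fun i : Fin N => Circled m β i), ketOne (β i) (γ i)) := by
  rw [strSign, strSign, ← Finset.prod_mul_distrib, prod_blocks m β]
  unfold varpi
  have hr : ∀ a b c d a' b' c' d' : Ground, a * b * c * d * (a' * b' * c' * d') =
      (a * a') * (b * b') * (c * c') * (d * d') := fun _ _ _ _ _ _ _ _ => by ring
  rw [hr]
  simp only [← Finset.prod_mul_distrib]
  refine congrArg₂ (· * ·) (congrArg₂ (· * ·) (congrArg₂ (· * ·) ?_ ?_) ?_) ?_
  · refine Finset.prod_congr rfl fun p hp => ?_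
    have h := (Finset.mem_filter.mp hp).2
    rw [arcVec_apply, h.left_two, h.right_one]
    cases γ p.1 <;> cases γ p.2 <;> simp [letterSign]
  · refine Finset.prod_congr rfl fun i hi => ?_
    have h := (Finset.mem_filter.mp hi).2
    rw [labelVec_apply, labelVec_apply, h.1.1,
      show m + 1 - label m β i = m - label m β i + 1 by have := label_bounds h; omega]
    cases γ i <;> simp [letterSign, pow_succ]
  · refine Finset.prod_congr rfl fun p hp => ?_
    have h := (Finset.mem_filter.mp hp).2
    rw [dottedVec_apply, h.2.1.1, h.2.2.1.1]
    cases γ p.1 <;> cases γ p.2 <;> simp [letterSign]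
  · refine Finset.prod_congr rfl fun i _ => ?_
    rw [ketOne_apply]
    cases γ i <;> cases β i <;> simp [letterSign]

theorem varpi_label {N m : ℕ} {β : Str (N + 1)} (h : β (Fin.last N) = two) :
    varpi (N + 1) (m + 1) β = strSign (β ∘ Fin.castSucc) •
      labelMap N (m + 1) (varpi N m (β ∘ Fin.castSucc)) := by
  classical
  have n1 : Fin.last N ∉ Set.range (Fin.castSucc (n := N)) := (not_mem_range_castSucc _).mpr rfl
  obtain ⟨hr, hu⟩ := removable_of_twos (β := β) Fin.strictMono_castSucc fun K hK => by
    rw [not_mem_range_castSucc] at hK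
    subst hK
    exact ⟨h, Fin.castSucc_lt_last⟩
  have hrk : ∀ k : Fin N, rank β k.castSucc = rank (β ∘ Fin.castSucc) k + 1 := fun k =>
    hr.rank_eq {Fin.last N} (fun K => by
      rw [Finset.mem_singleton, not_mem_range_castSucc]
      exact ⟨fun hK => ⟨hK, hK ▸ hu _ n1⟩, fun hK => hK.1⟩) k (by
        simp only [Finset.mem_singleton, forall_eq]; exact Fin.le_last _)
  have hrl : rank β (Fin.last N) = 1 := by
    rw [rank, Finset.card_eq_one]
    refine ⟨Fin.last N, ?_⟩
    ext K
    simp only [Finset.mem_filter, Finset.mem_univ, true_and, Finset.mem_singleton,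
      Fin.last_le_iff]
    exact ⟨fun hK => hK.1, fun hK => ⟨hK, hK ▸ hu _ n1⟩⟩
  have hs : RemovableShift Fin.castSucc β m (m + 1) 1 := by
    refine ⟨hr, hrk, fun r _ => by omega, fun r _ => ?_, fun k K hK hd => ?_,
      fun k K hK hd => ?_⟩
    · push_cast
      rw [show (r : ℤ) + 1 - (m + 1) + 1 = r - m + 1 by ring]
    · rw [not_mem_range_castSucc] at hK
      subst hK
      have := hd.2.2.2.2.1
      omega
    · rw [not_mem_range_castSucc] at hK
      subst hK
      exact lt_asymm hd.1 (Fin.castSucc_lt_last k)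
  have hl : Labelled (m + 1) β (Fin.last N) := ⟨hu _ n1, by omega⟩
  funext γ
  have hlab : ∀ k, label (m + 1) β (Fin.castSucc k) = label m (β ∘ Fin.castSucc) k :=
    fun k => by rw [label, label, hrk k]; omega
  have hvec : labelVec (m + 1) (label (m + 1) β (Fin.last N)) (γ (Fin.last N)) =
      if γ (Fin.last N) = two then 1 else tp (-((m + 1 : ℕ) : ℤ)) := by
    rw [labelVec_apply, label, hrl]
    simp
  rw [hs.varpi_eq ∅ ?_ {Fin.last N} ?_ ∅ ?_ ?_, Pi.smul_apply, smul_eq_mul, labelMap_apply,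
    Finset.prod_singleton, Finset.prod_empty, Finset.prod_empty, mul_one, one_mul, hvec,
    ← mul_assoc, ← mul_assoc, varpi_sign]
  · simp only [hlab]
  · intro p
    simp only [Finset.notMem_empty, false_iff]
    exact fun h => (hu p.1 h.2).2 _ h.1
  · intro k
    rw [Finset.mem_singleton, not_mem_range_castSucc]
    exact ⟨fun hk => ⟨hk ▸ hl, hk⟩, fun hk => hk.2⟩
  · intro p
    simp only [Finset.notMem_empty, false_iff]
    rintro ⟨h1, h2⟩
    rw [not_mem_range_castSucc] at h2
    have := h1.1
    rw [h2] at this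
    exact absurd this (not_lt.mpr (Fin.le_last _))
  · intro k hk
    by_contra hn
    rw [not_mem_range_castSucc] at hn
    subst hn
    rcases hk with hk | hk
    · have := hk.1; rw [h] at this; cases this
    · exact hk.2.1 hl

theorem varpi_dotted {N : ℕ} {β : Str (N + 2)} (h1 : β (Fin.last N).castSucc = two)
    (h2 : β (Fin.last N).succ = two) :
    varpi (N + 2) 0 β = dottedMap N (varpi N 0 (β ∘ skip (Fin.last N))) := by
  classical
  have hR := not_mem_range_skip (Fin.last N)
  have hne : (Fin.last N).castSucc ≠ (Fin.last N).succ := (castSucc_ne_succ' _).symm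
  have hlt : (Fin.last N).castSucc < (Fin.last N).succ := by simp [Fin.lt_def]
  have hk1 : ∀ k, skip (Fin.last N) k < (Fin.last N).castSucc := fun k => by
    rw [Fin.lt_def, skip_val]; simp
  have n1 := (hR _).mpr (Or.inl rfl)
  have n2 := (hR _).mpr (Or.inr rfl)
  obtain ⟨hr, hu⟩ := removable_of_twos (β := β) (skip_strictMono (Fin.last N)) fun K hK => by
    rcases (hR K).mp hK with rfl | rfl
    · exact ⟨h1, hk1⟩
    · exact ⟨h2, fun k => (hk1 k).trans hlt⟩
  have hrk : ∀ k : Fin N, rank β (skip (Fin.last N) k) =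
      rank (β ∘ skip (Fin.last N)) k + 2 := fun k => by
    have := hr.rank_eq {(Fin.last N).castSucc, (Fin.last N).succ} (fun K => by
      rw [Finset.mem_insert, Finset.mem_singleton, hR]
      exact ⟨fun hK => ⟨hK, hu K ((hR K).mpr hK)⟩, fun hK => hK.1⟩) k (by
        simp only [Finset.mem_insert, Finset.mem_singleton, forall_eq_or_imp, forall_eq]
        exact ⟨(hk1 k).le, ((hk1 k).trans hlt).le⟩)
    rwa [Finset.card_pair hne] at this
  have hle : ∀ K : Fin (N + 2), (Fin.last N).castSucc ≤ K ↔
      K = (Fin.last N).castSucc ∨ K = (Fin.last N).succ := fun K => by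
    simp only [Fin.le_def, Fin.ext_iff, Fin.val_castSucc, Fin.val_last, Fin.val_succ]; omega
  have hle' : ∀ K : Fin (N + 2), (Fin.last N).succ ≤ K ↔ K = (Fin.last N).succ := fun K => by
    simp only [Fin.le_def, Fin.ext_iff, Fin.val_last, Fin.val_succ]; omega
  have hr2 : rank β (Fin.last N).succ = 1 := by
    rw [rank, Finset.card_eq_one]
    refine ⟨(Fin.last N).succ, ?_⟩
    ext K
    simp only [Finset.mem_filter, Finset.mem_univ, true_and, Finset.mem_singleton, hle']
    exact ⟨fun hK => hK.1, fun hK => ⟨hK, hK ▸ hu _ n2⟩⟩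
  have hr1 : rank β (Fin.last N).castSucc = 2 := by
    refine (congrArg Finset.card ?_).trans (Finset.card_pair hne)
    ext K
    simp only [Finset.mem_filter, Finset.mem_univ, true_and, Finset.mem_insert,
      Finset.mem_singleton, hle]
    exact ⟨fun hK => hK.1, fun hK => ⟨hK, hu _ ((hR K).mpr hK)⟩⟩
  have hs : RemovableShift (skip (Fin.last N)) β 0 0 2 := by
    refine ⟨hr, hrk, fun r _ => by omega, fun r hr1 => ?_, fun k K hK hd => ?_,
      fun k K hK hd => ?_⟩
    · push_cast
      rw [show (r : ℤ) + 2 - 0 + 1 = (r - 0 + 1) + 2 by ring, Int.even_add]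
      simp only [even_two, iff_true]
      exact and_congr_left fun _ => ⟨fun _ => hr1, fun _ => trivial⟩
    · rcases (hR K).mp hK with rfl | rfl
      · have := hd.2.2.2.2.2
        rw [hr1] at this
        revert this
        decide
      · have h3 := hd.2.2.2.1
        have h4 := hrk k
        have h5 := one_le_rank ((hr.unpairedTwo_iff k).mp hd.2.1)
        omega
    · rcases (hR K).mp hK with rfl | rfl
      · exact lt_asymm hd.1 (hk1 k)
      · exact lt_asymm hd.1 ((hk1 k).trans hlt)
  have hL : ∀ k, ¬ Labelled 0 β k := fun k hk => by
    have h3 := one_le_rank hk.1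
    have h4 := hk.2
    omega
  have hD : Dotted 0 β (Fin.last N).castSucc (Fin.last N).succ :=
    ⟨hlt, hu _ n1, hu _ n2, by omega, by omega, by rw [hr2]; decide⟩
  funext γ
  rw [hs.varpi_eq_mul ∅ ?_ (fun k hk => (hL k hk).elim)
    {((Fin.last N).castSucc, (Fin.last N).succ)} ?_ ?_
    (fun k x hk => (hL _ ((hs.labelled_iff k).mpr hk)).elim), dottedMap_apply,
    Finset.prod_singleton, Finset.prod_empty, one_mul]
  · intro p
    simp only [Finset.notMem_empty, false_iff]
    exact fun h => (hu p.1 h.2).2 _ h.1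
  · rintro ⟨x, y⟩
    simp only [Finset.mem_singleton, Prod.mk.injEq]
    constructor
    · rintro ⟨rfl, rfl⟩; exact ⟨hD, n1⟩
    · rintro ⟨h3, h4⟩
      have h5 := h3.1
      rcases (hR x).mp h4 with rfl | rfl
      · exact ⟨rfl, ((hle y).mp h5.le).resolve_left h5.ne'⟩
      · exact (h5.ne' ((hle' y).mp h5.le)).elim
  · intro k hk
    by_contra hn
    rcases hk with hk | hk
    · exact absurd (hu k hn).1 (by rw [hk.1]; simp)
    · rcases (hR k).mp hn with rfl | rfl
      · exact (hk.2.2 _).1 hD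
      · exact (hk.2.2 _).2 hD

/-! ### Bar invariance -/

theorem varpi_eq_ket {N m : ℕ} {β : Str N} (h : ∀ k, Circled m β k) : varpi N m β = ket β := by
  funext α
  by_cases hα : α = β
  · subst hα
    rw [varpi_diag]; simp [ket]
  · have h0 : varpi N m β α = 0 := by
      by_contra h1
      exact hα (funext fun k => (isFlip_of_varpi_ne_zero h1).circled k (h k))
    rw [h0]; simp [ket, hα]

theorem moduleBar_varpi_one (N m : ℕ) :
    moduleBar N m (varpi N m fun _ => one) = varpi N m fun _ => one := by
  rw [varpi_eq_ket, moduleBar_ket_one]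
  exact fun k => Or.inl ⟨rfl, fun j hj => by have := hj.left_two; cases this⟩

theorem moduleBar_varpi_one_two {N : ℕ} {β : Str (N + 1)} (h : β (Fin.last N) = two)
    (h' : ∀ k, k ≠ Fin.last N → β k = one) :
    moduleBar (N + 1) 0 (varpi (N + 1) 0 β) = varpi (N + 1) 0 β := by
  have hc : ∀ k, Circled 0 β k := by
    intro k
    by_cases hk : k = Fin.last N
    · subst hk
      have hu : UnpairedTwo β (Fin.last N) :=
        ⟨h, fun j hj => absurd hj.lt (not_lt.mpr (Fin.le_last _))⟩
      refine Or.inr ⟨hu, fun hl => ?_, fun j => ⟨fun hd => ?_, fun hd => ?_⟩⟩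
      · have h3 := one_le_rank hl.1
        have h4 := hl.2
        omega
      · exact absurd hd.1 (not_lt.mpr (Fin.le_last _))
      · have h3 := hd.2.1.1
        rw [h' j hd.1.ne] at h3
        cases h3
    · refine Or.inl ⟨h' k hk, fun j hj => ?_⟩
      have hj' : j = Fin.last N := by
        by_contra hn
        have := hj.left_two
        rw [h' j hn] at this
        cases this
      have := hj.lt
      rw [hj'] at this
      exact absurd this (not_lt.mpr (Fin.le_last _))
  rw [varpi_eq_ket hc]
  have hN : ((Fin.last N : Fin (N + 1)) : ℕ) + 1 = N + 1 := by simp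
  have hβ : β = strRefl (Fin.last N) fun _ => one := by
    funext k
    rw [strRefl_apply_last _ hN]
    split_ifs with hk
    · rw [hk, h]; rfl
    · exact h' k hk
  have hu : IsUp (Fin.last N) (fun _ : Fin (N + 1) => one) := ⟨rfl, fun j hj => by
    have := j.isLt; simp only [Fin.val_last] at hj; omega⟩
  have e := cup_up (m := 0) hu
  rw [wt_last hN, Nat.cast_zero, neg_zero, tp_zero_smul, ← hβ] at e
  have e' : ket β = (cup (N + 1) 0 (Fin.last N) - 1) (ket fun _ => one) := by
    rw [LinearMap.sub_apply, e, Module.End.one_apply, add_sub_cancel_right]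
  rw [e']
  exact ((barComm_cup _ _ _).sub (barComm_one _ _)).apply (moduleBar_ket_one _ _)

theorem invert_strSign {N : ℕ} (α : Str N) : LaurentPolynomial.invert (strSign α) = strSign α := by
  rw [strSign, map_prod]
  refine Finset.prod_congr rfl fun k _ => ?_
  rw [letterSign]
  split_ifs <;> simp

theorem eq_two_of_le {N : ℕ} {β : Str N}
    (h : ¬ ∃ i j : Fin N, (i : ℕ) + 1 = j ∧ β i = two ∧ β j = one) {s : Fin N}
    (hs : β s = two) : ∀ (n : ℕ) (t : Fin N), (t : ℕ) = s + n → β t = two := by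
  intro n
  induction n with
  | zero =>
    intro t ht
    rwa [show t = s from Fin.ext ht]
  | succ n ih =>
    intro t ht
    have h1 := ih ⟨s + n, by omega⟩ rfl
    cases h2 : β t
    · exact (h ⟨⟨s + n, by omega⟩, t, by simp only; omega, h1, h2⟩).elim
    · rfl

theorem moduleBar_varpi (N m : ℕ) (β : Str N) : moduleBar N m (varpi N m β) = varpi N m β := by
  induction N using Nat.strong_induction_on generalizing m with
  | _ N ih =>
  by_cases hd : ∃ i j : Fin N, (i : ℕ) + 1 = j ∧ β i = two ∧ β j = one
  · obtain ⟨i, j, hij, hi, hj⟩ := hd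
    obtain ⟨n, rfl⟩ : ∃ n, N = n + 2 := ⟨N - 2, by omega⟩
    obtain ⟨k, rfl⟩ : ∃ k : Fin (n + 1), i = k.castSucc := ⟨⟨i, by omega⟩, rfl⟩
    obtain rfl : j = k.succ := Fin.ext (by rw [Fin.val_succ, ← hij, Fin.val_castSucc])
    rw [varpi_arc k hi hj, moduleBar_arcMap, ih n (by omega)]
  by_cases h1 : β = fun _ => one
  · rw [h1]; exact moduleBar_varpi_one N m
  obtain ⟨s, hs⟩ : ∃ s, β s = two := by
    by_contra hn
    exact h1 (funext fun s => by
      cases hs : β s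
      · rfl
      · exact (hn ⟨s, hs⟩).elim)
  obtain ⟨n, rfl⟩ : ∃ n, N = n + 1 := ⟨N - 1, by have := s.isLt; omega⟩
  have hlast : β (Fin.last n) = two :=
    eq_two_of_le hd hs (n - s) _ (by rw [Fin.val_last]; omega)
  cases m with
  | succ m =>
    rw [varpi_label hlast, moduleBar_smul, invert_strSign, moduleBar_labelMap, ih n (by omega)]
  | zero =>
    by_cases h2 : ∀ k, k ≠ Fin.last n → β k = one
    · exact moduleBar_varpi_one_two hlast h2
    · push Not at h2
      obtain ⟨k, hk, hk'⟩ := h2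
      have hk2 : β k = two := by simpa using hk'
      have hkn : (k : ℕ) < n := by
        have := k.isLt
        rw [ne_eq, Fin.ext_iff, Fin.val_last] at hk
        omega
      obtain ⟨l, rfl⟩ : ∃ l, n = l + 1 := ⟨n - 1, by omega⟩
      rw [varpi_dotted (eq_two_of_le hd hk2 (l - k) _ (by simp; omega)) hlast,
        moduleBar_dottedMap, ih l (by omega)]

/-! ### The parabolic Kazhdan–Lusztig basis -/

theorem tp_zsmul_mem_negPart (ε : ℤ) {k : ℕ} (hk : 1 ≤ k) : ε • tp (-(k : ℤ)) ∈ negPart :=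
  negPart.zsmul_mem (AddSubgroup.subset_closure ⟨-(k : ℤ), by omega, rfl⟩) ε

theorem coeff_eq_zero_of_mem_negPart {x : Ground} (hx : x ∈ negPart) (n : ℤ) (hn : 0 ≤ n) :
    x.coeff n = 0 := by
  induction hx using AddSubgroup.closure_induction with
  | mem x h =>
    obtain ⟨k, hk, rfl⟩ := h
    exact (LaurentPolynomial.T_apply n k).trans (if_neg (by omega))
  | zero => rfl
  | add x y _ _ hx hy => simp [hx, hy]
  | neg x _ hx => simp [hx]

theorem eq_zero_of_mem_negPart {x : Ground} (hx : x ∈ negPart)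
    (hb : LaurentPolynomial.invert x = x) : x = 0 := by
  refine AddMonoidAlgebra.ext (Finsupp.ext fun n => ?_)
  rcases le_total 0 n with hn | hn
  · exact coeff_eq_zero_of_mem_negPart hx n hn
  · rw [← hb, LaurentPolynomial.invert_apply]
    exact coeff_eq_zero_of_mem_negPart hx (-n) (by omega)

theorem strLE_of_varpi_ne_zero {N m : ℕ} {x y : Str N} (h : varpi N m y x ≠ 0) : StrLE x y :=
  strLE_of_sublist (isFlip_of_varpi_ne_zero h).sublist

theorem strLE_refl {N : ℕ} (x : Str N) : StrLE x x := strLE_of_sublist (List.Sublist.refl _)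

theorem varpi_mem_negPart {N m : ℕ} {x y : Str N} (h : x ≠ y) : varpi N m y x ∈ negPart := by
  by_cases h0 : varpi N m y x = 0
  · rw [h0]; exact zero_mem _
  · have hf := isFlip_of_varpi_ne_zero h0
    obtain ⟨ε, hε⟩ := hf.varpi_eq
    rw [hε]
    refine tp_zsmul_mem_negPart ε (Nat.one_le_iff_ne_zero.mpr fun hk => ?_)
    exact h (hf.eq_of_flipExp_eq_zero hk)

theorem exists_klPolynomial (N m : ℕ) (x y : Str N) : ∃ P : Polynomial ℤ,
    tp (wlen N m x - wlen N m y) * (P.map (Int.castRingHom ℂ)).toLaurent = varpi N m y x := by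
  by_cases h0 : varpi N m y x = 0
  · exact ⟨0, by simp [h0]⟩
  · have hf := isFlip_of_varpi_ne_zero h0
    obtain ⟨ε, hε⟩ := hf.varpi_eq
    have hle := hf.flipExp_le
    obtain ⟨n, hn⟩ := Int.eq_ofNat_of_zero_le (sub_nonneg.mpr hle)
    refine ⟨ε • Polynomial.X ^ n, ?_⟩
    rw [hε, ← Polynomial.coe_mapRingHom, map_zsmul, map_zsmul, mul_smul_comm, map_pow,
      Polynomial.coe_mapRingHom, Polynomial.map_X, Polynomial.toLaurent_X_pow, ← tp_add]
    congr 2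
    omega

theorem sum_smul_varpi_apply {N m : ℕ} (e : Str N → Ground) (x : Str N)
    (h : ∀ y, height x < height y → e y = 0) : (∑ y, e y • varpi N m y) x = e x := by
  rw [Finset.sum_apply, Finset.sum_eq_single x]
  · rw [Pi.smul_apply, varpi_diag, smul_eq_mul, mul_one]
  · intro y _ hy
    rw [Pi.smul_apply, smul_eq_mul]
    by_cases h0 : varpi N m y x = 0
    · rw [h0, mul_zero]
    · rw [h y ((isFlip_of_varpi_ne_zero h0).height_lt hy.symm), zero_mul]
  · simp

theorem eq_zero_of_height {N : ℕ} {e : Str N → Ground}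
    (h : ∀ x, (∀ y, height x < height y → e y = 0) → e x = 0) (x : Str N) : e x = 0 := by
  classical
  by_contra hx
  obtain ⟨y, hy, hmax⟩ := Finset.exists_max_image (Finset.univ.filter fun x => e x ≠ 0) height
    ⟨x, by simpa using hx⟩
  refine (Finset.mem_filter.mp hy).2 (h y fun z hz => ?_)
  by_contra hz'
  exact not_lt.mpr (hmax z (by simpa using hz')) hz

theorem linearIndependent_varpi (N m : ℕ) : LinearIndependent Ground (varpi N m) := by
  rw [Fintype.linearIndependent_iff]
  intro e he
  refine eq_zero_of_height fun x hx => ?_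
  rw [← sum_smul_varpi_apply (m := m) e x hx, he, Pi.zero_apply]

theorem ket_mem_span_varpi {N m : ℕ} (x : Str N) :
    ket x ∈ Submodule.span Ground (Set.range (varpi N m)) := by
  classical
  induction hn : height x using Nat.strong_induction_on generalizing x with
  | _ n ih =>
  have e : ket x = varpi N m x - ∑ y ∈ Finset.univ.erase x, varpi N m x y • ket y := by
    rw [eq_sub_iff_add_eq]
    conv_rhs => rw [eq_sum_ket (varpi N m x),
      ← Finset.add_sum_erase _ _ (Finset.mem_univ x), varpi_diag, one_smul]
  rw [e]
  refine Submodule.sub_mem _ (Submodule.subset_span ⟨x, rfl⟩) (Submodule.sum_mem _ fun y hy => ?_)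
  by_cases h0 : varpi N m x y = 0
  · rw [h0, zero_smul]; exact Submodule.zero_mem _
  · refine Submodule.smul_mem _ _ (ih _ ?_ y rfl)
    rw [← hn]
    exact (isFlip_of_varpi_ne_zero h0).height_lt (Finset.ne_of_mem_erase hy)

/-- The vectors `ϖ(β)` form a basis. -/
def varpiBasis (N m : ℕ) : Module.Basis (Str N) Ground (MMinus N) :=
  Module.Basis.mk (linearIndependent_varpi N m) fun v _ => by
    rw [eq_sum_ket v]
    exact Submodule.sum_mem _ fun x _ => Submodule.smul_mem _ _ (ket_mem_span_varpi x)

theorem varpiBasis_apply (N m : ℕ) (x : Str N) : varpiBasis N m x = varpi N m x :=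
  Module.Basis.mk_apply _ _ _

/-- A bar invariant vector with coefficients in `ℤ(Γ_-)` vanishes. -/
theorem eq_zero_of_moduleBar_eq {N m : ℕ} {v : MMinus N} (hb : moduleBar N m v = v)
    (hv : ∀ x, v x ∈ negPart) : v = 0 := by
  have hs := (varpiBasis N m).sum_repr v
  set e := (varpiBasis N m).repr v with he
  simp only [varpiBasis_apply] at hs
  have hs' : ∑ x, LaurentPolynomial.invert (e x) • varpi N m x = v := by
    rw [← hb, ← hs, moduleBar_sum]
    simp only [moduleBar_smul, moduleBar_varpi]
  have hinv : ∀ x, LaurentPolynomial.invert (e x) = e x := by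
    intro x
    have h0 := Fintype.linearIndependent_iff.mp (linearIndependent_varpi N m)
      (fun x => LaurentPolynomial.invert (e x) - e x) (by
        simp only [sub_smul, Finset.sum_sub_distrib, hs, hs', sub_self]) x
    exact sub_eq_zero.mp h0
  have h0 : ∀ x, e x = 0 := eq_zero_of_height fun x hx => by
    refine eq_zero_of_mem_negPart ?_ (hinv x)
    rw [← sum_smul_varpi_apply (m := m) e x hx, hs]
    exact hv x
  rw [← hs]
  simp [h0]

theorem IsParabolicKLBasis.eq_varpi {N m : ℕ}
    {C : Module.Basis (Str N) Ground (MMinus N)} {P : Str N → Str N → Ground}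
    (h : IsParabolicKLBasis N m C P) (y : Str N) : C y = varpi N m y := by
  classical
  have hc : ∀ x, C y x =
      if StrLE x y then tp (wlen N m x - wlen N m y) * P x y else 0 := by
    intro x
    rw [h.expansion y, Finset.sum_filter, Finset.sum_apply, Finset.sum_eq_single x]
    · split_ifs <;> simp [ket]
    · intro z _ hz
      split_ifs <;> simp [ket, hz.symm]
    · simp
  refine sub_eq_zero.mp (eq_zero_of_moduleBar_eq (m := m) ?_ fun x => ?_)
  · rw [moduleBar_sub, h.bar_eq, moduleBar_varpi]
  · rw [Pi.sub_apply]
    by_cases hx : x = y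
    · subst hx
      rw [hc, if_pos (strLE_refl x), h.diag, varpi_diag, sub_self, tp_zero_eq, mul_one, sub_self]
      exact zero_mem _
    · refine sub_mem ?_ (varpi_mem_negPart hx)
      rw [hc]
      split_ifs with hle
      · exact h.off_diag x y hle hx
      · exact zero_mem _

theorem isParabolicKLBasis_varpi {N m : ℕ} {P : Str N → Str N → Ground}
    (hP : ∀ x y, tp (wlen N m x - wlen N m y) * P x y = varpi N m y x) :
    IsParabolicKLBasis N m (varpiBasis N m) P := by
  classical
  refine ⟨fun y => ?_, fun y => ?_, fun y => ?_, fun x y _ hne => ?_⟩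
  · rw [varpiBasis_apply, moduleBar_varpi]
  · rw [varpiBasis_apply, Finset.sum_filter]
    conv_lhs => rw [eq_sum_ket (varpi N m y)]
    refine Finset.sum_congr rfl fun x _ => ?_
    split_ifs with hle
    · rw [hP]
    · have h0 : varpi N m y x = 0 := by
        by_contra h0
        exact hle (strLE_of_varpi_ne_zero h0)
      rw [h0, zero_smul]
  · have := hP y y
    rwa [sub_self, tp_zero_eq, one_mul, varpi_diag] at this
  · rw [hP]
    exact varpi_mem_negPart hne

end ParabolicKL

end

theorem mainTheorem4 (N m : ℕ) (hm : 1 ≤ m) :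
    ∃ (C : Module.Basis (ParabolicKL.Str N) ParabolicKL.Ground (ParabolicKL.MMinus N))
      (P : ParabolicKL.Str N → ParabolicKL.Str N → Polynomial ℤ),
      (∀ α, C α = ParabolicKL.varpi N m α) ∧
      ParabolicKL.IsParabolicKLBasis N m C
        (fun x y => ((P x y).map (Int.castRingHom ℂ)).toLaurent) ∧
      ∀ (C' : Module.Basis (ParabolicKL.Str N) ParabolicKL.Ground (ParabolicKL.MMinus N))
        (P' : ParabolicKL.Str N → ParabolicKL.Str N → ParabolicKL.Ground),
        ParabolicKL.IsParabolicKLBasis N m C' P' → C' = C := by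
  choose P hP using ParabolicKL.exists_klPolynomial N m
  refine ⟨ParabolicKL.varpiBasis N m, P, ParabolicKL.varpiBasis_apply N m,
    ParabolicKL.isParabolicKLBasis_varpi hP, fun C' P' h => ?_⟩
  exact Module.Basis.eq_of_apply_eq fun y =>
    (h.eq_varpi y).trans (ParabolicKL.varpiBasis_apply N m y).symm
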